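/- Let $p$ and $m\ge 2$ be positive integers and $r$ an integer with $r^p\equiv 1 \pmod m$, and let $G=\langle x,y \mid x^p=y^m=1,\ x^{-1}yx=y^r\rangle$. Suppose that $p$ is the smallest prime divisor of $|G|$ and that $\gcd(p(r-1),m)=1$. A sequence over $G$ is a finite unordered sequence of elements of $G$ with repetition allowed; sequences are multiplied (concatenated) with the symbol $\cdot$, and $g^{[k]}$ denotes the sequence consisting of $k$ copies of $g$. A sequence is product-one if its terms can be ordered so that their product is $1$. Let $\mathsf E(G)$ be the smallest integer $t$ such that every sequence of length $t$ over $G$ has a product-one subsequence of length $|G|$. Then $\mathsf E(G)-1=mp+m+p-3$, and for every sequence $S$ over $G$ of length $|S|=\mathsf E(G)-1$ the following statements are equivalent. (a) $S$ has no product-one subsequence of length $|G|$. (b) $S$ has one of the following forms. (i) If $G\not\cong C_2\ltimes C_3$, then $$S=(x^ay^{b_1})\cdot\ldots\cdot(x^ay^{b_{p-1}})\cdot(y^{c_1})^{[k_1m-1]}\cdot(y^{c_2})^{[k_2m-1]},$$ where $a\in[1,p-1]$, $b_1,\dots,b_{p-1},c_1,c_2\in[0,m-1]$, $\gcd(c_1-c_2,m)=1$,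 and $k_1,k_2$ are positive integers with $k_1+k_2=p+1$. (ii) If $G\cong C_2\ltimes C_3$, then $$S=x\cdot xy\cdot xy^2\cdot 1^{[5]}\quad\text{or}\quad S=(xy^b)\cdot(y^{c_1})^{[5]}\cdot(y^{c_2})^{[2]},$$ where $b,c_1,c_2\in[0,2]$ and $\gcd(c_1-c_2,3)=1$. Here $[u,v]$ denotes the set of integers from $u$ to $v$, and $C_2\ltimes C_3=\langle x,y\mid x^2=y^3=1,\ x^{-1}yx=y^2\rangle$ is the non-abelian group of order $6$. -/

import Mathlib

/-- The metacyclic group `⟨x, y ∣ x ^ p = y ^ m = 1, x⁻¹ y x = y ^ r⟩`; the generators `x` and `y` are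
indexed by `false` and `true`. -/
abbrev MetacyclicGroup (p m : ℕ) (r : ℤ) : Type :=
  PresentedGroup
    ({FreeGroup.of false ^ p, FreeGroup.of true ^ m,
      (FreeGroup.of false)⁻¹ * FreeGroup.of true * FreeGroup.of false * (FreeGroup.of true ^ r)⁻¹} :
      Set (FreeGroup Bool))

namespace MetacyclicGroup

/-- The generator `x`. -/
def x (p m : ℕ) (r : ℤ) : MetacyclicGroup p m r := PresentedGroup.of false

/-- The generator `y`. -/
def y (p m : ℕ) (r : ℤ) : MetacyclicGroup p m r := PresentedGroup.of true

end MetacyclicGroup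

/-! A (finite, unordered) sequence over a group `G` is a multiset `S : Multiset G`; its length is
`S.card`, and its subsequences are the multisets `T ≤ S`. -/

section Sequences

variable {G : Type*} [Group G]

/-- `π(S)`: the set of the products of all terms of `S`, taken in any order. -/
def productSet (S : Multiset G) : Set G :=
  {g | ∃ l : List G, (l : Multiset G) = S ∧ l.prod = g}

/-- `Π_n(S)`: the set of all products of subsequences of `S` of length `n`. -/
def nProductSet (n : ℕ) (S : Multiset G) : Set G :=
  {g | ∃ T : Multiset G, T ≤ S ∧ T.card = n ∧ g ∈ productSet T}

/-- `S` is `|G|`-product-one free: no subsequence of `S` of length `|G|` has product one in any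
order of its terms. -/
def IsCardProductOneFree (S : Multiset G) : Prop :=
  1 ∉ nProductSet (Nat.card G) S

variable (G) in
/-- `E(G)`: the smallest integer `t` such that every sequence of length `t` over `G` contains a
product-one subsequence of length `|G|`. -/
noncomputable def egzConstant : ℕ :=
  sInf {t : ℕ | ∀ S : Multiset G, S.card = t → 1 ∈ nProductSet (Nat.card G) S}

end Sequences

section Extremal

open MetacyclicGroup

/-- `S = (x^a y^{b_1}) ⋯ (x^a y^{b_{p-1}}) ⬝ (y^{c_1})^{[k_1 m - 1]} ⬝ (y^{c_2})^{[k_2 m - 1]}` with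
`a ∈ [1, p-1]`, `b_i, c_1, c_2 ∈ [0, m-1]`, `gcd(c_1 - c_2, m) = 1`, and `k_1, k_2` positive integers
with `k_1 + k_2 = p + 1`. -/
def IsGenericExtremal (p m : ℕ) (r : ℤ) (S : Multiset (MetacyclicGroup p m r)) : Prop :=
  ∃ (a : ℕ) (b : Fin (p - 1) → ℕ) (c₁ c₂ k₁ k₂ : ℕ),
    (1 ≤ a ∧ a ≤ p - 1) ∧ (∀ i, b i ≤ m - 1) ∧ c₁ ≤ m - 1 ∧ c₂ ≤ m - 1 ∧
    Int.gcd ((c₁ : ℤ) - (c₂ : ℤ)) (m : ℤ) = 1 ∧ 1 ≤ k₁ ∧ 1 ≤ k₂ ∧ k₁ + k₂ = p + 1 ∧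
    S = Finset.univ.val.map (fun i => x p m r ^ a * y p m r ^ b i)
      + Multiset.replicate (k₁ * m - 1) (y p m r ^ c₁)
      + Multiset.replicate (k₂ * m - 1) (y p m r ^ c₂)

/-- `S = x ⬝ xy ⬝ xy² ⬝ 1^{[5]}`, or `S = (x y^b) ⬝ (y^{c_1})^{[5]} ⬝ (y^{c_2})^{[2]}` with
`b, c_1, c_2 ∈ [0, 2]` and `gcd(c_1 - c_2, 3) = 1`. -/
def IsExceptionalExtremal (p m : ℕ) (r : ℤ) (S : Multiset (MetacyclicGroup p m r)) : Prop :=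
  S = {x p m r, x p m r * y p m r, x p m r * y p m r ^ 2} + Multiset.replicate 5 1 ∨
  ∃ b c₁ c₂ : ℕ, b ≤ 2 ∧ c₁ ≤ 2 ∧ c₂ ≤ 2 ∧ Int.gcd ((c₁ : ℤ) - (c₂ : ℤ)) 3 = 1 ∧
    S = {x p m r * y p m r ^ b} + Multiset.replicate 5 (y p m r ^ c₁)
      + Multiset.replicate 2 (y p m r ^ c₂)

/-- `G ≅ C_2 ⋉ C_3`, the non-abelian group `⟨x, y ∣ x² = y³ = 1, x⁻¹ y x = y²⟩` of order six. -/
def IsIsoC2C3 (G : Type*) [Group G] : Prop :=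
  Nonempty (G ≃* MetacyclicGroup 2 3 2)

end Extremal

/-! Normal forms x^a y^b identify G with a semidirect product of ℤ/m by ℤ/p. The class a of a
product is additive, and its y-exponent is the sum of the ω(a')b, where b is the exponent of a term,
a' the total class of the terms to its right, and ω(a) = r^a. As r - 1 is a unit, so is every ω(a) -
1 with a ≠ 0. Hence ℤ/p acts on ℤ/m without fixed points: nonzero orbits have exactly p elements, m
= 1 + pβ, and every subgroup of ℤ/m has order congruent to 1 modulo p.

Call a term inner if its class is 0 and outer otherwise, and take mp + m + p - 3 terms without a
product-one subfamily of length mp. Fewer than p - 1 outer terms are impossible by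
Erdős–Ginzburg–Ziv (EGZ) applied to the inner ones. With exactly p - 1, the mp + m - 2 inner terms
are extremal for EGZ and take two values (`ZMod.isTwoValued`). Such inner terms complete any
nonempty outer set of class zero to a product-one family, so the outer classes form a zero-sum free
family of length p - 1 in ℤ/p and are all equal. This is the generic form.

With at least p outer terms, the key point is that p terms of one nonzero class have final segments
of every class. A class-zero block with value v can therefore be inserted so as to contribute ω(j)v
for any j. Cutting the other terms into class-zero blocks of length p leads to a weighted EGZ
problem in ℤ/m: m + β - 1 blocks always suffice, and `IsWeight.weighted_zero_sum` describes what
happens with one block fewer. Consequently only two classes occur (`exists_two_classes`), and each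
nonzero class with at least 2p - 1 terms is constant or consists of three distinct terms with p = 2
(`equal_or_three`). Constant classes are excluded (`not_equal_outer`), and what remains is the
exceptional family in the group of order six.

For odd p it must be shown that some nonzero class has p terms (`exists_le_card_class`). Otherwise
there are few outer terms, so m is small and therefore prime, and a count of the values obtained by
rotating minimal blocks contradicts the maximality of a product-one subfamily.

The value of the constant follows because deleting an inner or an outer term from a longer free
family would leave extremal families with incompatible numbers of outer terms
(`not_productOneFree`). -/

open scoped Pointwise
open Finset
set_option linter.unusedSectionVars false

/-! ### Sumsets, periods and a weak form of Kneser's theorem. -/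

section Sumsets

variable {V : Type*} [AddCommGroup V] [Fintype V] [DecidableEq V]

/-- The stabilizer of a finite set under translation. -/
def Finset.period (X : Finset V) : AddSubgroup V where
  carrier := {v | ∀ x ∈ X, x + v ∈ X}
  add_mem' := by
    intro a b ha hb x hx
    rw [← add_assoc]
    exact hb _ (ha _ hx)
  zero_mem' := by
    intro x hx
    simpa using hx
  neg_mem' := by
    intro a ha x hx
    -- An injective map of a finite set into itself is onto, so stability under a gives stability
    -- under -a.
    have himg : X.image (fun y => y + a) = X := by
      apply Finset.eq_of_subset_of_card_le
      · intro y hy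
        obtain ⟨z, hz, rfl⟩ := Finset.mem_image.1 hy
        exact ha z hz
      · rw [Finset.card_image_of_injective _ (add_left_injective a)]
    rw [← himg] at hx
    obtain ⟨z, hz, rfl⟩ := Finset.mem_image.1 hx
    simpa using hz

namespace Finset

/-- Periods only grow along partial sums. This lets the period of a full sum control the periods of
all its partial sums. -/
lemma period_le_period_add (X A : Finset V) : X.period ≤ (X + A).period := by
  intro v hv x hx
  obtain ⟨y, hy, a, ha, rfl⟩ := Finset.mem_add.1 hx
  rw [add_right_comm]
  exact Finset.add_mem_add (hv y hy) ha

lemma period_eq_top {X : Finset V} (hX : X.Nonempty) (h : X.period = ⊤) : X = univ := by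
  obtain ⟨x, hx⟩ := hX
  ext y
  simp only [mem_univ, iff_true]
  have : (y - x) ∈ X.period := by rw [h]; trivial
  simpa using this x hx

lemma card_subgroup_le {K : AddSubgroup V} {D : Finset V} {x : V} (h : ∀ k ∈ K, x + k ∈ D) :
    Nat.card K ≤ #D := by
  classical
  rw [Nat.card_eq_fintype_card, ← Fintype.card_coe]
  apply Fintype.card_le_of_injective (fun k : K => (⟨x + k, h k k.2⟩ : D))
  intro a b hab
  simp only [Subtype.mk.injEq, add_right_inj] at hab
  exact Subtype.ext hab

/-- The elements of a subgroup, as a finite set. -/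
noncomputable def ofSubgroup (K : AddSubgroup V) : Finset V := by
  classical exact univ.filter (· ∈ K)

lemma mem_ofSubgroup {K : AddSubgroup V} {v : V} : v ∈ ofSubgroup K ↔ v ∈ K := by
  classical
  simp [ofSubgroup]

lemma card_ofSubgroup (K : AddSubgroup V) : #(ofSubgroup K) = Nat.card K := by
  classical
  rw [Nat.card_eq_fintype_card]
  symm
  apply Fintype.card_of_subtype
  intro x
  exact mem_ofSubgroup

lemma ofSubgroup_add_eq {K : AddSubgroup V} {X : Finset V} (h : K ≤ X.period) :
    ofSubgroup K + X = X := by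
  ext y
  constructor
  · intro hy
    obtain ⟨k, hk, x, hx, rfl⟩ := Finset.mem_add.1 hy
    rw [add_comm]
    exact h (mem_ofSubgroup.1 hk) x hx
  · intro hy
    simpa using Finset.add_mem_add (mem_ofSubgroup.2 K.zero_mem) hy

lemma le_period_ofSubgroup_add (K : AddSubgroup V) (X : Finset V) :
    K ≤ (ofSubgroup K + X).period := by
  intro v hv y hy
  obtain ⟨k, hk, x, hx, rfl⟩ := Finset.mem_add.1 hy
  rw [add_right_comm]
  exact Finset.add_mem_add (mem_ofSubgroup.2 (K.add_mem (mem_ofSubgroup.1 hk) hv)) hx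

/-- The difference set of two periodic sets is periodic. -/
lemma sdiff_add_mem {K : AddSubgroup V} {X Y : Finset V} (hX : K ≤ X.period) (hY : K ≤ Y.period)
    {y : V} (hy : y ∈ Y \ X) {k : V} (hk : k ∈ K) : y + k ∈ Y \ X := by
  rw [Finset.mem_sdiff] at hy ⊢
  refine ⟨hY hk y hy.1, fun hc => hy.2 ?_⟩
  have := X.period.neg_mem (hX hk) _ hc
  simpa using this

lemma card_add_card_subgroup_le {K : AddSubgroup V} {X Y : Finset V} (hX : K ≤ X.period)
    (hY : K ≤ Y.period) (hXY : X ⊆ Y) (hne : X ≠ Y) : #X + Nat.card K ≤ #Y := by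
  have hD : (Y \ X).Nonempty := by
    rw [Finset.sdiff_nonempty]
    intro h
    exact hne (subset_antisymm hXY h)
  obtain ⟨y, hy⟩ := hD
  have := card_subgroup_le (fun k hk => sdiff_add_mem hX hY hy hk)
  rw [Finset.card_sdiff_of_subset hXY] at this
  have := Finset.card_le_card hXY
  have : 0 < Nat.card K := Nat.card_pos
  omega

/-- If adding a set does not enlarge `Z`, then the set lies in a coset of the period of `Z`. -/
lemma sub_mem_period_of_card_add_le {Z A : Finset V} (h : #(Z + A) ≤ #Z) {α β : V} (hα : α ∈ A)
    (hβ : β ∈ A) : α - β ∈ Z.period := by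
  -- Each translate of Z already has as many elements as Z + A, so all translates by elements of A
  -- coincide.
  have key : ∀ γ ∈ A, Z.image (fun z => z + γ) = Z + A := by
    intro γ hγ
    apply Finset.eq_of_subset_of_card_le
    · intro y hy
      obtain ⟨z, hz, rfl⟩ := Finset.mem_image.1 hy
      exact Finset.add_mem_add hz hγ
    · rwa [Finset.card_image_of_injective _ (add_left_injective γ)]
  intro z hz
  have h1 : z + α ∈ Z.image (fun z => z + β) := by
    rw [key β hβ, ← key α hα]
    exact Finset.mem_image_of_mem _ hz
  obtain ⟨w, hw, hwz⟩ := Finset.mem_image.1 h1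
  have : z + (α - β) = w := by
    rw [← add_sub_assoc, ← hwz, add_sub_cancel_right]
  rwa [this]

lemma card_le_card_add {Z A : Finset V} (hA : A.Nonempty) : #Z ≤ #(Z + A) :=
  Finset.card_le_card_add_right hA

/-- A lower bound of Kneser type for a sum of sets, each of which enlarges every set with period
`K` by at least `w * |K|` elements. -/
theorem card_sum_growth {ι : Type*} (K : AddSubgroup V) (w : ℕ) (A : ι → Finset V)
    (bad : ι → Prop) [DecidablePred bad] (Q : Finset V → Prop) (F : Finset ι)
    (hQ0 : Q (ofSubgroup K)) (hQ : ∀ i ∈ F, ∀ Z, Q Z → Q (Z + A i))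
    (hA : ∀ i ∈ F, (A i).Nonempty)
    (hgrow : ∀ i ∈ F, bad i → ∀ Z : Finset V, Q Z → Z.period = K → (Z + A i).period = K →
      #Z + w * Nat.card K ≤ #(Z + A i))
    (hper : (ofSubgroup K + ∑ i ∈ F, A i).period = K) :
    Nat.card K * (1 + w * #{i ∈ F | bad i}) ≤ #(ofSubgroup K + ∑ i ∈ F, A i) := by
  classical
  suffices H : ∀ F' ⊆ F, (ofSubgroup K + ∑ i ∈ F', A i).period = K →
      Q (ofSubgroup K + ∑ i ∈ F', A i) ∧
      Nat.card K * (1 + w * #{i ∈ F' | bad i}) ≤ #(ofSubgroup K + ∑ i ∈ F', A i) from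
    (H F subset_rfl hper).2
  intro F'
  induction F' using Finset.induction_on with
  | empty =>
    intro _ _
    simp only [sum_empty, add_zero, filter_empty, card_empty, mul_zero, mul_one]
    exact ⟨hQ0, (card_ofSubgroup K).ge⟩
  | insert i F' hi ih =>
    intro hsub hper'
    have hiF : i ∈ F := hsub (mem_insert_self _ _)
    have hsub' : F' ⊆ F := fun j hj => hsub (mem_insert_of_mem hj)
    have heq : ofSubgroup K + ∑ j ∈ insert i F', A j = (ofSubgroup K + ∑ j ∈ F', A j) + A i := by
      rw [sum_insert hi, add_comm (A i), add_assoc]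
    rw [heq] at hper' ⊢
    -- The period is squeezed: it contains K because of the summand K, and it lies in the period K
    -- of the next partial sum.
    have hper : (ofSubgroup K + ∑ j ∈ F', A j).period = K := by
      apply le_antisymm
      · calc _ ≤ _ := period_le_period_add _ (A i)
          _ = K := hper'
      · exact le_period_ofSubgroup_add K _
    obtain ⟨hq, hc⟩ := ih hsub' hper
    refine ⟨hQ i hiF _ hq, ?_⟩
    rw [filter_insert]
    split_ifs with hb
    · have := hgrow i hiF hb _ hq hper hper'
      rw [card_insert_of_notMem (by simp [hi])]
      calc _ = Nat.card K * (1 + w * #{i ∈ F' | bad i}) + w * Nat.card K := by ring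
        _ ≤ _ := by omega
    · exact hc.trans (card_le_card_add (hA i hiF))

/-- A dichotomy for sums of sets of at least two elements in a subgroup `H`: either few of them
already add up to `H`, or nearly all of them are trivial modulo a proper subgroup. -/
theorem exists_sum_eq_or_subgroup {ι : Type*} [DecidableEq ι] (H : AddSubgroup V)
    (A : ι → Finset V) (c : ι → V) (F Λ₀ : Finset ι) (h₀ : Λ₀ ⊆ F)
    (hAH : ∀ i ∈ F, A i ⊆ ofSubgroup H) (hA : ∀ i ∈ F, (A i).Nonempty)
    (hc : ∀ i ∈ F, ∀ K : AddSubgroup V, (∀ α ∈ A i, ∀ β ∈ A i, α - β ∈ K) → c i ∈ K) :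
    ∃ Λ, Λ₀ ⊆ Λ ∧ Λ ⊆ F ∧ #(∑ i ∈ Λ₀, A i) + #Λ ≤ #(∑ i ∈ Λ, A i) + #Λ₀ ∧
      (∑ i ∈ Λ, A i = ofSubgroup H ∨
        ∃ K < H, ∃ B : Finset ι, (∀ i ∈ F, c i ∉ K → i ∈ B) ∧
          Nat.card K * (#B + 2) ≤ Nat.card H) := by
  classical
  -- Λ is a largest family containing Λ₀ whose sum gains at least one element per additional term.
  let P : Finset (Finset ι) := F.powerset.filter (fun Λ => Λ₀ ⊆ Λ ∧
    #(∑ i ∈ Λ₀, A i) + #Λ ≤ #(∑ i ∈ Λ, A i) + #Λ₀)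
  have hP : P.Nonempty := ⟨Λ₀, by simp [P, h₀]⟩
  obtain ⟨Λ, hΛP, hmax⟩ := Finset.exists_max_image P card hP
  simp only [P, mem_filter, mem_powerset] at hΛP hmax
  obtain ⟨hΛF, hΛ₀, hcard⟩ := hΛP
  refine ⟨Λ, hΛ₀, hΛF, hcard, ?_⟩
  set X := ∑ i ∈ Λ, A i with hX
  have hXH : X ⊆ ofSubgroup H := by
    have : ∀ Λ' ⊆ F, ∑ i ∈ Λ', A i ⊆ ofSubgroup H := by
      intro Λ'
      induction Λ' using Finset.induction_on with
      | empty =>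
        intro _ x hx
        rw [sum_empty, Finset.mem_zero] at hx
        rw [hx, mem_ofSubgroup]
        exact H.zero_mem
      | insert i Λ' hi ih =>
        intro hs x hx
        rw [sum_insert hi] at hx
        obtain ⟨a, ha, b, hb, rfl⟩ := Finset.mem_add.1 hx
        rw [mem_ofSubgroup]
        exact H.add_mem (mem_ofSubgroup.1 (hAH i (hs (mem_insert_self _ _)) ha))
          (mem_ofSubgroup.1 (ih (fun j hj => hs (mem_insert_of_mem hj)) hb))
    exact this Λ hΛF
  have hXne : X.Nonempty := by
    rw [hX]
    have : ∀ Λ' ⊆ F, (∑ i ∈ Λ', A i).Nonempty := by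
      intro Λ'
      induction Λ' using Finset.induction_on with
      | empty => intro _; simp
      | insert i Λ' hi ih =>
        intro hs
        rw [sum_insert hi]
        exact Finset.Nonempty.add (hA i (hs (mem_insert_self _ _)))
          (ih (fun j hj => hs (mem_insert_of_mem hj)))
    exact this Λ hΛF
  obtain ⟨x₀, hx₀⟩ := hXne
  by_cases hXeq : X = ofSubgroup H
  · exact Or.inl hXeq
  right
  set K := X.period with hK
  have hKH : K ≤ H := by
    intro v hv
    have h1 := mem_ofSubgroup.1 (hXH (hv x₀ hx₀))
    have h2 := mem_ofSubgroup.1 (hXH hx₀)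
    simpa using H.sub_mem h1 h2
  have hHper : H ≤ (ofSubgroup H).period := by
    intro v hv y hy
    rw [mem_ofSubgroup] at hy ⊢
    exact H.add_mem hy hv
  have hcardK := card_add_card_subgroup_le (K := K) (X := X) (Y := ofSubgroup H) le_rfl
    (hKH.trans hHper) hXH hXeq
  rw [card_ofSubgroup] at hcardK
  have hKX : ofSubgroup K + X = X := ofSubgroup_add_eq le_rfl
  refine ⟨K, lt_of_le_of_ne hKH ?_, Λ.filter (fun i => c i ∉ K), ?_, ?_⟩
  · intro hKe
    rw [hKe] at hcardK
    have : 0 < #X := card_pos.2 ⟨x₀, hx₀⟩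
    omega
  · intro i hi hci
    by_contra hiB
    have hiΛ : i ∉ Λ := fun h => hiB (by simp [h, hci])
    apply hci
    apply hc i hi
    intro α hα β hβ
    -- By maximality of Λ the unused set `A i` does not enlarge X, so it lies in one coset of the
    -- period of X.
    apply sub_mem_period_of_card_add_le _ hα hβ
    by_contra hlt
    push Not at hlt
    have hins : ∑ j ∈ insert i Λ, A j = X + A i := by rw [sum_insert hiΛ, add_comm]
    have := hmax (insert i Λ) ⟨insert_subset hi hΛF, hΛ₀.trans (subset_insert _ _), by
      rw [hins, card_insert_of_notMem hiΛ]; omega⟩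
    rw [card_insert_of_notMem hiΛ] at this
    omega
  -- Each term of Λ that is nontrivial modulo K gains a coset of K, and at least one coset of K in H
  -- is missed. This gives the summand 2 in `#B + 2`.
  · have := card_sum_growth K 1 A (fun i => c i ∉ K) (fun _ => True) Λ trivial
      (fun _ _ _ _ => trivial) (fun i hi => hA i (hΛF hi)) ?_ ?_
    · rw [← hX, hKX] at this
      calc _ = Nat.card K * (1 + 1 * #{i ∈ Λ | c i ∉ K}) + Nat.card K := by ring
        _ ≤ _ := by omega
    · intro i hi hb Z _ hZ hZA
      obtain ⟨a, ha⟩ := hA i (hΛF hi)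
      have hsub : Z.image (fun z => z + a) ⊆ Z + A i := by
        intro y hy
        obtain ⟨z, hz, rfl⟩ := Finset.mem_image.1 hy
        exact Finset.add_mem_add hz ha
      have hci : #(Z.image (fun z => z + a)) = #Z :=
        Finset.card_image_of_injective _ (add_left_injective a)
      rw [one_mul, ← hci]
      apply card_add_card_subgroup_le _ hZA.ge hsub
      · intro heq
        apply hb
        apply hc i (hΛF hi)
        intro α hα β hβ
        rw [← hZ]
        apply sub_mem_period_of_card_add_le _ hα hβ
        rw [← heq, hci]
      · intro v hv y hy
        obtain ⟨z, hz, rfl⟩ := Finset.mem_image.1 hy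
        rw [← hZ] at hv
        rw [add_right_comm]
        exact Finset.mem_image_of_mem _ (hv z hz)
    · rw [← hX, hKX]

end Finset

end Sumsets

/-! ### The Erdős–Ginzburg–Ziv theorem, iterated and inside subgroups. -/

section ErdosGinzburgZiv

/-- Iterated form of the Erdős–Ginzburg–Ziv theorem. -/
theorem ZMod.exists_card_eq_mul_sum_eq_zero {ι : Type*} {n : ℕ} (hn : 0 < n) (a : ι → ZMod n)
    (q : ℕ) (s : Finset ι) (hs : n * q + n ≤ #s + 1) :
    ∃ t ⊆ s, #t = n * q ∧ ∑ i ∈ t, a i = 0 := by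
  classical
  induction q generalizing s with
  | zero => exact ⟨∅, by simp, by simp, by simp⟩
  | succ q ih =>
    obtain ⟨t, hts, htc, ht⟩ := ZMod.erdos_ginzburg_ziv (s := s) a
      (by have : 0 ≤ n * q := Nat.zero_le _
          rw [mul_add] at hs; omega)
    obtain ⟨u, hus, huc, hu⟩ := ih (s \ t) (by
      rw [Finset.card_sdiff_of_subset hts, htc]
      have := Finset.card_le_card hts
      rw [mul_add] at hs; omega)
    have hd : Disjoint t u := by
      rw [Finset.disjoint_left]
      intro x hx hxu
      exact (Finset.mem_sdiff.1 (hus hxu)).2 hx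
    refine ⟨t ∪ u, Finset.union_subset hts (hus.trans Finset.sdiff_subset), ?_, ?_⟩
    · rw [Finset.card_union_of_disjoint hd, htc, huc]; ring
    · rw [Finset.sum_union hd, ht, hu, add_zero]

/-- The Erdős–Ginzburg–Ziv theorem in a subgroup of `ZMod m`. -/
theorem ZMod.exists_sum_eq_zero_of_mem_subgroup {ι : Type*} {m : ℕ} [NeZero m]
    (K : AddSubgroup (ZMod m)) (a : ι → ZMod m) (M : ℕ) (hM : Nat.card K ∣ M) (s : Finset ι)
    (ha : ∀ i ∈ s, a i ∈ K) (hs : M + Nat.card K ≤ #s + 1) :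
    ∃ t ⊆ s, #t = M ∧ ∑ i ∈ t, a i = 0 := by
  classical
  obtain ⟨q, rfl⟩ := hM
  let e : ZMod (Nat.card K) ≃+ K := zmodAddCyclicAddEquiv inferInstance
  -- The value 0 is a default that is never met: all terms indexed by `s` lie in K.
  let b : ι → K := fun i => if h : a i ∈ K then ⟨a i, h⟩ else 0
  obtain ⟨t, hts, htc, ht⟩ := ZMod.exists_card_eq_mul_sum_eq_zero Nat.card_pos
    (fun i => e.symm (b i)) q s hs
  refine ⟨t, hts, htc, ?_⟩
  rw [← map_sum, EmbeddingLike.map_eq_zero_iff] at ht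
  have h2 : ((∑ i ∈ t, b i : K) : ZMod m) = ∑ i ∈ t, a i := by
    rw [AddSubgroup.val_finsetSum]
    apply Finset.sum_congr rfl
    intro i hi
    simp [b, ha i (hts hi)]
  rw [← h2, ht, AddSubgroup.coe_zero]

end ErdosGinzburgZiv

/-! ### Fixed-point-free weights on ℤ/m and sums of their orbits. -/

lemma ZMod.mul_mem_addSubgroup {m : ℕ} [NeZero m] (K : AddSubgroup (ZMod m)) (x : ZMod m)
    {c : ZMod m} (hc : c ∈ K) : x * c ∈ K := by
  have : x * c = x.val • c := by
    rw [nsmul_eq_mul, ZMod.natCast_zmod_val]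
  rw [this]
  exact K.nsmul_mem hc _

lemma ZMod.mem_of_unit_mul_mem {m : ℕ} [NeZero m] (K : AddSubgroup (ZMod m)) {x c : ZMod m}
    (hx : IsUnit x) (hc : x * c ∈ K) : c ∈ K := by
  obtain ⟨u, rfl⟩ := hx
  have := ZMod.mul_mem_addSubgroup K (↑u⁻¹ : ZMod m) hc
  rwa [Units.inv_mul_cancel_left] at this

/-- A homomorphism from `ZMod p` to the units of `ZMod m` that is fixed point free. -/
structure IsWeight {p m : ℕ} (ω : ZMod p → ZMod m) : Prop where
  map_zero : ω 0 = 1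
  map_add : ∀ a b, ω (a + b) = ω a * ω b
  isUnit_sub_one : ∀ a, a ≠ 0 → IsUnit (ω a - 1)

section Weights

variable {p m : ℕ} [hp : Fact p.Prime] [NeZero m] {ω : ZMod p → ZMod m}

/-- The orbit of `c` under multiplication by the weights. -/
def weightOrbit (ω : ZMod p → ZMod m) (c : ZMod m) : Finset (ZMod m) :=
  univ.image (fun j => ω j * c)

/-- The orbit of `c` together with `0`. -/
def weightHull (ω : ZMod p → ZMod m) (c : ZMod m) : Finset (ZMod m) :=
  insert 0 (weightOrbit ω c)

/-- A set stable under multiplication by the weights. -/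
def WeightStable (ω : ZMod p → ZMod m) (X : Finset (ZMod m)) : Prop :=
  ∀ j, ∀ x ∈ X, ω j * x ∈ X

lemma mem_weightOrbit {c x : ZMod m} : x ∈ weightOrbit ω c ↔ ∃ j, ω j * c = x := by
  simp [weightOrbit]

lemma mem_weightHull {c x : ZMod m} : x ∈ weightHull ω c ↔ x = 0 ∨ ∃ j, ω j * c = x := by
  simp [weightHull, mem_weightOrbit]

lemma zero_mem_weightHull (c : ZMod m) : (0 : ZMod m) ∈ weightHull ω c := mem_insert_self _ _

lemma WeightStable.add {X Y : Finset (ZMod m)} (hX : WeightStable ω X) (hY : WeightStable ω Y) :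
    WeightStable ω (X + Y) := by
  intro j z hz
  obtain ⟨x, hx, y, hy, rfl⟩ := Finset.mem_add.1 hz
  rw [mul_add]
  exact Finset.add_mem_add (hX j x hx) (hY j y hy)

lemma WeightStable.sum {ι : Type*} {F : Finset ι} {A : ι → Finset (ZMod m)}
    (h : ∀ i ∈ F, WeightStable ω (A i)) : WeightStable ω (∑ i ∈ F, A i) := by
  classical
  induction F using Finset.induction_on with
  | empty =>
    intro j x hx
    rw [sum_empty, Finset.mem_zero] at hx ⊢
    rw [hx, mul_zero]
  | insert i F hi ih =>
    rw [sum_insert hi]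
    exact (h i (mem_insert_self _ _)).add (ih fun j hj => h j (mem_insert_of_mem hj))

lemma WeightStable.sdiff {X Y : Finset (ZMod m)} (hω : IsWeight ω) (hX : WeightStable ω X)
    (hY : WeightStable ω Y) : WeightStable ω (X \ Y) := by
  intro j x hx
  rw [Finset.mem_sdiff] at hx ⊢
  refine ⟨hX j x hx.1, fun h => hx.2 ?_⟩
  have := hY (-j) _ h
  rwa [← mul_assoc, ← hω.map_add, neg_add_cancel, hω.map_zero, one_mul] at this

lemma WeightStable.univ : WeightStable ω (univ : Finset (ZMod m)) := fun _ _ _ => mem_univ _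

lemma weightStable_ofSubgroup (K : AddSubgroup (ZMod m)) : WeightStable ω (ofSubgroup K) := by
  intro j x hx
  rw [mem_ofSubgroup] at hx ⊢
  exact ZMod.mul_mem_addSubgroup K _ hx

namespace IsWeight

variable (hω : IsWeight ω)
include hω

lemma isUnit_sub {i j : ZMod p} (h : i ≠ j) : IsUnit (ω i - ω j) := by
  have h1 : ω i - ω j = ω j * (ω (i - j) - 1) := by
    rw [mul_sub, ← hω.map_add, mul_one, add_sub_cancel]
  rw [h1]
  refine IsUnit.mul ?_ (hω.isUnit_sub_one _ (sub_ne_zero.2 h))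
  have : ω j * ω (-j) = 1 := by rw [← hω.map_add, add_neg_cancel, hω.map_zero]
  exact IsUnit.of_mul_eq_one _ this

lemma isUnit (j : ZMod p) : IsUnit (ω j) := by
  have : ω j * ω (-j) = 1 := by rw [← hω.map_add, add_neg_cancel, hω.map_zero]
  exact IsUnit.of_mul_eq_one _ this

/-- Fixed-point-freeness modulo K: the difference of two distinct weights is a unit, and units can
be cancelled because subgroups of ℤ/m are ideals. -/
lemma mem_of_sub_mem {K : AddSubgroup (ZMod m)} {i j : ZMod p} (h : i ≠ j) {c : ZMod m}
    (hc : ω i * c - ω j * c ∈ K) : c ∈ K := by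
  rw [← sub_mul] at hc
  exact ZMod.mem_of_unit_mul_mem K (hω.isUnit_sub h) hc

lemma mul_right_injective {c : ZMod m} (hc : c ≠ 0) : Function.Injective (fun j => ω j * c) := by
  intro i j hij
  by_contra h
  apply hc
  have := hω.mem_of_sub_mem (K := ⊥) h (c := c) (by simp [hij])
  simpa using this

lemma card_weightOrbit {c : ZMod m} (hc : c ≠ 0) : #(weightOrbit ω c) = p := by
  rw [weightOrbit, Finset.card_image_of_injective _ (hω.mul_right_injective hc), card_univ,
    ZMod.card]

lemma stable_weightOrbit (c : ZMod m) : WeightStable ω (weightOrbit ω c) := by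
  intro j x hx
  obtain ⟨i, rfl⟩ := mem_weightOrbit.1 hx
  rw [mem_weightOrbit]
  exact ⟨j + i, by rw [hω.map_add, mul_assoc]⟩

lemma stable_weightHull (c : ZMod m) : WeightStable ω (weightHull ω c) := by
  intro j x hx
  rw [weightHull, mem_insert] at hx ⊢
  rcases hx with rfl | hx
  · left; simp
  · right; exact hω.stable_weightOrbit c j x hx

lemma self_mem_weightOrbit (c : ZMod m) : c ∈ weightOrbit ω c :=
  mem_weightOrbit.2 ⟨0, by rw [hω.map_zero, one_mul]⟩

/-- A weight-stable periodic set that misses the subgroup has at least `p * |K|` elements. -/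
lemma mul_card_le {K : AddSubgroup (ZMod m)} {D : Finset (ZMod m)} (hD : WeightStable ω D)
    (hper : ∀ y ∈ D, ∀ k ∈ K, y + k ∈ D) (hK : ∀ y ∈ D, y ∉ K) (hne : D.Nonempty) :
    p * Nat.card K ≤ #D := by
  classical
  obtain ⟨d, hd⟩ := hne
  -- The p cosets ω(i)d + K lie in D, and they are disjoint because d ∉ K.
  have hinj : Function.Injective (fun x : ZMod p × K =>
      (⟨ω x.1 * d + x.2, hper _ (hD _ _ hd) _ x.2.2⟩ : D)) := by
    rintro ⟨i, k⟩ ⟨j, l⟩ h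
    simp only [Subtype.mk.injEq] at h
    have hij : i = j := by
      by_contra hij
      apply hK d hd
      apply hω.mem_of_sub_mem hij
      have : ω i * d - ω j * d = l - k := by linear_combination h
      rw [this]
      exact K.sub_mem l.2 k.2
    subst hij
    simp only [add_right_inj] at h
    rw [Subtype.ext h]
  have := Fintype.card_le_of_injective _ hinj
  rwa [Fintype.card_prod, ZMod.card, Fintype.card_coe, ← Nat.card_eq_fintype_card] at this

/-- Such a set is a disjoint union of nonzero orbits, each with exactly p elements. Applied to K
without 0, this gives |K| ≡ 1 modulo p. -/
lemma dvd_card_of_stable {D : Finset (ZMod m)} (hD : WeightStable ω D) (h0 : (0 : ZMod m) ∉ D) :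
    p ∣ #D := by
  induction D using Finset.strongInduction with
  | H D ih =>
    by_cases hne : D.Nonempty
    · obtain ⟨d, hd⟩ := hne
      have hsub : weightOrbit ω d ⊆ D := by
        intro x hx
        obtain ⟨j, rfl⟩ := mem_weightOrbit.1 hx
        exact hD j d hd
      have hd0 : d ≠ 0 := fun h => h0 (h ▸ hd)
      have h1 := ih (D \ weightOrbit ω d)
        (Finset.sdiff_ssubset hsub ⟨d, hω.self_mem_weightOrbit d⟩)
        (hD.sdiff hω (hω.stable_weightOrbit d)) (fun h => h0 (mem_sdiff.1 h).1)
      rw [Finset.card_sdiff_of_subset hsub, hω.card_weightOrbit hd0] at h1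
      have h2 := Finset.card_le_card hsub
      rw [hω.card_weightOrbit hd0] at h2
      have := Nat.dvd_add h1 (dvd_refl p)
      rwa [Nat.sub_add_cancel h2] at this
    · rw [Finset.not_nonempty_iff_eq_empty] at hne
      simp [hne]

lemma exists_card_subgroup (K : AddSubgroup (ZMod m)) : ∃ b, Nat.card K = 1 + p * b := by
  have h1 := hω.dvd_card_of_stable (D := (ofSubgroup K).erase 0) (by
    intro j x hx
    rw [mem_erase, mem_ofSubgroup] at hx ⊢
    refine ⟨fun h => hx.1 ?_, ZMod.mul_mem_addSubgroup K _ hx.2⟩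
    exact (hω.isUnit j).mul_right_eq_zero.1 h) (by simp)
  rw [Finset.card_erase_of_mem (mem_ofSubgroup.2 K.zero_mem), card_ofSubgroup] at h1
  obtain ⟨b, hb⟩ := h1
  have : 0 < Nat.card K := Nat.card_pos
  exact ⟨b, by omega⟩

lemma exists_modulus_eq : ∃ b, m = 1 + p * b := by
  obtain ⟨b, hb⟩ := hω.exists_card_subgroup (⊤ : AddSubgroup (ZMod m))
  rw [AddSubgroup.card_top, Nat.card_zmod] at hb
  exact ⟨b, hb⟩

/-- The order and the index of a subgroup of `ZMod m` are both congruent to one modulo `p`. -/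
lemma exists_card_index (K : AddSubgroup (ZMod m)) :
    ∃ a b, Nat.card K = 1 + p * a ∧ m = (1 + p * a) * (1 + p * b) := by
  obtain ⟨a, ha⟩ := hω.exists_card_subgroup K
  obtain ⟨c, hc⟩ := hω.exists_modulus_eq
  have hd : Nat.card K ∣ m := by
    have := K.card_addSubgroup_dvd_card
    rwa [Nat.card_zmod] at this
  obtain ⟨s, hs⟩ := hd
  rw [ha] at hs
  have h1 : s ≡ 1 [MOD p] := by
    have h2 : (1 + p * a) * s ≡ 1 * s [MOD p] := by
      apply Nat.ModEq.mul_right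
      simp [Nat.ModEq]
    rw [← hs, hc, one_mul] at h2
    exact h2.symm.trans (by simp [Nat.ModEq])
  have hs1 : 1 ≤ s := by
    rcases Nat.eq_zero_or_pos s with h | h
    · rw [h, mul_zero] at hs; exact absurd hs (NeZero.ne m)
    · exact h
  obtain ⟨b, hb⟩ := (Nat.modEq_iff_dvd' hs1).1 h1.symm
  refine ⟨a, b, ha, ?_⟩
  rw [hs]
  congr 1
  omega

/-- From m = 1 + pb the inverse of p is -b. -/
lemma isUnit_natCast : IsUnit (p : ZMod m) := by
  obtain ⟨b, hb⟩ := hω.exists_modulus_eq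
  apply IsUnit.of_mul_eq_one (-(b : ZMod m))
  have : ((1 + p * b : ℕ) : ZMod m) = 0 := by rw [← hb]; simp
  push_cast at this
  linear_combination -this

/-- An even m would give a subgroup of order 2, but 2 = 1 + pb has no solution with p ≥ 2. -/
lemma odd_modulus : Odd m := by
  rw [← Nat.not_even_iff_odd]
  rintro ⟨d, hd⟩
  have hd0 : d ≠ 0 := by
    rintro rfl
    exact NeZero.ne m (by omega)
  have hord : addOrderOf ((d : ℕ) : ZMod m) = 2 := by
    rw [ZMod.addOrderOf_coe d (NeZero.ne m)]
    have : Nat.gcd m d = d := by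
      apply Nat.gcd_eq_right
      exact ⟨2, by omega⟩
    rw [this, hd, ← two_mul]
    exact Nat.mul_div_cancel _ (Nat.pos_of_ne_zero hd0)
  obtain ⟨b, hb⟩ := hω.exists_card_subgroup (AddSubgroup.zmultiples ((d : ℕ) : ZMod m))
  rw [Nat.card_zmultiples, hord] at hb
  have h1 : p * b = 1 := by omega
  have := hp.out.two_le
  have := Nat.eq_one_of_mul_eq_one_right h1
  omega

/-- Multiplication by ω(1) permutes the weights, so the sum is annihilated by the unit ω(1) - 1. -/
lemma sum_eq_zero : ∑ j, ω j = 0 := by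
  have h1 : ω 1 * ∑ j, ω j = ∑ j, ω j := by
    rw [Finset.mul_sum]
    simp_rw [← hω.map_add]
    exact Fintype.sum_equiv (Equiv.addLeft 1) _ _ (fun _ => rfl)
  have h2 : (ω 1 - 1) * ∑ j, ω j = 0 := by rw [sub_mul, h1, one_mul, sub_self]
  exact (hω.isUnit_sub_one 1 one_ne_zero).mul_right_eq_zero.1 h2

/-- Weighted sums of a family: either everything is a sum of weighted terms, or nearly all terms
lie in a proper subgroup. -/
theorem hull_dichotomy {ι : Type*} (c : ι → ZMod m) (F : Finset ι) :
    ∑ i ∈ F, weightHull ω (c i) = univ ∨ ∃ K : AddSubgroup (ZMod m), K ≠ ⊤ ∧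
      ∃ B : Finset ι, (∀ i ∈ F, c i ∉ K → i ∈ B) ∧ B ⊆ F ∧
        Nat.card K * (1 + p * #B) ≤ #(∑ i ∈ F, weightHull ω (c i)) ∧
        Nat.card K * (1 + p * #B + p) ≤ m := by
  classical
  set X := ∑ i ∈ F, weightHull ω (c i) with hX
  by_cases hXu : X = univ
  · exact Or.inl hXu
  right
  have hX0 : (0 : ZMod m) ∈ X := by
    rw [hX]
    clear_value X
    clear hX hXu
    induction F using Finset.induction_on with
    | empty => simp
    | insert i F hi ih =>
      rw [sum_insert hi]
      simpa using Finset.add_mem_add (zero_mem_weightHull (ω := ω) (c i)) ih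
  set K := X.period with hK
  have hKX : ofSubgroup K + X = X := ofSubgroup_add_eq le_rfl
  -- The elements gained by a hull outside K form a weight-stable, K-periodic set. It misses K
  -- because partial sums contain 0 and hence K. So `mul_card_le` yields p new cosets of K; the same
  -- reasoning bounds the complement of X below.
  have hmain : Nat.card K * (1 + p * #{i ∈ F | c i ∉ K}) ≤ #X := by
    have := card_sum_growth K p (fun i => weightHull ω (c i)) (fun i => c i ∉ K)
      (fun Z => WeightStable ω Z ∧ (0 : ZMod m) ∈ Z) F
      ⟨weightStable_ofSubgroup K, mem_ofSubgroup.2 K.zero_mem⟩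
      (fun i _ Z hZ => ⟨hZ.1.add (hω.stable_weightHull _), by
        simpa using Finset.add_mem_add hZ.2 (zero_mem_weightHull (ω := ω) (c i))⟩)
      (fun i _ => ⟨0, zero_mem_weightHull _⟩) ?_ (by rw [← hX, hKX])
    · rwa [← hX, hKX] at this
    · intro i _ hci Z hZ hZK hZAK
      have hsub : Z ⊆ Z + weightHull ω (c i) := by
        intro z hz
        simpa using Finset.add_mem_add hz (zero_mem_weightHull (ω := ω) (c i))
      have hlt : ((Z + weightHull ω (c i)) \ Z).Nonempty := by
        rw [Finset.sdiff_nonempty]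
        intro hle
        apply hci
        rw [← hZK]
        have := sub_mem_period_of_card_add_le (Finset.card_le_card hle)
          (mem_insert_of_mem (hω.self_mem_weightOrbit (c i)))
          (zero_mem_weightHull (ω := ω) (c i))
        simpa using this
      have := hω.mul_card_le (K := K) ((hZ.1.add (hω.stable_weightHull _)).sdiff hω hZ.1)
        (fun y hy k hk => sdiff_add_mem hZK.ge hZAK.ge hy hk) (fun y hy hyK => by
          rw [mem_sdiff] at hy
          apply hy.2
          rw [← hZK] at hyK
          simpa using hyK 0 hZ.2) hlt
      rw [card_sdiff_of_subset hsub] at this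
      have := card_le_card hsub
      omega
  have hcompl : #X + p * Nat.card K ≤ m := by
    have hst : WeightStable ω X := WeightStable.sum fun i _ => hω.stable_weightHull _
    have := hω.mul_card_le (K := K) (WeightStable.univ.sdiff hω hst)
        (fun y hy k hk => sdiff_add_mem le_rfl (fun _ _ _ _ => mem_univ _) hy hk)
        (fun y hy hyK => by
          rw [mem_sdiff] at hy
          apply hy.2
          simpa using hyK 0 hX0) (by
          rw [Finset.sdiff_nonempty]
          intro h
          exact hXu (subset_antisymm (subset_univ _) h))
    rw [card_sdiff_of_subset (subset_univ _), card_univ, ZMod.card] at this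
    have := card_le_univ X
    rw [ZMod.card] at this
    omega
  refine ⟨K, ?_, F.filter (fun i => c i ∉ K), fun i hi h => by simp [hi, h], filter_subset _ _,
    hmain, ?_⟩
  · intro h
    exact hXu (period_eq_top ⟨0, hX0⟩ h)
  · calc _ = Nat.card K * (1 + p * #{i ∈ F | c i ∉ K}) + p * Nat.card K := by ring
      _ ≤ _ := by omega

/-- A greedy subfamily whose weighted sums grow by `p` with each term. -/
theorem exists_greedy_hull {ι : Type*} (c : ι → ZMod m) (F : Finset ι)
    (hF : ∑ i ∈ F, weightHull ω (c i) = univ) (b : ℕ) :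
    ∃ Λ ⊆ F, #Λ ≤ b ∧ 1 + p * #Λ ≤ #(∑ i ∈ Λ, weightHull ω (c i)) ∧
      (∑ i ∈ Λ, weightHull ω (c i) = univ ∨ #Λ = b) := by
  classical
  have hzero : ∀ Λ : Finset ι, (0 : ZMod m) ∈ ∑ i ∈ Λ, weightHull ω (c i) := by
    intro Λ
    induction Λ using Finset.induction_on with
    | empty => simp
    | insert i F hi ih =>
      rw [sum_insert hi]
      simpa using Finset.add_mem_add (zero_mem_weightHull (ω := ω) (c i)) ih
  let P : Finset (Finset ι) := F.powerset.filter (fun Λ => #Λ ≤ b ∧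
    1 + p * #Λ ≤ #(∑ i ∈ Λ, weightHull ω (c i)))
  obtain ⟨Λ, hΛP, hmax⟩ := Finset.exists_max_image P card ⟨∅, by simp [P]⟩
  simp only [P, mem_filter, mem_powerset] at hΛP hmax
  obtain ⟨hΛF, hb, hcard⟩ := hΛP
  refine ⟨Λ, hΛF, hb, hcard, ?_⟩
  by_contra hcon
  push Not at hcon
  set X := ∑ i ∈ Λ, weightHull ω (c i) with hX
  have hst : WeightStable ω X := WeightStable.sum fun i _ => hω.stable_weightHull _
  apply hcon.1
  rw [← hF]
  -- A hull that enlarges X gains at least p elements, so by maximality the unused hulls do not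
  -- enlarge it. Then X is already the sum of all hulls.
  have hin : ∀ i ∈ F, i ∉ Λ → c i ∈ X.period := by
    intro i hi hiΛ
    by_contra hci
    have hsub : X ⊆ X + weightHull ω (c i) := by
      intro z hz
      simpa using Finset.add_mem_add hz (zero_mem_weightHull (ω := ω) (c i))
    have hlt : ((X + weightHull ω (c i)) \ X).Nonempty := by
      rw [Finset.sdiff_nonempty]
      intro hle
      apply hci
      have := sub_mem_period_of_card_add_le (Finset.card_le_card hle)
        (mem_insert_of_mem (hω.self_mem_weightOrbit (c i)))
        (zero_mem_weightHull (ω := ω) (c i))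
      simpa using this
    have := hω.mul_card_le (K := ⊥) ((hst.add (hω.stable_weightHull _)).sdiff hω hst)
      (fun y hy k hk => by
        rw [AddSubgroup.mem_bot] at hk
        rwa [hk, add_zero]) (fun y hy hyK => by
        rw [mem_sdiff] at hy
        apply hy.2
        rw [AddSubgroup.mem_bot] at hyK
        rw [hyK]
        exact hzero Λ) hlt
    rw [card_sdiff_of_subset hsub, AddSubgroup.card_bot, mul_one] at this
    have := card_le_card hsub
    have hins : ∑ j ∈ insert i Λ, weightHull ω (c j) = X + weightHull ω (c i) := by
      rw [sum_insert hiΛ, add_comm]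
    have := hmax (insert i Λ) ⟨insert_subset hi hΛF, by
      rw [card_insert_of_notMem hiΛ]
      have := lt_of_le_of_ne hb hcon.2
      omega, by
      rw [hins, card_insert_of_notMem hiΛ]
      calc 1 + p * (#Λ + 1) = (1 + p * #Λ) + p := by ring
        _ ≤ _ := by omega⟩
    rw [card_insert_of_notMem hiΛ] at this
    omega
  have hrest : ∀ G : Finset ι, G ⊆ F → Disjoint Λ G →
      X + ∑ i ∈ G, weightHull ω (c i) = X := by
    intro G
    induction G using Finset.induction_on with
    | empty => intro _ _; simp
    | insert i G hi ih =>
      intro hGF hd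
      rw [sum_insert hi, add_left_comm, ih (fun j hj => hGF (mem_insert_of_mem hj))
        (hd.mono_right (subset_insert _ _))]
      have hciX := hin i (hGF (mem_insert_self _ _))
        (fun h => disjoint_left.1 hd h (mem_insert_self _ _))
      apply subset_antisymm
      · intro y hy
        obtain ⟨a, ha, x, hx, rfl⟩ := Finset.mem_add.1 hy
        rw [mem_weightHull] at ha
        rcases ha with rfl | ⟨j, rfl⟩
        · simpa using hx
        · rw [add_comm]
          exact ZMod.mul_mem_addSubgroup X.period (ω j) hciX x hx
      · intro z hz
        simpa using Finset.add_mem_add (zero_mem_weightHull (ω := ω) (c i)) hz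
  rw [← hrest (F \ Λ) sdiff_subset disjoint_sdiff, hX, ← Finset.sum_sdiff hΛF, add_comm]

end IsWeight

end Weights

/-! ### The weighted Erdős–Ginzburg–Ziv theorem and its extremal case. -/

section WeightedZeroSums

variable {p m : ℕ} [hp : Fact p.Prime] [NeZero m] {ω : ZMod p → ZMod m} {ι : Type*}

/-- There are `m - 1` terms that add up, with suitable weights, to `-g`. -/
def HasWeightedZero (ω : ZMod p → ZMod m) (I : Finset ι) (c : ι → ZMod m) (g : ZMod m) : Prop :=
  ∃ J ⊆ I, #J + 1 = m ∧ ∃ e : ι → ZMod p, g + ∑ i ∈ J, ω (e i) * c i = 0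

/-- There are `m` terms that add up to `0`. -/
def HasPlainZero (I : Finset ι) (c : ι → ZMod m) : Prop :=
  ∃ J ⊆ I, #J = m ∧ ∑ i ∈ J, c i = 0

/-- A summand 0 of a hull is read as omitting the term, a summand from the orbit as choosing its
weight. J collects the terms that are kept. -/
lemma exists_of_mem_sum_weightHull [DecidableEq ι] {F : Finset ι} {c : ι → ZMod m} {x : ZMod m}
    (hx : x ∈ ∑ i ∈ F, weightHull ω (c i)) :
    ∃ J ⊆ F, ∃ e : ι → ZMod p, x = ∑ i ∈ J, ω (e i) * c i := by
  induction F using Finset.induction_on generalizing x with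
  | empty =>
    rw [sum_empty, Finset.mem_zero] at hx
    exact ⟨∅, subset_rfl, fun _ => 0, by simp [hx]⟩
  | insert i F hi ih =>
    rw [sum_insert hi] at hx
    obtain ⟨a, ha, y, hy, rfl⟩ := Finset.mem_add.1 hx
    obtain ⟨J, hJF, e, rfl⟩ := ih hy
    have hiJ : i ∉ J := fun h => hi (hJF h)
    rcases mem_weightHull.1 ha with rfl | ⟨j, rfl⟩
    · exact ⟨J, hJF.trans (subset_insert _ _), e, by simp⟩
    · refine ⟨insert i J, insert_subset_insert _ hJF, Function.update e i j, ?_⟩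
      rw [sum_insert hiJ, Function.update_self]
      congr 1
      apply sum_congr rfl
      intro k hk
      rw [Function.update_of_ne (by rintro rfl; exact hiJ hk)]

lemma exists_of_mem_sum_weightOrbit [DecidableEq ι] {F : Finset ι} {c : ι → ZMod m} {x : ZMod m}
    (hx : x ∈ ∑ i ∈ F, weightOrbit ω (c i)) :
    ∃ e : ι → ZMod p, x = ∑ i ∈ F, ω (e i) * c i := by
  induction F using Finset.induction_on generalizing x with
  | empty =>
    rw [sum_empty, Finset.mem_zero] at hx
    exact ⟨fun _ => 0, by simp [hx]⟩
  | insert i F hi ih =>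
    rw [sum_insert hi] at hx
    obtain ⟨a, ha, y, hy, rfl⟩ := Finset.mem_add.1 hx
    obtain ⟨e, rfl⟩ := ih hy
    obtain ⟨j, rfl⟩ := mem_weightOrbit.1 ha
    refine ⟨Function.update e i j, ?_⟩
    rw [sum_insert hi, Function.update_self]
    congr 1
    apply sum_congr rfl
    intro k hk
    rw [Function.update_of_ne (by rintro rfl; exact hi hk)]

lemma sum_weights_union [DecidableEq ι] {A B : Finset ι} (h : Disjoint A B) (c : ι → ZMod m)
    (e f : ι → ZMod p) :
    ∃ e' : ι → ZMod p, ∑ i ∈ A ∪ B, ω (e' i) * c i =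
      ∑ i ∈ A, ω (e i) * c i + ∑ i ∈ B, ω (f i) * c i := by
  refine ⟨fun i => if i ∈ A then e i else f i, ?_⟩
  rw [sum_union h]
  congr 1
  · exact sum_congr rfl fun i hi => by simp only [if_pos hi]
  · exact sum_congr rfl fun i hi => by simp only [if_neg (fun hA => disjoint_left.1 h hA hi)]

/-- Padding a weighted zero sum with zero terms. -/
lemma hasWeightedZero_of_zeros [DecidableEq ι] {I J Z : Finset ι} {c : ι → ZMod m} {g : ZMod m}
    (hJI : J ⊆ I) (hZI : Z ⊆ I) (hJZ : Disjoint J Z) (hZ : ∀ i ∈ Z, c i = 0) (e : ι → ZMod p)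
    (hg : g + ∑ i ∈ J, ω (e i) * c i = 0) (h1 : #J + 1 ≤ m) (h2 : m ≤ #J + #Z + 1) :
    HasWeightedZero ω I c g := by
  obtain ⟨Z', hZ'Z, hZ'c⟩ := exists_subset_card_eq (s := Z) (n := m - 1 - #J) (by omega)
  have hd := hJZ.mono_right hZ'Z
  refine ⟨J ∪ Z', union_subset hJI (hZ'Z.trans hZI), ?_, e, ?_⟩
  · rw [card_union_of_disjoint hd, hZ'c]; omega
  · rw [sum_union hd, sum_eq_zero (s := Z') (fun i hi => by rw [hZ i (hZ'Z hi), mul_zero]), add_zero,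
      hg]

namespace IsWeight

variable (hω : IsWeight ω)
include hω

/-- Order and index of K are 1 + pa and 1 + pb. Later size estimates use that a and b are positive
for a nontrivial proper K, which makes the product term pab dominate. -/
lemma card_arith {K : AddSubgroup (ZMod m)} {β : ℕ} (hm : m = 1 + p * β) :
    ∃ a b, Nat.card K = 1 + p * a ∧ m = (1 + p * a) * (1 + p * b) ∧ β = a + b + p * (a * b) ∧
      (K ≠ ⊥ → 1 ≤ a) ∧ (K ≠ ⊤ → 1 ≤ b) := by
  obtain ⟨a, b, ha, hab⟩ := hω.exists_card_index K
  refine ⟨a, b, ha, hab, ?_, ?_, ?_⟩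
  · have hpos := hp.out.pos
    apply Nat.eq_of_mul_eq_mul_left hpos
    have : 1 + p * β = 1 + (p * (a + b + p * (a * b))) := by
      rw [← hm, hab]; ring
    omega
  · intro h
    by_contra ha0
    apply h
    rw [← AddSubgroup.card_eq_one, ha]
    have : a = 0 := by omega
    simp [this]
  · intro h
    by_contra hb0
    apply h
    apply AddSubgroup.eq_top_of_card_eq
    have : b = 0 := by omega
    subst this
    rw [ha, Nat.card_zmod, hab]
    ring

/-- The hypothesis leaves at most b - 1 terms outside K. Since β = a + b + pab with a, b ≥ 1, at
least m + |K| - 1 terms lie in K, which is what EGZ in K needs. -/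
lemma hasPlainZero_of_subgroup {β : ℕ} (hm : m = 1 + p * β) {I : Finset ι} {c : ι → ZMod m}
    (hI : m + β ≤ #I + 2) {K : AddSubgroup (ZMod m)} (hK0 : K ≠ ⊥) (hK1 : K ≠ ⊤) {B : Finset ι}
    (hB : ∀ i ∈ I, c i ∉ K → i ∈ B) (hc : Nat.card K * (1 + p * #B + p) ≤ m) :
    HasPlainZero I c := by
  classical
  obtain ⟨a, b, ha, hab, hβ, ha1, hb1⟩ := hω.card_arith (K := K) hm
  replace ha1 := ha1 hK0
  replace hb1 := hb1 hK1
  have hpos := hp.out.pos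
  have hBb : #B + 1 ≤ b := by
    rw [ha, hab] at hc
    have h1 := Nat.le_of_mul_le_mul_left hc (by omega)
    have h2 : p * (#B + 1) ≤ p * b := by rw [mul_add]; omega
    exact Nat.le_of_mul_le_mul_left h2 hpos
  have hsd : #I ≤ #(I \ B) + #B := by
    have := card_le_card (s := I) (t := (I \ B) ∪ B) (by
      intro x hx
      by_cases h : x ∈ B <;> simp [h, hx])
    exact this.trans (card_union_le _ _)
  obtain ⟨t, hts, htc, ht⟩ := ZMod.exists_sum_eq_zero_of_mem_subgroup K c m
    (by rw [ha, hab]; exact dvd_mul_right _ _) (I \ B) (fun i hi => by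
      rw [mem_sdiff] at hi
      by_contra h
      exact hi.2 (hB i hi.1 h)) (by
      rw [ha]
      have : p * a ≤ p * (a * b) := Nat.mul_le_mul_left _ (Nat.le_mul_of_pos_right _ hb1)
      omega)
  exact ⟨t, hts.trans sdiff_subset, htc, ht⟩

lemma card_lt_card_of_lt {K H : AddSubgroup (ZMod m)} (h : K < H) : Nat.card K < Nat.card H := by
  rw [← card_ofSubgroup, ← card_ofSubgroup]
  apply card_lt_card
  rw [Finset.ssubset_iff_subset_ne]
  refine ⟨fun x hx => mem_ofSubgroup.2 (h.le (mem_ofSubgroup.1 hx)), fun he => h.ne ?_⟩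
  ext x
  rw [← mem_ofSubgroup, he, mem_ofSubgroup]

lemma weightOrbit_subset_ofSubgroup {H : AddSubgroup (ZMod m)} {c : ZMod m} (hc : c ∈ H) :
    weightOrbit ω c ⊆ ofSubgroup H := by
  intro x hx
  obtain ⟨j, rfl⟩ := mem_weightOrbit.1 hx
  exact mem_ofSubgroup.2 (ZMod.mul_mem_addSubgroup H _ hc)

lemma mem_of_weightOrbit_sub_mem {K : AddSubgroup (ZMod m)} {c : ZMod m}
    (h : ∀ α ∈ weightOrbit ω c, ∀ β ∈ weightOrbit ω c, α - β ∈ K) : c ∈ K :=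
  hω.mem_of_sub_mem (i := 1) (j := 0) one_ne_zero
    (h _ (mem_weightOrbit.2 ⟨1, rfl⟩) _ (mem_weightOrbit.2 ⟨0, rfl⟩))

/-- Many nonzero terms: no term has to be omitted. -/
theorem hasWeightedZero_of_many {β : ℕ} (hm : m = 1 + p * β) (hβ : 1 ≤ β) {I : Finset ι}
    {c : ι → ZMod m} (hI : m + β ≤ #I + 2) {F : Finset ι} (hFI : F ⊆ I)
    (hF0 : ∀ i ∈ I, c i ≠ 0 → i ∈ F) (hFc : m ≤ #F + 1)
    (hF1 : ∀ i ∈ F, c i ≠ 0) (hX : ∑ i ∈ F, weightHull ω (c i) = univ) (g : ZMod m) :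
    HasWeightedZero ω I c g := by
  classical
  have hpos := hp.out.pos
  -- H is a smallest subgroup that misses only few terms. Minimality rules out the second
  -- alternative of `exists_sum_eq_or_subgroup` inside H, so fewer than |H| orbits of terms in H
  -- fill H.
  let P : Set (AddSubgroup (ZMod m)) :=
    {H | H = ⊤ ∨ Nat.card H * (#{i ∈ I | c i ∉ H} + 2) ≤ m}
  obtain ⟨H, hHP, hHmin⟩ := WellFounded.has_min
    (measure (fun H : AddSubgroup (ZMod m) => Nat.card H)).wf P ⟨⊤, Or.inl rfl⟩
  have hHmin' : ∀ K < H, ¬ Nat.card K * (#{i ∈ I | c i ∉ K} + 2) ≤ m := by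
    intro K hK hbad
    exact hHmin K (Or.inr hbad) (hω.card_lt_card_of_lt hK)
  obtain ⟨Λ, -, hΛF, hΛc, hΛ⟩ := exists_sum_eq_or_subgroup H (fun i => weightOrbit ω (c i)) c
    (F.filter (fun i => c i ∈ H)) ∅ (empty_subset _)
    (fun i hi => hω.weightOrbit_subset_ofSubgroup (mem_filter.1 hi).2)
    (fun i _ => ⟨c i, hω.self_mem_weightOrbit _⟩)
    (fun i _ K h => hω.mem_of_weightOrbit_sub_mem h)
  obtain ⟨a, b, ha, hab, hβab, ha1, hb1⟩ := hω.card_arith (K := H) hm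
  have hout : #{i ∈ I | c i ∉ H} ≤ p * b ∧ (b = 0 ∨ #{i ∈ I | c i ∉ H} + 1 ≤ p * b) := by
    rcases hHP with h | h
    · subst h
      simp only [AddSubgroup.mem_top, not_true_eq_false, filter_false, card_empty, zero_le,
        true_and]
      rcases Nat.eq_zero_or_pos b with h0 | h0
      · exact Or.inl h0
      · right
        exact Nat.succ_le_of_lt (Nat.mul_pos hpos h0)
    · have h1 : #{i ∈ I | c i ∉ H} + 2 ≤ 1 + p * b := by
        have h0 : (1 + p * a) * (#{i ∈ I | c i ∉ H} + 2) ≤ (1 + p * a) * (1 + p * b) := by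
          rw [← hab, ← ha]
          exact h
        exact Nat.le_of_mul_le_mul_left h0 (by omega)
      constructor
      · omega
      · right; omega
  have ha1' : 1 ≤ a := by
    apply ha1
    rintro rfl
    have hFout : #F ≤ #{i ∈ I | c i ∉ (⊥ : AddSubgroup (ZMod m))} := by
      apply card_le_card
      intro i hi
      rw [mem_filter, AddSubgroup.mem_bot]
      exact ⟨hFI hi, hF1 i hi⟩
    rcases hHP with h | h
    · have h1 := AddSubgroup.card_bot (G := ZMod m)
      rw [h, AddSubgroup.card_top, Nat.card_zmod] at h1
      have : 1 ≤ p * β := Nat.mul_pos hpos hβ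
      omega
    · rw [AddSubgroup.card_bot] at h
      omega
  rcases hΛ with hΛ | ⟨K, hKH, B, hB, hKc⟩
  · rw [hΛ, card_ofSubgroup, ha, sum_empty, card_zero, card_empty] at hΛc
    have hΛI : Λ ⊆ I := hΛF.trans ((filter_subset _ _).trans hFI)
    -- A representation of -g by hulls prescribes the terms I₀ outside H and their weights; they
    -- solve the equation modulo H. Terms of H then do the rest: E adjusts the length to m - 1 and
    -- the orbits of Λ correct the value.
    have hg : -g ∈ ∑ i ∈ F, weightHull ω (c i) := by rw [hX]; exact mem_univ _
    obtain ⟨I₁, hI₁F, e₁, he₁⟩ := exists_of_mem_sum_weightHull hg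
    set I₀ := I₁.filter (fun i => c i ∉ H) with hI₀
    have hI₀out : I₀ ⊆ {i ∈ I | c i ∉ H} := by
      intro i hi
      rw [hI₀, mem_filter] at hi
      exact mem_filter.2 ⟨hFI (hI₁F hi.1), hi.2⟩
    have hI₀c := card_le_card hI₀out
    have hHsum : g + ∑ i ∈ I₀, ω (e₁ i) * c i ∈ H := by
      have h1 := sum_filter_add_sum_filter_not I₁ (fun i => c i ∉ H) (fun i => ω (e₁ i) * c i)
      rw [← he₁] at h1
      have h2 : g + ∑ i ∈ I₀, ω (e₁ i) * c i =
          -∑ i ∈ I₁ with ¬ (c i ∉ H), ω (e₁ i) * c i := by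
        linear_combination h1
      rw [h2]
      apply H.neg_mem
      apply H.sum_mem
      intro i hi
      rw [mem_filter, not_not] at hi
      exact ZMod.mul_mem_addSubgroup H _ hi.2
    have hIH : #({i ∈ I | c i ∈ H} \ Λ) + #Λ + #{i ∈ I | c i ∉ H} = #I := by
      rw [card_sdiff_add_card_eq_card, card_filter_add_card_filter_not]
      intro i hi
      exact mem_filter.2 ⟨hΛI hi, (mem_filter.1 (hΛF hi)).2⟩
    have hmab : m = 1 + p * a + p * b + p * a * (p * b) := by rw [hab]; ring
    have hpab : p * b ≤ p * (a * b) := Nat.mul_le_mul_left _ (Nat.le_mul_of_pos_left _ ha1')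
    obtain ⟨E, hEsub, hEc⟩ := exists_subset_card_eq (s := {i ∈ I | c i ∈ H} \ Λ)
      (n := m - 1 - #I₀ - #Λ) (by
        rcases hout with ⟨h1, h2 | h2⟩
        · subst h2; omega
        · omega)
    have htarget : -(g + ∑ i ∈ I₀, ω (e₁ i) * c i + ∑ i ∈ E, ω 0 * c i) ∈
        ∑ i ∈ Λ, weightOrbit ω (c i) := by
      rw [hΛ, mem_ofSubgroup]
      apply H.neg_mem
      apply H.add_mem hHsum
      apply H.sum_mem
      intro i hi
      have := hEsub hi
      rw [mem_sdiff, mem_filter] at this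
      exact ZMod.mul_mem_addSubgroup H _ this.1.2
    obtain ⟨e₂, he₂⟩ := exists_of_mem_sum_weightOrbit htarget
    have hd1 : Disjoint E Λ := by
      rw [disjoint_left]
      intro i hi
      exact (mem_sdiff.1 (hEsub hi)).2
    have hd2 : Disjoint I₀ (E ∪ Λ) := by
      rw [disjoint_left]
      intro i hi hi'
      rw [hI₀, mem_filter] at hi
      rw [mem_union] at hi'
      rcases hi' with h | h
      · have := hEsub h
        rw [mem_sdiff, mem_filter] at this
        exact hi.2 this.1.2
      · exact hi.2 (mem_filter.1 (hΛF h)).2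
    obtain ⟨e₃, he₃⟩ := sum_weights_union (ω := ω) hd1 c (fun _ => 0) e₂
    obtain ⟨e₄, he₄⟩ := sum_weights_union (ω := ω) hd2 c e₁ e₃
    refine ⟨I₀ ∪ (E ∪ Λ), union_subset (hI₀out.trans (filter_subset _ _))
      (union_subset (hEsub.trans (sdiff_subset.trans (filter_subset _ _))) hΛI), ?_, e₄, ?_⟩
    · rw [card_union_of_disjoint hd2, card_union_of_disjoint hd1, hEc]
      omega
    · rw [he₄, he₃, ← he₂]
      ring
  · exfalso
    -- The bound for K inside H and the bound for H multiply to the same kind of bound for K,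
    -- against minimality.
    apply hHmin' K hKH
    have hsub : #{i ∈ I | c i ∉ K} ≤ #{i ∈ I | c i ∉ H} + #B := by
      have : ({i ∈ I | c i ∉ K} : Finset ι) ⊆ {i ∈ I | c i ∉ H} ∪ B := by
        intro i hi
        rw [mem_filter] at hi
        rw [mem_union, mem_filter]
        by_cases hiH : c i ∈ H
        · right
          apply hB i _ hi.2
          rw [mem_filter]
          refine ⟨hF0 i hi.1 (fun h => hi.2 (by rw [h]; exact K.zero_mem)), hiH⟩
        · left
          exact ⟨hi.1, hiH⟩
      exact (card_le_card this).trans (card_union_le _ _)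
    have hx : Nat.card H * (#{i ∈ I | c i ∉ H} + 1) ≤ m ∧
        (Nat.card H * (#{i ∈ I | c i ∉ H} + 2) ≤ m ∨ #{i ∈ I | c i ∉ H} = 0) := by
      rcases hHP with h | h
      · subst h
        simp
      · exact ⟨(Nat.mul_le_mul_left _ (by omega)).trans h, Or.inl h⟩
    rcases hx with ⟨h1, h2 | h2⟩
    · calc Nat.card K * (#{i ∈ I | c i ∉ K} + 2)
          ≤ Nat.card K * ((#B + 2) * (#{i ∈ I | c i ∉ H} + 2)) := by
            apply Nat.mul_le_mul_left
            nlinarith [Nat.zero_le (#B * #{i ∈ I | c i ∉ H})]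
        _ = (Nat.card K * (#B + 2)) * (#{i ∈ I | c i ∉ H} + 2) := by ring
        _ ≤ Nat.card H * (#{i ∈ I | c i ∉ H} + 2) := Nat.mul_le_mul_right _ hKc
        _ ≤ m := h2
    · calc Nat.card K * (#{i ∈ I | c i ∉ K} + 2) ≤ Nat.card K * (#B + 2) := by
            apply Nat.mul_le_mul_left
            omega
        _ ≤ Nat.card H := hKc
        _ ≤ m := by rw [h2] at h1; omega

/-- The sum of an orbit vanishes. -/
lemma sum_weightOrbit {c : ZMod m} (hc : c ≠ 0) : ∑ x ∈ weightOrbit ω c, x = 0 := by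
  rw [weightOrbit, sum_image (fun _ _ _ _ h => hω.mul_right_injective hc h), ← sum_mul,
    hω.sum_eq_zero, zero_mul]

/-- Adding an orbit to a stable set that misses at most one orbit covers all nonzero elements. -/
lemma mem_add_weightOrbit {X : Finset (ZMod m)} (hX : WeightStable ω X) (h0 : 0 ∈ X)
    (hcard : m ≤ #X + p) {c : ZMod m} (hc : c ≠ 0) {v : ZMod m} (hv : v ≠ 0) :
    v ∈ X + weightOrbit ω c := by
  by_contra hcon
  apply hv
  have hDcard : #(univ \ X) ≤ p := by
    rw [card_sdiff_of_subset (subset_univ _), card_univ, ZMod.card]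
    omega
  -- If v is missed, then v minus the orbit of c lies in the complement of X, which has at most p
  -- elements, and so equals it. This complement is stable, hence itself an orbit. Summing its
  -- elements in two ways gives pv = 0.
  have hDeq : (weightOrbit ω c).image (fun x => v - x) = univ \ X := by
    apply Finset.eq_of_subset_of_card_le
    · intro y hy
      obtain ⟨x, hx, rfl⟩ := Finset.mem_image.1 hy
      rw [mem_sdiff]
      refine ⟨mem_univ _, fun hvx => hcon ?_⟩
      simpa using Finset.add_mem_add hvx hx
    · rw [card_image_of_injective _ sub_right_injective, hω.card_weightOrbit hc]
      exact hDcard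
  have hsum1 : ∑ x ∈ univ \ X, x = p * v := by
    rw [← hDeq, sum_image (fun _ _ _ _ h => sub_right_injective h), sum_sub_distrib,
      hω.sum_weightOrbit hc, sum_const, hω.card_weightOrbit hc, nsmul_eq_mul, sub_zero]
  have hdmem : v - c ∈ univ \ X := by
    rw [← hDeq]
    exact mem_image_of_mem _ (hω.self_mem_weightOrbit c)
  have hd0 : v - c ≠ 0 := by
    intro h
    rw [h, mem_sdiff] at hdmem
    exact hdmem.2 h0
  have horb : weightOrbit ω (v - c) = univ \ X := by
    apply Finset.eq_of_subset_of_card_le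
    · intro y hy
      obtain ⟨j, rfl⟩ := mem_weightOrbit.1 hy
      exact (WeightStable.univ.sdiff hω hX) j _ hdmem
    · rw [hω.card_weightOrbit hd0]
      exact hDcard
  rw [← horb, hω.sum_weightOrbit hd0] at hsum1
  exact hω.isUnit_natCast.mul_right_eq_zero.1 hsum1.symm

/-- Few nonzero terms. -/
theorem hasWeightedZero_of_few {β : ℕ} (hm : m = 1 + p * β) (hβ : 1 ≤ β) {I : Finset ι}
    {c : ι → ZMod m} (hI : m + β ≤ #I + 2) {F : Finset ι} (hFI : F ⊆ I)
    (hF0 : ∀ i ∈ I, c i ≠ 0 → i ∈ F) (hFc : #F + 2 ≤ m)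
    (hF1 : ∀ i ∈ F, c i ≠ 0) (hX : ∑ i ∈ F, weightHull ω (c i) = univ) (g : ZMod m) :
    HasWeightedZero ω I c g ∨ (#I + 2 = m + β ∧ #F = β ∧ g = 0) := by
  classical
  have hpos := hp.out.two_le
  have hβm : 2 * β + 1 ≤ m := by
    rw [hm]
    have := Nat.mul_le_mul_right β hpos
    omega
  have hZ0 : ∀ i ∈ I \ F, c i = 0 := by
    intro i hi
    rw [mem_sdiff] at hi
    by_contra h
    exact hi.2 (hF0 i hi.1 h)
  have hZc : #(I \ F) + #F = #I := card_sdiff_add_card_eq_card hFI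
  have hdirect : ∀ Λ ⊆ F, ∑ i ∈ Λ, weightHull ω (c i) = univ → #Λ ≤ β → m + #Λ ≤ #I + 1 →
      HasWeightedZero ω I c g := by
    intro Λ hΛF hΛ hΛβ hΛI
    have h1 : #(F \ Λ) + #Λ = #F := card_sdiff_add_card_eq_card hΛF
    -- Nonzero terms outside Λ are forced in only as far as there are fewer than m - 1 zeros for
    -- padding; the truncated subtraction gives 0 when the zeros suffice.
    obtain ⟨E, hEsub, hEc⟩ := exists_subset_card_eq (s := F \ Λ) (n := m - 1 - #(I \ F)) (by omega)
    have hdEΛ : ∀ J ⊆ Λ, Disjoint J E := by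
      intro J hJ
      rw [disjoint_right]
      intro i hi hi'
      exact (mem_sdiff.1 (hEsub hi)).2 (hJ hi')
    have ht : -(g + ∑ i ∈ E, ω 0 * c i) ∈ ∑ i ∈ Λ, weightHull ω (c i) := by
      rw [hΛ]; exact mem_univ _
    obtain ⟨J, hJΛ, e, he⟩ := exists_of_mem_sum_weightHull ht
    obtain ⟨e', he'⟩ := sum_weights_union (ω := ω) (hdEΛ J hJΛ) c e (fun _ => 0)
    have hJE : J ∪ E ⊆ F := union_subset (hJΛ.trans hΛF) (hEsub.trans sdiff_subset)
    have hJc := card_le_card hJΛ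
    refine hasWeightedZero_of_zeros (J := J ∪ E) (Z := I \ F) (hJE.trans hFI) sdiff_subset
      (disjoint_sdiff.mono_left hJE) hZ0 e' ?_ ?_ ?_
    · rw [he', ← he]; ring
    · rw [card_union_of_disjoint (hdEΛ J hJΛ), hEc]; omega
    · rw [card_union_of_disjoint (hdEΛ J hJΛ), hEc]; omega
  -- With β - 1 hulls the sum has at least 1 + p(β - 1) = m - p elements, so it misses at most one
  -- orbit.
  obtain ⟨Λ, hΛF, hΛb, hΛc, hΛ⟩ := hω.exists_greedy_hull c F hX (β - 1)
  set X := ∑ i ∈ Λ, weightHull ω (c i) with hXdef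
  by_cases hΛu : X = univ
  · exact Or.inl (hdirect Λ hΛF hΛu (by omega) (by omega))
  have hΛcard : #Λ = β - 1 := by
    rcases hΛ with h | h
    · exact absurd h hΛu
    · exact h
  by_cases hIm : m + β ≤ #I + 1
  · left
    obtain ⟨Λ', hΛF', hΛb', hΛc', hΛ'⟩ := hω.exists_greedy_hull c F hX β
    have : ∑ i ∈ Λ', weightHull ω (c i) = univ := by
      rcases hΛ' with h | h
      · exact h
      · apply Finset.eq_univ_of_card
        rw [ZMod.card]
        apply le_antisymm
        · exact (card_le_univ _).trans_eq (ZMod.card m)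
        · rw [h] at hΛc'; omega
    exact hdirect Λ' hΛF' this hΛb' (by omega)
  have hIeq : #I + 2 = m + β := by omega
  have hEne : (F \ Λ).Nonempty := by
    rw [sdiff_nonempty]
    intro h
    exact hΛu (by rw [hXdef, subset_antisymm hΛF h, hX])
  obtain ⟨i₁, hi₁⟩ := hEne
  have hEc : #(F \ Λ) + #Λ = #F := card_sdiff_add_card_eq_card hΛF
  set E := (F \ Λ).erase i₁ with hE
  have hEcard : #E + 1 = #(F \ Λ) := card_erase_add_one hi₁
  have hEsub : E ⊆ F \ Λ := erase_subset _ _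
  -- All terms of E are used, and i₁ is used with a free weight. `mem_add_weightOrbit` then reaches
  -- every nonzero target, so failure means that the target is 0 for all weights on E. This forces E
  -- to be empty and g = 0.
  by_cases hcase : ∃ e : ι → ZMod p, g + ∑ i ∈ E, ω (e i) * c i ≠ 0
  · left
    obtain ⟨e, he⟩ := hcase
    have hXst : WeightStable ω X := WeightStable.sum fun i _ => hω.stable_weightHull _
    have hX0 : (0 : ZMod m) ∈ X := by
      rw [hXdef]
      clear_value X
      clear * -
      induction Λ using Finset.induction_on with
      | empty => simp
      | insert i F hi ih =>
        rw [sum_insert hi]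
        simpa using Finset.add_mem_add (zero_mem_weightHull (ω := ω) (c i)) ih
    have hXp : m ≤ #X + p := by
      rw [hΛcard] at hΛc
      have : p * (β - 1) + p = p * β := by
        rw [← Nat.mul_succ]; congr 1; omega
      omega
    have hmem := hω.mem_add_weightOrbit hXst hX0 hXp (hF1 i₁ (mem_sdiff.1 hi₁).1) (neg_ne_zero.2 he)
    obtain ⟨x, hx, y, hy, hxy⟩ := Finset.mem_add.1 hmem
    obtain ⟨J, hJΛ, f, rfl⟩ := exists_of_mem_sum_weightHull hx
    obtain ⟨j, rfl⟩ := mem_weightOrbit.1 hy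
    have hdJ : Disjoint J (insert i₁ E) := by
      rw [disjoint_right]
      intro i hi hiJ
      rw [hE, insert_erase hi₁] at hi
      exact (mem_sdiff.1 hi).2 (hJΛ hiJ)
    obtain ⟨e', he'⟩ := sum_weights_union (ω := ω) hdJ c f (Function.update e i₁ j)
    have hsub : J ∪ insert i₁ E ⊆ F := by
      rw [hE, insert_erase hi₁]
      exact union_subset (hJΛ.trans hΛF) sdiff_subset
    have hins : #(insert i₁ E) = #(F \ Λ) := by rw [hE, insert_erase hi₁]
    have hJc := card_le_card hJΛ
    refine hasWeightedZero_of_zeros (J := J ∪ insert i₁ E) (Z := I \ F) (hsub.trans hFI)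
      sdiff_subset (disjoint_sdiff.mono_left hsub) hZ0 e' ?_ ?_ ?_
    · rw [he', sum_insert (by simp [hE]), Function.update_self]
      have : ∑ i ∈ E, ω (Function.update e i₁ j i) * c i = ∑ i ∈ E, ω (e i) * c i := by
        apply sum_congr rfl
        intro i hi
        rw [Function.update_of_ne (fun h => by simp [hE, h] at hi)]
      rw [this]
      linear_combination hxy
    · rw [card_union_of_disjoint hdJ, hins]; omega
    · rw [card_union_of_disjoint hdJ, hins]; omega
  · right
    push Not at hcase
    have hEe : E = ∅ := by
      by_contra hne
      obtain ⟨i₂, hi₂⟩ := Finset.nonempty_iff_ne_empty.2 hne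
      have h1 := hcase (fun _ => 0)
      have h2 := hcase (Function.update (fun _ => (0 : ZMod p)) i₂ 1)
      rw [← add_sum_erase _ _ hi₂] at h1 h2
      have h3 : ∑ i ∈ E.erase i₂, ω (Function.update (fun _ => (0 : ZMod p)) i₂ 1 i) * c i =
          ∑ i ∈ E.erase i₂, ω 0 * c i := by
        apply sum_congr rfl
        intro i hi
        rw [Function.update_of_ne (fun h => by simp [h] at hi)]
      rw [h3, Function.update_self] at h2
      have h4 : ω 1 * c i₂ = ω 0 * c i₂ := by linear_combination h2 - h1
      have hi₂F : i₂ ∈ F := (mem_sdiff.1 (hEsub hi₂)).1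
      have := hω.mul_right_injective (hF1 i₂ hi₂F) h4
      exact one_ne_zero this
    have hg := hcase (fun _ => 0)
    rw [hEe, sum_empty, add_zero] at hg
    rw [hEe, card_empty] at hEcard
    exact ⟨hIeq, by omega, hg⟩

/-- Weighted Erdős–Ginzburg–Ziv theorem with a description of the extremal case. -/
theorem weighted_zero_sum {β : ℕ} (hm : m = 1 + p * β) (hβ : 1 ≤ β) {I : Finset ι}
    (c : ι → ZMod m) (g : ZMod m) (hI : m + β ≤ #I + 2) :
    HasWeightedZero ω I c g ∨ HasPlainZero I c ∨
      (#I + 2 = m + β ∧ ((g = 0 ∧ #{i ∈ I | c i ≠ 0} = β) ∨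
        (g ≠ 0 ∧ #{i ∈ I | c i ≠ 0} + 1 = β))) := by
  classical
  set F := I.filter (fun i => c i ≠ 0) with hF
  have hFI : F ⊆ I := filter_subset _ _
  have hF0 : ∀ i ∈ I, c i ≠ 0 → i ∈ F := fun i hi h => mem_filter.2 ⟨hi, h⟩
  have hF1 : ∀ i ∈ F, c i ≠ 0 := fun i hi => (mem_filter.1 hi).2
  have hZ0 : ∀ i ∈ I \ F, c i = 0 := by
    intro i hi
    rw [mem_sdiff] at hi
    by_contra h
    exact hi.2 (hF0 i hi.1 h)
  have hZc : #(I \ F) + #F = #I := card_sdiff_add_card_eq_card hFI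
  rcases hω.hull_dichotomy c F with hX | ⟨K, hK1, B, hB, -, -, hKc⟩
  · by_cases hFc : m ≤ #F + 1
    · exact Or.inl (hω.hasWeightedZero_of_many hm hβ hI hFI hF0 hFc hF1 hX g)
    · rcases hω.hasWeightedZero_of_few hm hβ hI hFI hF0 (by omega) hF1 hX g with h | ⟨h1, h2, h3⟩
      · exact Or.inl h
      · exact Or.inr (Or.inr ⟨h1, Or.inl ⟨h3, h2⟩⟩)
  · by_cases hK0 : K = ⊥
    · subst hK0
      rw [AddSubgroup.card_bot, one_mul] at hKc
      have hFB : #F ≤ #B := card_le_card fun i hi => hB i hi (by simpa using hF1 i hi)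
      have hBβ : #B + 1 ≤ β := by
        have h2 : p * (#B + 1) ≤ p * β := by rw [mul_add]; omega
        exact Nat.le_of_mul_le_mul_left h2 hp.out.pos
      by_cases hz : m ≤ #(I \ F)
      · right; left
        obtain ⟨J, hJ, hJc⟩ := exists_subset_card_eq hz
        exact ⟨J, hJ.trans sdiff_subset, hJc, Finset.sum_eq_zero fun i hi => hZ0 i (hJ hi)⟩
      · by_cases hg : g = 0
        · left
          refine hasWeightedZero_of_zeros (J := ∅) (Z := I \ F) (empty_subset _) sdiff_subset
            (disjoint_empty_left _) hZ0 (fun _ => 0) (by simp [hg]) ?_ ?_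
          · rw [card_empty]; have := NeZero.pos m; omega
          · rw [card_empty]; omega
        · right; right
          exact ⟨by omega, Or.inr ⟨hg, by omega⟩⟩
    · right; left
      refine hω.hasPlainZero_of_subgroup hm hI hK0 hK1 (fun i hi hci => ?_) hKc
      exact hB i (hF0 i hi (fun h => hci (by rw [h]; exact K.zero_mem))) hci

/-- In the extremal case all but one orbit of targets are weighted sums. -/
theorem weighted_zero_sum_extremal {β : ℕ} (hm : m = 1 + p * β) {I : Finset ι}
    (c : ι → ZMod m) (hI : m + β = #I + 2) (hc : #{i ∈ I | c i ≠ 0} + 1 = β) :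
    HasPlainZero I c ∨ ∃ O : Finset (ZMod m), #O ≤ p ∧ ∀ g ∉ O, HasWeightedZero ω I c g := by
  classical
  set F := I.filter (fun i => c i ≠ 0) with hF
  have hFI : F ⊆ I := filter_subset _ _
  have hF0 : ∀ i ∈ I, c i ≠ 0 → i ∈ F := fun i hi h => mem_filter.2 ⟨hi, h⟩
  have hF1 : ∀ i ∈ F, c i ≠ 0 := fun i hi => (mem_filter.1 hi).2
  have hpos := hp.out.two_le
  have hβm : 2 * β + 1 ≤ m := by
    rw [hm]
    have := Nat.mul_le_mul_right β hpos
    omega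
  have hZ0 : ∀ i ∈ I \ F, c i = 0 := by
    intro i hi
    rw [mem_sdiff] at hi
    by_contra h
    exact hi.2 (hF0 i hi.1 h)
  have hZc : #(I \ F) + #F = #I := card_sdiff_add_card_eq_card hFI
  have hgo : ∀ g, -g ∈ ∑ i ∈ F, weightHull ω (c i) → HasWeightedZero ω I c g := by
    intro g hg
    obtain ⟨J, hJF, e, he⟩ := exists_of_mem_sum_weightHull hg
    have hJc := card_le_card hJF
    refine hasWeightedZero_of_zeros (J := J) (Z := I \ F) (hJF.trans hFI) sdiff_subset
      (disjoint_sdiff.mono_left hJF) hZ0 e (by rw [← he, add_neg_cancel]) ?_ ?_ <;> omega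
  rcases hω.hull_dichotomy c F with hX | ⟨K, hK1, B, hB, -, hKX, hKc⟩
  · right
    exact ⟨∅, by simp, fun g _ => hgo g (by rw [hX]; exact mem_univ _)⟩
  · by_cases hK0 : K = ⊥
    · right
      subst hK0
      rw [AddSubgroup.card_bot, one_mul] at hKX
      have hFB : #F ≤ #B := card_le_card fun i hi => hB i hi (by simpa using hF1 i hi)
      -- O consists of the targets not reached. The hulls of β - 1 nonzero terms give at least m - p
      -- sums, so #O ≤ p.
      refine ⟨univ.filter (fun g => -g ∉ ∑ i ∈ F, weightHull ω (c i)), ?_, fun g hg => hgo g ?_⟩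
      · have h1 : #{g | -g ∉ ∑ i ∈ F, weightHull ω (c i)} =
            #(univ \ ∑ i ∈ F, weightHull ω (c i)) := by
          apply card_bij (fun g _ => -g)
          · intro g hg
            simpa using hg
          · intro a _ b _ h
            exact neg_injective h
          · intro b hb
            exact ⟨-b, by simpa using hb, by simp⟩
        rw [h1, card_sdiff_of_subset (subset_univ _), card_univ, ZMod.card]
        have h2 : p * #F ≤ p * #B := Nat.mul_le_mul_left _ hFB
        have h3 : p * #F + p = p * β := by rw [← hc]; ring
        omega
      · simpa using hg
    · left
      refine hω.hasPlainZero_of_subgroup hm hI.le hK0 hK1 (fun i hi hci => ?_) hKc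
      exact hB i (hF0 i hi (fun h => hci (by rw [h]; exact K.zero_mem))) hci

end IsWeight

end WeightedZeroSums

/-! ### The inverse Erdős–Ginzburg–Ziv theorem. -/

section InverseZeroSums

lemma Finset.exists_of_mem_sum_pair {ι V : Type*} [DecidableEq ι] [AddCommGroup V] [DecidableEq V]
    {F : Finset ι} {c : ι → V} {x : V} (hx : x ∈ ∑ i ∈ F, ({0, c i} : Finset V)) :
    ∃ J ⊆ F, ∑ i ∈ J, c i = x := by
  induction F using Finset.induction_on generalizing x with
  | empty =>
    rw [sum_empty, Finset.mem_zero] at hx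
    exact ⟨∅, subset_rfl, by simp [hx]⟩
  | insert i F hi ih =>
    rw [sum_insert hi] at hx
    obtain ⟨a, ha, y, hy, rfl⟩ := Finset.mem_add.1 hx
    obtain ⟨J, hJF, rfl⟩ := ih hy
    rw [mem_insert, mem_singleton] at ha
    rcases ha with rfl | rfl
    · exact ⟨J, hJF.trans (subset_insert _ _), by simp⟩
    · exact ⟨insert i J, insert_subset_insert _ hJF, sum_insert fun h => hi (hJF h)⟩

/-- An enumeration of a finite set along which a function increases. -/
lemma Finset.exists_monotone_enumeration {ι : Type*} [DecidableEq ι] (F : Finset ι) (hF : F.Nonempty)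
    (f : ι → ℕ) : ∃ u : ℕ → ι, (∀ j < #F, u j ∈ F) ∧
      (∀ i < #F, ∀ j < #F, u i = u j → i = j) ∧ ∀ i j, i ≤ j → j < #F → f (u i) ≤ f (u j) := by
  obtain ⟨i₀, -⟩ := hF
  induction F using Finset.induction_on_max_value f with
  | empty => exact ⟨fun _ => i₀, by simp, by simp, by simp⟩
  | insert i F hi hmax ih =>
    obtain ⟨u, h1, h2, h3⟩ := ih
    refine ⟨Function.update u #F i, ?_, ?_, ?_⟩
    · intro j hj
      rw [card_insert_of_notMem hi] at hj
      rcases Nat.lt_succ_iff_lt_or_eq.1 hj with h | h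
      · rw [Function.update_of_ne h.ne]; exact mem_insert_of_mem (h1 j h)
      · rw [h, Function.update_self]; exact mem_insert_self _ _
    · intro a ha b hb hab
      rw [card_insert_of_notMem hi] at ha hb
      rcases Nat.lt_succ_iff_lt_or_eq.1 ha with h | h <;>
      rcases Nat.lt_succ_iff_lt_or_eq.1 hb with h' | h'
      · rw [Function.update_of_ne h.ne, Function.update_of_ne h'.ne] at hab
        exact h2 a h b h' hab
      · rw [Function.update_of_ne h.ne, h', Function.update_self] at hab
        exact absurd (hab ▸ h1 a h) hi
      · rw [Function.update_of_ne h'.ne, h, Function.update_self] at hab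
        exact absurd (hab ▸ h1 b h') hi
      · rw [h, h']
    · intro a b hab hb
      rw [card_insert_of_notMem hi] at hb
      rcases Nat.lt_succ_iff_lt_or_eq.1 hb with h | h
      · rw [Function.update_of_ne h.ne, Function.update_of_ne (by omega)]
        exact h3 a b hab h
      · rw [h, Function.update_self]
        rcases hab.lt_or_eq with h' | h'
        · rw [Function.update_of_ne (by omega)]
          exact hmax _ (h1 a (by omega))
        · rw [h', h, Function.update_self]

/-- The Cauchy–Davenport theorem for several summands. -/
lemma ZMod.min_le_card_sum {q : ℕ} [Fact q.Prime] {κ : Type*} [DecidableEq κ] (R : Finset κ)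
    (A : κ → Finset (ZMod q)) (hA : ∀ j ∈ R, (A j).Nonempty) :
    min q (1 + ∑ j ∈ R, (#(A j) - 1)) ≤ #(∑ j ∈ R, A j) := by
  induction R using Finset.induction_on with
  | empty => simp
  | insert i R hi ih =>
    rw [sum_insert hi, sum_insert hi]
    have h1 := ih fun j hj => hA j (mem_insert_of_mem hj)
    have h2 := (hA i (mem_insert_self _ _))
    have h4 : (∑ j ∈ R, A j).Nonempty := by
      rw [← card_pos]
      have := (Fact.out : q.Prime).pos
      omega
    have h3 := ZMod.cauchy_davenport (Fact.out : q.Prime) h2 h4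
    have := h2.card_pos
    omega

variable {ι : Type*} [DecidableEq ι]

/-- Disjoint zero-sum blocks, by repeated use of the Erdős–Ginzburg–Ziv theorem. -/
lemma ZMod.exists_blocks {n : ℕ} (hn : 0 < n) (a : ι → ZMod n) (P : ℕ) (s : Finset ι)
    (hs : n * P + n ≤ #s + 1) : ∃ B : ℕ → Finset ι, (∀ j < P, B j ⊆ s ∧ #(B j) = n ∧
      ∑ i ∈ B j, a i = 0) ∧ ∀ i < P, ∀ j < P, i ≠ j → Disjoint (B i) (B j) := by
  induction P generalizing s with
  | zero => exact ⟨fun _ => ∅, by simp, by simp⟩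
  | succ P ih =>
    rw [mul_add] at hs
    obtain ⟨t, hts, htc, ht⟩ := ZMod.erdos_ginzburg_ziv (s := s) a (by omega)
    obtain ⟨B, hB, hd⟩ := ih (s \ t) (by
      rw [card_sdiff_of_subset hts, htc]
      omega)
    have hdt : ∀ j < P, Disjoint (B j) t := fun j hj =>
      sdiff_disjoint.mono_left (hB j hj).1
    refine ⟨Function.update B P t, ?_, ?_⟩
    · intro j hj
      rcases Nat.lt_succ_iff_lt_or_eq.1 hj with h | h
      · rw [Function.update_of_ne h.ne]
        exact ⟨(hB j h).1.trans sdiff_subset, (hB j h).2⟩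
      · rw [h, Function.update_self]
        exact ⟨hts, htc, ht⟩
    · intro i hi j hj hij
      rcases Nat.lt_succ_iff_lt_or_eq.1 hi with h | h <;>
      rcases Nat.lt_succ_iff_lt_or_eq.1 hj with h' | h'
      · rw [Function.update_of_ne h.ne, Function.update_of_ne h'.ne]
        exact hd i h j h' hij
      · rw [Function.update_of_ne h.ne, h', Function.update_self]
        exact hdt i h
      · rw [Function.update_of_ne h'.ne, h, Function.update_self]
        exact (hdt j h').symm
      · omega

/-- A zero-sum set of `n * P` terms splits into zero-sum blocks. -/
lemma ZMod.exists_blocks_of_sum_eq_zero {n : ℕ} (hn : 0 < n) (a : ι → ZMod n) (P : ℕ) (s : Finset ι)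
    (hs : #s = n * P) (hsum : ∑ i ∈ s, a i = 0) :
    ∃ B : ℕ → Finset ι, (∀ j < P, B j ⊆ s ∧ #(B j) = n ∧
      ∑ i ∈ B j, a i = 0) ∧ ∀ i < P, ∀ j < P, i ≠ j → Disjoint (B i) (B j) := by
  rcases P with _ | P
  · exact ⟨fun _ => ∅, by simp, by simp⟩
  rw [mul_add] at hs
  obtain ⟨B, hB, hd⟩ := ZMod.exists_blocks hn a P s (by omega)
  set U := (range P).biUnion B with hU
  have hUs : U ⊆ s := by
    rw [hU, biUnion_subset]
    intro j hj
    exact (hB j (mem_range.1 hj)).1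
  have hpd : ((range P : Finset ℕ) : Set ℕ).PairwiseDisjoint B := by
    intro i hi j hj hij
    exact hd i (by simpa using hi) j (by simpa using hj) hij
  have hUc : #U = n * P := by
    rw [hU, card_biUnion hpd, sum_congr rfl fun j hj => (hB j (mem_range.1 hj)).2.1]
    simp [mul_comm]
  have hUsum : ∑ i ∈ U, a i = 0 := by
    rw [hU, sum_biUnion hpd]
    exact sum_eq_zero fun j hj => (hB j (mem_range.1 hj)).2.2
  have hdt : ∀ j < P, Disjoint (B j) (s \ U) := fun j hj => by
    refine disjoint_sdiff.mono_left ?_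
    rw [hU]
    exact subset_biUnion_of_mem B (mem_range.2 hj)
  refine ⟨Function.update B P (s \ U), ?_, ?_⟩
  · intro j hj
    rcases Nat.lt_succ_iff_lt_or_eq.1 hj with h | h
    · rw [Function.update_of_ne h.ne]
      exact hB j h
    · rw [h, Function.update_self]
      refine ⟨sdiff_subset, ?_, ?_⟩
      · rw [card_sdiff_of_subset hUs]; omega
      · rw [← sum_sdiff hUs, hUsum, add_zero] at hsum
        exact hsum
  · intro i hi j hj hij
    rcases Nat.lt_succ_iff_lt_or_eq.1 hi with h | h <;>
    rcases Nat.lt_succ_iff_lt_or_eq.1 hj with h' | h'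
    · rw [Function.update_of_ne h.ne, Function.update_of_ne h'.ne]
      exact hd i h j h' hij
    · rw [Function.update_of_ne h.ne, h', Function.update_self]
      exact hdt i h
    · rw [Function.update_of_ne h'.ne, h, Function.update_self]
      exact (hdt j h').symm
    · omega

/-- No zero-sum subfamily of length `m * P`. -/
def ZeroSumFree {m : ℕ} (P : ℕ) (F : Finset ι) (v : ι → ZMod m) : Prop :=
  ∀ T ⊆ F, #T = m * P → ∑ i ∈ T, v i ≠ 0

/-- If the value `0` is popular in an extremal family then there is only one other value. -/
lemma ZMod.exists_unit_of_zero_popular {m P : ℕ} [NeZero m] (hm : 2 ≤ m) {F : Finset ι}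
    {v : ι → ZMod m} (hF : #F + 2 = m * P + m) (hfree : ZeroSumFree P F v)
    (h0 : m ≤ #{i ∈ F | v i = 0} + 2) :
    ∃ c, IsUnit c ∧ ∀ i ∈ F, v i = 0 ∨ v i = c := by
  set F' := {i ∈ F | v i ≠ 0} with hF'
  set σ := ∑ i ∈ F, v i with hσ
  have hF'F : F' ⊆ F := filter_subset _ _
  have hZd : Disjoint F' {i ∈ F | v i = 0} := by
    rw [disjoint_left]
    intro i hi hi'
    exact (mem_filter.1 hi).2 (mem_filter.1 hi').2
  -- The complement of a set of mP terms has m - 2 terms. Since zeros are available for padding, at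
  -- most m - 2 nonzero terms with sum σ would produce a forbidden zero sum.
  have key : ∀ J ⊆ F', #J + 2 ≤ m → ∑ i ∈ J, v i ≠ σ := by
    intro J hJ hJc hJσ
    obtain ⟨Z, hZ, hZc⟩ := exists_subset_card_eq (s := {i ∈ F | v i = 0}) (n := m - 2 - #J)
      (by omega)
    have hd : Disjoint J Z := (hZd.mono_left hJ).mono_right hZ
    have hsub : J ∪ Z ⊆ F := union_subset (hJ.trans hF'F) (hZ.trans (filter_subset _ _))
    apply hfree (F \ (J ∪ Z)) sdiff_subset
    · rw [card_sdiff_of_subset hsub, card_union_of_disjoint hd]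
      omega
    · rw [← sum_sdiff hsub, sum_union hd, hJσ,
        Finset.sum_eq_zero (s := Z) (fun i hi => (mem_filter.1 (hZ hi)).2)] at hσ
      simpa using hσ
  -- Subset sums grow to all of ℤ/m; the other alternative, nearly all terms in a proper subgroup,
  -- contradicts freeness by EGZ in that subgroup.
  have hdich : ∀ Λ₀ ⊆ F', ∃ Λ, Λ₀ ⊆ Λ ∧ Λ ⊆ F' ∧
      #(∑ i ∈ Λ₀, ({0, v i} : Finset (ZMod m))) + #Λ ≤ m + #Λ₀ ∧
      ∑ i ∈ Λ, ({0, v i} : Finset (ZMod m)) = univ := by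
    intro Λ₀ hΛ₀
    obtain ⟨Λ, h1, h2, h3, h4⟩ := exists_sum_eq_or_subgroup (⊤ : AddSubgroup (ZMod m))
      (fun i => {0, v i}) v F' Λ₀ hΛ₀ (fun i _ x _ => mem_ofSubgroup.2 (AddSubgroup.mem_top _))
      (fun i _ => ⟨0, mem_insert_self _ _⟩)
      (fun i _ K h => by simpa using h (v i) (by simp) 0 (by simp))
    rcases h4 with h4 | ⟨K, -, B, hB, hK⟩
    · have hu : ∑ i ∈ Λ, ({0, v i} : Finset (ZMod m)) = univ := by
        rw [h4]
        ext x
        simp [mem_ofSubgroup]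
      refine ⟨Λ, h1, h2, ?_, hu⟩
      rw [hu, card_univ, ZMod.card] at h3
      exact h3
    · exfalso
      rw [AddSubgroup.card_top, Nat.card_zmod] at hK
      have hpos : 0 < Nat.card K := Nat.card_pos
      obtain ⟨s, hs⟩ : Nat.card K ∣ m := by
        have := K.card_addSubgroup_dvd_card
        rwa [Nat.card_zmod] at this
      obtain ⟨T, hT, hTc, hTs⟩ := ZMod.exists_sum_eq_zero_of_mem_subgroup K v (m * P)
        ⟨s * P, by rw [← mul_assoc, ← hs]⟩ (F \ B) (fun i hi => by
          rw [mem_sdiff] at hi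
          by_contra hiK
          refine hi.2 (hB i (mem_filter.2 ⟨hi.1, fun h => hiK ?_⟩) hiK)
          rw [h]; exact K.zero_mem) (by
          have h5 := le_card_sdiff B F
          have h6 : Nat.card K + (#B + 1) ≤ Nat.card K * (#B + 2) := by
            nlinarith [Nat.mul_le_mul_right (#B + 1) hpos]
          omega)
      exact hfree T (hT.trans sdiff_subset) hTc hTs
  have hall : ∀ i ∈ F', ∀ j ∈ F', v i = v j := by
    intro i hi j hj
    by_contra hij
    have hne : i ≠ j := fun h => hij (by rw [h])
    have hi0 := (mem_filter.1 hi).2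
    have hj0 := (mem_filter.1 hj).2
    -- Two distinct nonzero values start with four subset sums, so at most m - 2 terms fill ℤ/m and
    -- σ is a forbidden sum. If the values are opposite there are only three sums and m - 1 terms
    -- may be needed, but then i and j can be dropped together.
    obtain ⟨Λ, h1, h2, h3, h4⟩ := hdich {i, j} (by
      intro x hx
      rw [mem_insert, mem_singleton] at hx
      rcases hx with rfl | rfl <;> assumption)
    have hσ' : σ ∈ ∑ i ∈ Λ, ({0, v i} : Finset (ZMod m)) := by rw [h4]; exact mem_univ _
    obtain ⟨J, hJ, hJσ⟩ := exists_of_mem_sum_pair hσ'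
    rw [card_pair hne, sum_pair hne] at h3
    have hJc := card_le_card hJ
    by_cases hopp : v i + v j = 0
    · have h5 : ({0, v i, v j} : Finset (ZMod m)) ⊆ {0, v i} + {0, v j} := by
        intro x hx
        simp only [mem_insert, mem_singleton] at hx
        rcases hx with rfl | rfl | rfl
        · simpa using Finset.add_mem_add (mem_insert_self 0 {v i}) (mem_insert_self 0 {v j})
        · simpa using Finset.add_mem_add (s := {0, v i}) (t := {0, v j}) (a := v i) (b := 0)
            (by simp) (by simp)
        · simpa using Finset.add_mem_add (s := {0, v i}) (t := {0, v j}) (a := 0) (b := v j)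
            (by simp) (by simp)
      have h6 := card_le_card h5
      rw [card_eq_three.2 ⟨0, v i, v j, hi0.symm, hj0.symm, hij, rfl⟩] at h6
      by_cases hJm : #J + 2 ≤ m
      · exact key J (hJ.trans h2) hJm hJσ
      · have hJΛ : J = Λ := eq_of_subset_of_card_le hJ (by omega)
        have hsub : {i, j} ⊆ J := by rw [hJΛ]; exact h1
        refine key (J \ {i, j}) (sdiff_subset.trans (hJ.trans h2)) ?_ ?_
        · rw [card_sdiff_of_subset hsub, card_pair hne]; omega
        · rw [← hJσ, ← sum_sdiff hsub, sum_pair hne, hopp, add_zero]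
    · have h5 : ({0, v i, v j, v i + v j} : Finset (ZMod m)) ⊆ {0, v i} + {0, v j} := by
        intro x hx
        simp only [mem_insert, mem_singleton] at hx
        rcases hx with rfl | rfl | rfl | rfl
        · simpa using Finset.add_mem_add (mem_insert_self 0 {v i}) (mem_insert_self 0 {v j})
        · simpa using Finset.add_mem_add (s := {0, v i}) (t := {0, v j}) (a := v i) (b := 0)
            (by simp) (by simp)
        · simpa using Finset.add_mem_add (s := {0, v i}) (t := {0, v j}) (a := 0) (b := v j)
            (by simp) (by simp)
        · exact Finset.add_mem_add (by simp) (by simp)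
      have h6 := card_le_card h5
      have h7 : #({0, v i, v j, v i + v j} : Finset (ZMod m)) = 4 := by
        rw [card_insert_of_notMem, card_eq_three.2 ⟨v i, v j, v i + v j, hij, ?_, ?_, rfl⟩]
        · simpa using hj0
        · simpa using hi0
        · simp only [mem_insert, mem_singleton, not_or]
          exact ⟨hi0.symm, hj0.symm, fun h => hopp h.symm⟩
      exact key J (hJ.trans h2) (by omega) hJσ
  have hne : F'.Nonempty := by
    rw [nonempty_iff_ne_empty]
    intro he
    obtain ⟨T, hT, hTc⟩ := exists_subset_card_eq (s := F) (n := m * P) (by omega)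
    refine hfree T hT hTc (Finset.sum_eq_zero fun i hi => ?_)
    by_contra h
    have : i ∈ F' := mem_filter.2 ⟨hT hi, h⟩
    rw [he] at this
    exact notMem_empty _ this
  obtain ⟨i₀, hi₀⟩ := hne
  refine ⟨v i₀, ?_, fun i hi => ?_⟩
  · obtain ⟨Λ, -, h2, -, h4⟩ := hdich ∅ (empty_subset _)
    have h1 : (1 : ZMod m) ∈ ∑ i ∈ Λ, ({0, v i} : Finset (ZMod m)) := by rw [h4]; exact mem_univ _
    obtain ⟨J, hJ, hJσ⟩ := exists_of_mem_sum_pair h1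
    rw [sum_congr rfl fun i hi => hall i (h2 (hJ hi)) i₀ hi₀, sum_const, nsmul_eq_mul,
      mul_comm] at hJσ
    exact IsUnit.of_mul_eq_one _ hJσ
  · by_cases h : v i = 0
    · exact Or.inl h
    · exact Or.inr (hall i (mem_filter.2 ⟨hi, h⟩) i₀ hi₀)

/-- The extremal families for the Erdős–Ginzburg–Ziv theorem: two values whose multiplicities are
congruent to `-1` modulo `m`. -/
def IsTwoValued {m : ℕ} (P : ℕ) (F : Finset ι) (v : ι → ZMod m) : Prop :=
  ∃ (a b : ZMod m) (k₁ k₂ : ℕ), IsUnit (a - b) ∧ 1 ≤ k₁ ∧ 1 ≤ k₂ ∧ k₁ + k₂ = P + 1 ∧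
    #{i ∈ F | v i = a} + 1 = k₁ * m ∧ #{i ∈ F | v i = b} + 1 = k₂ * m ∧
    ∀ i ∈ F, v i = a ∨ v i = b

lemma ZMod.isTwoValued_of_popular {m P : ℕ} [NeZero m] (hm : 2 ≤ m) {F : Finset ι}
    {v : ι → ZMod m} (hF : #F + 2 = m * P + m) (hfree : ZeroSumFree P F v) {a : ZMod m}
    (ha : m ≤ #{i ∈ F | v i = a} + 2) : IsTwoValued P F v := by
  obtain ⟨c, hc, hall⟩ := ZMod.exists_unit_of_zero_popular hm (v := fun i => v i - a) hF (by
    intro T hT hTc h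
    apply hfree T hT hTc
    rw [sum_sub_distrib, sum_const, hTc] at h
    simpa using h) (by simpa [sub_eq_zero] using ha)
  simp only [sub_eq_zero] at hall
  have hcne : c ≠ 0 := by
    rintro rfl
    have : Fact (1 < m) := ⟨hm⟩
    exact not_isUnit_zero hc
  set A := {i ∈ F | v i = a} with hA
  set B := {i ∈ F | v i = a + c} with hB
  have hdisj : Disjoint A B := by
    rw [disjoint_left]
    intro i hi hi'
    have h1 := (mem_filter.1 hi).2
    have h2 := (mem_filter.1 hi').2
    rw [h1] at h2
    exact hcne (by simpa using h2.symm)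
  have hall' : ∀ i ∈ F, v i = a ∨ v i = a + c := fun i hi => (hall i hi).imp id fun h => by
    rw [← h]; ring
  have hAB : #A + #B = #F := by
    rw [← card_union_of_disjoint hdisj]
    congr 1
    ext i
    simp only [hA, hB, mem_union, mem_filter]
    have := hall' i
    tauto
  have hnot : ∀ u w, u ≤ #A → m * w ≤ #B → u + m * w ≠ m * P := by
    intro u w hu hw hsum
    obtain ⟨T₁, h1, h1c⟩ := exists_subset_card_eq hu
    obtain ⟨T₂, h2, h2c⟩ := exists_subset_card_eq hw
    have hd := (hdisj.mono_left h1).mono_right h2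
    apply hfree (T₁ ∪ T₂) (union_subset (h1.trans (filter_subset _ _))
      (h2.trans (filter_subset _ _)))
    · rw [card_union_of_disjoint hd, h1c, h2c, hsum]
    · rw [sum_union hd, sum_congr rfl fun i hi => (mem_filter.1 (h1 hi)).2,
        sum_congr (s₁ := T₂) rfl fun i hi => (mem_filter.1 (h2 hi)).2, sum_const, sum_const, h1c,
        h2c, smul_add, ← add_assoc, ← add_smul, hsum]
      simp
  have hmpos : 0 < m := by omega
  obtain ⟨q₁, r₁, hr₁, hq₁⟩ : ∃ q r, r < m ∧ #A = m * q + r :=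
    ⟨#A / m, #A % m, Nat.mod_lt _ hmpos, (Nat.div_add_mod _ _).symm⟩
  obtain ⟨q₂, r₂, hr₂, hq₂⟩ : ∃ q r, r < m ∧ #B = m * q + r :=
    ⟨#B / m, #B % m, Nat.mod_lt _ hmpos, (Nat.div_add_mod _ _).symm⟩
  -- Otherwise multiples of m of each value would add up to mP terms of sum zero. As #A + #B = mP +
  -- m - 2, both remainders must then be m - 1.
  have hlt : q₁ + q₂ + 1 ≤ P := by
    by_contra hcon
    have : P - min q₂ P ≤ q₁ := by omega
    refine hnot (m * (P - min q₂ P)) (min q₂ P) ?_ ?_ ?_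
    · rw [hq₁]; exact (Nat.mul_le_mul_left _ this).trans (Nat.le_add_right _ _)
    · rw [hq₂]; exact (Nat.mul_le_mul_left _ (min_le_left _ _)).trans (Nat.le_add_right _ _)
    · rw [← mul_add]; congr 1; omega
  obtain ⟨t, rfl⟩ := Nat.exists_eq_add_of_le hlt
  have h1 : m * (q₁ + q₂ + 1 + t) = m * q₁ + m * q₂ + m + m * t := by ring
  rw [h1] at hF
  have ht : t = 0 := by
    by_contra ht
    have : m * 1 ≤ m * t := Nat.mul_le_mul_left _ (by omega)
    omega
  subst ht
  refine ⟨a, a + c, q₁ + 1, q₂ + 1, by simpa using hc.neg, by omega, by omega, by omega, ?_, ?_,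
    hall'⟩
  · rw [hq₁, add_mul, one_mul, mul_comm q₁]; omega
  · rw [hq₂, add_mul, one_mul, mul_comm q₂]; omega

end InverseZeroSums

section InverseZeroSums

variable {ι : Type*} [DecidableEq ι]

lemma Finset.exists_choice_of_mem_sum {κ V : Type*} [AddCommGroup V] [DecidableEq V]
    {R : Finset κ} {A : κ → Finset V} {x : V} (hx : x ∈ ∑ j ∈ R, A j) :
    ∃ g : κ → V, (∀ j ∈ R, g j ∈ A j) ∧ ∑ j ∈ R, g j = x := by
  have h : x ∈ ((∑ j ∈ R, A j : Finset V) : Set V) := hx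
  rw [Finset.coe_sum, Set.mem_finsetSum] at h
  obtain ⟨g, hg, h⟩ := h
  exact ⟨g, fun j hj => hg hj, h⟩

/-- An extremal family in `ZMod q` with `q` prime has a popular value. -/
lemma ZMod.exists_popular_of_prime {q P : ℕ} [hq : Fact q.Prime] (hP : 1 ≤ P) {F : Finset ι}
    {v : ι → ZMod q} (hF : #F + 2 = q * P + q) (hfree : ZeroSumFree P F v) :
    ∃ a, q ≤ #{i ∈ F | v i = a} + 2 := by
  by_contra hcon
  push Not at hcon
  obtain ⟨t, rfl⟩ : ∃ t, q = t + 3 := ⟨q - 3, by have := hcon 0; omega⟩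
  have hn : 2 * t + 4 ≤ #F := by
    have := Nat.mul_le_mul_left (t + 3) hP
    omega
  obtain ⟨u, hu1, hu2, hu3⟩ := exists_monotone_enumeration F (card_pos.1 (by omega))
    (fun i => (v i).val)
  have hdist : ∀ j, j + (t + 1) < #F → v (u j) ≠ v (u (j + (t + 1))) := by
    intro j hj he
    have hsub : (Icc j (j + (t + 1))).image u ⊆ {i ∈ F | v i = v (u j)} := by
      intro i hi
      obtain ⟨k, hk, rfl⟩ := Finset.mem_image.1 hi
      rw [mem_Icc] at hk
      refine mem_filter.2 ⟨hu1 k (by omega), ZMod.val_injective _ (le_antisymm ?_ ?_)⟩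
      · rw [he]; exact hu3 _ _ hk.2 hj
      · exact hu3 _ _ hk.1 (by omega)
    have h1 := card_le_card hsub
    rw [card_image_of_injOn (fun a ha b hb hab => by
      simp only [coe_Icc, Set.mem_Icc] at ha hb
      exact hu2 a (by omega) b (by omega) hab), Nat.card_Icc] at h1
    have := hcon (v (u j))
    omega
  -- In sorted order terms at distance t + 1 differ, since no value occurs more than t times. So the
  -- t + 1 = q - 2 groups contain two distinct values each, the first one three, and
  -- Cauchy–Davenport gives 1 + 2 + t = q sums. Thus some q - 2 terms have the same sum as F, and
  -- their complement is a forbidden zero sum.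
  let G : ℕ → Finset ℕ := fun j =>
    if j = 0 then {0, t + 1, 2 * (t + 1)} else {j, j + (t + 1)}
  have hG : ∀ j < t + 1, ∀ k ∈ G j, k % (t + 1) = j ∧ k < #F := by
    intro j hj k hk
    by_cases h0 : j = 0
    · simp only [G, h0, if_true, mem_insert, mem_singleton] at hk
      rcases hk with rfl | rfl | rfl
      · exact ⟨by simp [h0], by omega⟩
      · exact ⟨by simp [h0], by omega⟩
      · exact ⟨by simp [h0], by omega⟩
    · simp only [G, h0, if_false, mem_insert, mem_singleton] at hk
      rcases hk with rfl | rfl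
      · exact ⟨Nat.mod_eq_of_lt hj, by omega⟩
      · rw [Nat.add_mod_right]
        exact ⟨Nat.mod_eq_of_lt hj, by omega⟩
  let A : ℕ → Finset (ZMod (t + 3)) := fun j => (G j).image (fun k => v (u k))
  have hA0 : #(A 0) = 3 := by
    have h1 := hdist 0 (by omega)
    have h2 := hdist (t + 1) (by omega)
    have h3 := hu3 0 (t + 1) (by omega) (by omega)
    have h4 := hu3 (t + 1) (2 * (t + 1)) (by omega) (by omega)
    rw [zero_add] at h1
    rw [← two_mul] at h2
    have h5 : v (u 0) ≠ v (u (2 * (t + 1))) := by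
      intro h
      rw [← h] at h4
      exact h1 (ZMod.val_injective _ (le_antisymm h3 h4))
    simp only [A, G, if_true, image_insert, image_singleton]
    exact card_eq_three.2 ⟨_, _, _, h1, h5, h2, rfl⟩
  have hA1 : ∀ j < t, #(A (j + 1)) = 2 := by
    intro j hj
    simp only [A, G, Nat.succ_ne_zero, if_false, image_insert, image_singleton]
    exact card_pair (hdist (j + 1) (by omega))
  have hcard := ZMod.min_le_card_sum (range (t + 1)) A (fun j hj => by
    rw [← card_pos]
    rcases j with _ | j
    · rw [hA0]; omega
    · rw [hA1 j (by have := mem_range.1 hj; omega)]; omega)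
  rw [sum_range_succ', hA0, sum_congr rfl (fun j hj => by rw [hA1 j (mem_range.1 hj)])] at hcard
  simp only [Nat.reduceSub, sum_const, card_range, smul_eq_mul, mul_one] at hcard
  have huniv : ∑ j ∈ range (t + 1), A j = univ := by
    apply Finset.eq_univ_of_card
    rw [ZMod.card]
    apply le_antisymm
    · exact (card_le_univ _).trans_eq (ZMod.card _)
    · omega
  have hσ : ∑ i ∈ F, v i ∈ ∑ j ∈ range (t + 1), A j := by rw [huniv]; exact mem_univ _
  obtain ⟨g, hg, hgσ⟩ := exists_choice_of_mem_sum hσ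
  have hch : ∀ j, ∃ k, j ∈ range (t + 1) → k ∈ G j ∧ v (u k) = g j := by
    intro j
    by_cases hj : j ∈ range (t + 1)
    · obtain ⟨k, hk, hkg⟩ := Finset.mem_image.1 (hg j hj)
      exact ⟨k, fun _ => ⟨hk, hkg⟩⟩
    · exact ⟨0, fun h => absurd h hj⟩
  choose h hh using hch
  have hinj : Set.InjOn (fun j => u (h j)) (range (t + 1) : Finset ℕ) := by
    intro a ha b hb hab
    have ha' := hG a (mem_range.1 ha) _ (hh a ha).1
    have hb' := hG b (mem_range.1 hb) _ (hh b hb).1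
    have := hu2 _ ha'.2 _ hb'.2 hab
    rw [← ha'.1, ← hb'.1, this]
  set J := (range (t + 1)).image (fun j => u (h j)) with hJ
  have hJF : J ⊆ F := by
    intro i hi
    obtain ⟨j, hj, rfl⟩ := Finset.mem_image.1 hi
    exact hu1 _ (hG j (mem_range.1 hj) _ (hh j hj).1).2
  have hJc : #J = t + 1 := by rw [hJ, card_image_of_injOn hinj, card_range]
  have hJs : ∑ i ∈ J, v i = ∑ i ∈ F, v i := by
    rw [← hgσ, hJ, sum_image hinj]
    exact sum_congr rfl fun j hj => (hh j hj).2
  apply hfree (F \ J) sdiff_subset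
  · rw [card_sdiff_of_subset hJF, hJc]; omega
  · rw [← sum_sdiff hJF] at hJs
    simpa using hJs.symm

/-- Inverse Erdős–Ginzburg–Ziv theorem for a prime modulus. -/
theorem ZMod.isTwoValued_of_prime {q P : ℕ} [hq : Fact q.Prime] (hP : 1 ≤ P) {F : Finset ι}
    {v : ι → ZMod q} (hF : #F + 2 = q * P + q) (hfree : ZeroSumFree P F v) :
    IsTwoValued P F v := by
  obtain ⟨a, ha⟩ := ZMod.exists_popular_of_prime hP hF hfree
  exact ZMod.isTwoValued_of_popular hq.out.two_le hF hfree ha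

/-- The quotient by `m` of an element of `ZMod (q * m)`. -/
def ZMod.quot (q m : ℕ) (y : ZMod (q * m)) : ZMod q := ((y.val / m : ℕ) : ZMod q)

section Quotient

variable {q m : ℕ} [NeZero q] [NeZero m]

lemma ZMod.dvd_val_of_castHom_eq_zero {y : ZMod (q * m)}
    (h : ZMod.castHom (dvd_mul_left m q) (ZMod m) y = 0) : m ∣ y.val := by
  rw [ZMod.castHom_apply, ZMod.cast_eq_val, ZMod.natCast_eq_zero_iff] at h
  exact h

/-- On multiples of m the map `quot` is the isomorphism onto ℤ/q; only its effect on the vanishing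
of sums is needed. -/
lemma ZMod.sum_quot_eq_zero_iff {κ : Type*} {s : Finset κ} {y : κ → ZMod (q * m)}
    (h : ∀ j ∈ s, ZMod.castHom (dvd_mul_left m q) (ZMod m) (y j) = 0) :
    ∑ j ∈ s, ZMod.quot q m (y j) = 0 ↔ ∑ j ∈ s, y j = 0 := by
  have h1 : ∑ j ∈ s, y j = ((m * ∑ j ∈ s, (y j).val / m : ℕ) : ZMod (q * m)) := by
    rw [mul_sum, Nat.cast_sum]
    apply sum_congr rfl
    intro j hj
    rw [Nat.mul_div_cancel' (ZMod.dvd_val_of_castHom_eq_zero (h j hj)), ZMod.natCast_zmod_val]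
  have h2 : q * m ∣ m * ∑ j ∈ s, (y j).val / m ↔ q ∣ ∑ j ∈ s, (y j).val / m := by
    generalize ∑ j ∈ s, (y j).val / m = x
    rw [mul_comm q, Nat.mul_dvd_mul_iff_left (NeZero.pos m)]
  rw [h1, ZMod.natCast_eq_zero_iff, h2, ← ZMod.natCast_eq_zero_iff, Nat.cast_sum]
  rfl

lemma ZMod.quot_injOn {y z : ZMod (q * m)}
    (hy : ZMod.castHom (dvd_mul_left m q) (ZMod m) y = 0)
    (hz : ZMod.castHom (dvd_mul_left m q) (ZMod m) z = 0)
    (h : ZMod.quot q m y = ZMod.quot q m z) : y = z := by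
  apply ZMod.val_injective
  rw [← Nat.mul_div_cancel' (ZMod.dvd_val_of_castHom_eq_zero hy),
    ← Nat.mul_div_cancel' (ZMod.dvd_val_of_castHom_eq_zero hz)]
  congr 1
  have h1 := (ZMod.natCast_eq_natCast_iff' _ _ _).1 h
  rwa [Nat.mod_eq_of_lt, Nat.mod_eq_of_lt] at h1
  · exact Nat.div_lt_of_lt_mul (by rw [mul_comm m]; exact ZMod.val_lt z)
  · exact Nat.div_lt_of_lt_mul (by rw [mul_comm m]; exact ZMod.val_lt y)

end Quotient

end InverseZeroSums

section InverseZeroSums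

variable {ι : Type*} [DecidableEq ι]

lemma Finset.pairwiseDisjoint_of_lt {B : ℕ → Finset ι} {N : ℕ}
    (hd : ∀ i < N, ∀ j < N, i ≠ j → Disjoint (B i) (B j)) {R : Finset ℕ} (hR : R ⊆ range N) :
    (R : Set ℕ).PairwiseDisjoint B := by
  intro i hi j hj hij
  exact hd i (mem_range.1 (hR hi)) j (mem_range.1 (hR hj)) hij

section Reduction

variable {q m P : ℕ} [hq : Fact q.Prime] [NeZero m]

/-- The block sums of an extremal family modulo `q * m`. -/
lemma ZeroSumFree.blocks {N : ℕ} {F : Finset ι} {v : ι → ZMod (q * m)} (hfree : ZeroSumFree P F v)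
    {B : ℕ → Finset ι}
    (hB : ∀ j < N, B j ⊆ F ∧ #(B j) = m ∧
      ∑ i ∈ B j, ZMod.castHom (dvd_mul_left m q) (ZMod m) (v i) = 0)
    (hd : ∀ i < N, ∀ j < N, i ≠ j → Disjoint (B i) (B j)) :
    ZeroSumFree P (range N) (fun j => ZMod.quot q m (∑ i ∈ B j, v i)) := by
  have := NeZero.of_pos hq.out.pos
  intro R hR hRc hsum
  have hpd := pairwiseDisjoint_of_lt hd hR
  rw [ZMod.sum_quot_eq_zero_iff (fun j hj => by
    rw [map_sum]; exact (hB j (mem_range.1 (hR hj))).2.2)] at hsum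
  apply hfree (R.biUnion B)
  · rw [biUnion_subset]
    exact fun j hj => (hB j (mem_range.1 (hR hj))).1
  · rw [card_biUnion hpd, sum_congr rfl fun j hj => (hB j (mem_range.1 (hR hj))).2.1, sum_const,
      hRc, smul_eq_mul]
    ring
  · rw [sum_biUnion hpd, hsum]

/-- A zero sum modulo m of that length splits into qP + q - 1 blocks, and EGZ modulo q for their
quotients selects qP of them. So an extremal family modulo qm stays extremal modulo m, with a new P.
-/
lemma ZeroSumFree.castHom {F : Finset ι} {v : ι → ZMod (q * m)} (hfree : ZeroSumFree P F v) :
    ZeroSumFree (q * P + q - 1) F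
      (fun i => ZMod.castHom (dvd_mul_left m q) (ZMod m) (v i)) := by
  intro T hT hTc hsum
  obtain ⟨B, hB, hd⟩ := ZMod.exists_blocks_of_sum_eq_zero (NeZero.pos m) _ _ T hTc hsum
  obtain ⟨R, hR, hRc, hRs⟩ := ZMod.exists_card_eq_mul_sum_eq_zero hq.out.pos
    (fun j => ZMod.quot q m (∑ i ∈ B j, v i)) P (range (q * P + q - 1)) (by
      rw [card_range]; omega)
  exact hfree.blocks (fun j hj => ⟨(hB j hj).1.trans hT, (hB j hj).2⟩) hd R hR hRc hRs

/-- Terms in a class with large multiplicity can be exchanged, so they are all equal. -/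
lemma ZeroSumFree.eq_of_castHom_eq (hq3 : 3 ≤ q) (hm : 2 ≤ m) (hP : 1 ≤ P) {F : Finset ι}
    {v : ι → ZMod (q * m)} (hfree : ZeroSumFree P F v) {a b : ZMod m} {k₁ k₂ : ℕ} (hk₁ : q ≤ k₁)
    (hk₂ : 1 ≤ k₂) (hk : k₁ + k₂ = q * P + q) (hab : a ≠ b)
    (ha : #{i ∈ F | ZMod.castHom (dvd_mul_left m q) (ZMod m) (v i) = a} + 1 = k₁ * m)
    (hb : #{i ∈ F | ZMod.castHom (dvd_mul_left m q) (ZMod m) (v i) = b} + 1 = k₂ * m)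
    {i j : ι} (hi : i ∈ F) (hj : j ∈ F)
    (hia : ZMod.castHom (dvd_mul_left m q) (ZMod m) (v i) = a)
    (hja : ZMod.castHom (dvd_mul_left m q) (ZMod m) (v j) = a) : v i = v j := by
  have := NeZero.of_pos hq.out.pos
  set φ := ZMod.castHom (dvd_mul_left m q) (ZMod m) with hφ
  by_contra hvij
  have hij : i ≠ j := fun h => hvij (by rw [h])
  set A := {i ∈ F | φ (v i) = a} with hA
  set C := {i ∈ F | φ (v i) = b} with hC
  have hAC : Disjoint A C := by
    rw [disjoint_left]
    intro x hx hx'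
    exact hab ((mem_filter.1 hx).2.symm.trans (mem_filter.1 hx').2)
  obtain ⟨l, rfl⟩ : ∃ l, k₁ = l + 2 := ⟨k₁ - 2, by omega⟩
  obtain ⟨l₂, rfl⟩ : ∃ l, k₂ = l + 1 := ⟨k₂ - 1, by omega⟩
  have hmulA : (l + 2) * m = l * m + 2 * m := by ring
  have hmulC : (l₂ + 1) * m = l₂ * m + m := by ring
  have hijA : {i, j} ⊆ A := by
    intro x hx
    rw [mem_insert, mem_singleton] at hx
    rcases hx with rfl | rfl
    · exact mem_filter.2 ⟨hi, hia⟩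
    · exact mem_filter.2 ⟨hj, hja⟩
  obtain ⟨Q, hQ, hQc⟩ := exists_subset_card_eq (s := A \ {i, j}) (n := m - 1) (by
    rw [card_sdiff_of_subset hijA, card_pair hij]; omega)
  have hQA : Q ⊆ A := hQ.trans sdiff_subset
  have hiQ : i ∉ Q := fun h => (mem_sdiff.1 (hQ h)).2 (by simp)
  have hjQ : j ∉ Q := fun h => (mem_sdiff.1 (hQ h)).2 (by simp)
  have hijQ : insert i (insert j Q) ⊆ A := by
    intro x hx
    rw [mem_insert, mem_insert] at hx
    rcases hx with rfl | rfl | hx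
    · exact hijA (by simp)
    · exact hijA (by simp)
    · exact hQA hx
  obtain ⟨Y₁, hY₁, hY₁c⟩ := exists_subset_card_eq (s := A \ insert i (insert j Q)) (n := l * m) (by
    rw [card_sdiff_of_subset hijQ, card_insert_of_notMem (by simp [hij, hiQ]),
      card_insert_of_notMem hjQ]
    omega)
  obtain ⟨Y₂, hY₂, hY₂c⟩ := exists_subset_card_eq (s := C) (n := l₂ * m) (by omega)
  have hY₁A : Y₁ ⊆ A := hY₁.trans sdiff_subset
  have hYd : Disjoint Y₁ Y₂ := (hAC.mono_left hY₁A).mono_right hY₂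
  obtain ⟨B, hB, hd⟩ := ZMod.exists_blocks_of_sum_eq_zero (NeZero.pos m) (fun i => φ (v i))
    (l + l₂) (Y₁ ∪ Y₂) (by rw [card_union_of_disjoint hYd, hY₁c, hY₂c]; ring) (by
      rw [sum_union hYd, sum_congr rfl fun i hi => (mem_filter.1 (hY₁A hi)).2,
        sum_congr (s₁ := Y₂) rfl fun i hi => (mem_filter.1 (hY₂ hi)).2, sum_const, sum_const, hY₁c,
        hY₂c]
      simp)
  have hYF : Y₁ ∪ Y₂ ⊆ F :=
    union_subset (hY₁A.trans (filter_subset _ _)) (hY₂.trans (filter_subset _ _))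
  have hYQ : Disjoint (Y₁ ∪ Y₂) (insert i (insert j Q)) := by
    rw [disjoint_union_left]
    exact ⟨sdiff_disjoint.mono_left hY₁, (hAC.symm.mono_left hY₂).mono_right hijQ⟩
  set N := l + l₂ with hN
  have hblocks : ∀ x ∈ ({i, j} : Finset ι), ∃ D : ℕ → Finset ι, (∀ k < N, D k = B k) ∧
      D N = insert x Q ∧ (∀ k < N + 1, D k ⊆ F ∧ #(D k) = m ∧ ∑ i ∈ D k, φ (v i) = 0) ∧
      ∀ k < N + 1, ∀ k' < N + 1, k ≠ k' → Disjoint (D k) (D k') := by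
    intro x hx
    have hxQ : x ∉ Q := fun h => (mem_sdiff.1 (hQ h)).2 hx
    have hxA : insert x Q ⊆ A := insert_subset (hijA hx) hQA
    have hdis : ∀ k < N, Disjoint (B k) (insert x Q) := by
      intro k hk
      refine (hYQ.mono_left (hB k hk).1).mono_right ?_
      rw [insert_subset_iff]
      refine ⟨?_, (subset_insert _ _).trans (subset_insert _ _)⟩
      rw [mem_insert, mem_singleton] at hx
      rcases hx with rfl | rfl <;> simp
    refine ⟨Function.update B N (insert x Q), fun k hk => Function.update_of_ne hk.ne _ _,
      Function.update_self _ _ _, fun k hk => ?_, fun k hk k' hk' hkk => ?_⟩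
    · rcases Nat.lt_succ_iff_lt_or_eq.1 hk with h | rfl
      · rw [Function.update_of_ne h.ne]
        exact ⟨(hB k h).1.trans hYF, (hB k h).2⟩
      · rw [Function.update_self]
        refine ⟨hxA.trans (filter_subset _ _), ?_, ?_⟩
        · rw [card_insert_of_notMem hxQ, hQc]; omega
        · rw [sum_congr rfl fun i hi => (mem_filter.1 (hxA hi)).2, sum_const,
            card_insert_of_notMem hxQ, hQc, Nat.sub_add_cancel (by omega)]
          simp
    · rcases Nat.lt_succ_iff_lt_or_eq.1 hk with h | rfl <;>
      rcases Nat.lt_succ_iff_lt_or_eq.1 hk' with h' | rfl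
      · rw [Function.update_of_ne h.ne, Function.update_of_ne h'.ne]
        exact hd k h k' h' hkk
      · rw [Function.update_of_ne h.ne, Function.update_self]
        exact hdis k h
      · rw [Function.update_of_ne h'.ne, Function.update_self]
        exact (hdis k' h').symm
      · exact absurd rfl hkk
  obtain ⟨D, hD1, hD2, hD3, hD4⟩ := hblocks i (by simp)
  obtain ⟨E, hE1, hE2, hE3, hE4⟩ := hblocks j (by simp)
  set x := ZMod.quot q m (∑ k ∈ insert i Q, v k) with hx
  set x' := ZMod.quot q m (∑ k ∈ insert j Q, v k) with hx'
  have hxx : x ≠ x' := by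
    intro h
    have h1 := ZMod.quot_injOn (q := q) (m := m) (by
      have := (hD3 N (by omega)).2.2
      rw [hD2, ← map_sum] at this
      exact this) (by
      have := (hE3 N (by omega)).2.2
      rw [hE2, ← map_sum] at this
      exact this) h
    rw [sum_insert hiQ, sum_insert hjQ, add_left_inj] at h1
    exact hvij h1
  have hcount : ∀ D : ℕ → Finset ι, (∀ k < N, D k = B k) →
      #{k ∈ range (N + 1) | ZMod.quot q m (∑ i ∈ D k, v i) = x} =
      #{k ∈ range N | ZMod.quot q m (∑ i ∈ B k, v i) = x} +
        if ZMod.quot q m (∑ i ∈ D N, v i) = x then 1 else 0 := by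
    intro D hD
    rw [range_add_one, filter_insert]
    have h1 : {k ∈ range N | ZMod.quot q m (∑ i ∈ D k, v i) = x} =
        {k ∈ range N | ZMod.quot q m (∑ i ∈ B k, v i) = x} := by
      apply filter_congr
      intro k hk
      rw [hD k (mem_range.1 hk)]
    rw [h1]
    split_ifs
    · rw [card_insert_of_notMem (by simp)]
    · rfl
  have hNP : N + 1 + 2 = q * P + q := by omega
  have hTD := ZMod.isTwoValued_of_prime hP (by rw [card_range]; exact hNP) (hfree.blocks hD3 hD4)
  have hTE := ZMod.isTwoValued_of_prime hP (by rw [card_range]; exact hNP) (hfree.blocks hE3 hE4)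
  have hcD := hcount D hD1
  have hcE := hcount E hE1
  rw [hD2, if_pos rfl] at hcD
  rw [hE2, if_neg hxx.symm] at hcE
  -- In a two-valued family modulo q every multiplicity is 0 or congruent to -1. The exchange
  -- changes the multiplicity of x by one, which is impossible for q ≥ 3.
  have hmod : ∀ G : ℕ → ZMod q, IsTwoValued P (range (N + 1)) G →
      #{k ∈ range (N + 1) | G k = x} = 0 ∨ q ∣ #{k ∈ range (N + 1) | G k = x} + 1 := by
    rintro G ⟨a', b', n₁, n₂, -, -, -, -, h1, h2, h3⟩
    by_cases hxa : x = a'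
    · right; rw [hxa, h1]; exact dvd_mul_left _ _
    by_cases hxb : x = b'
    · right; rw [hxb, h2]; exact dvd_mul_left _ _
    left
    rw [card_eq_zero, filter_eq_empty_iff]
    intro k hk hkx
    rcases h3 k hk with h | h
    · exact hxa (hkx.symm.trans h)
    · exact hxb (hkx.symm.trans h)
  have h1 := hmod _ hTD
  have h2 := hmod _ hTE
  rw [hcD] at h1
  rw [hcE, add_zero] at h2
  set e := #{k ∈ range N | ZMod.quot q m (∑ i ∈ B k, v i) = x}
  rcases h1 with h1 | h1
  · omega
  · rcases h2 with h2 | h2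
    · rw [h2] at h1
      have := Nat.le_of_dvd (by omega) h1
      omega
    · have h3 := (Nat.dvd_add_right h2).1 h1
      have := Nat.le_of_dvd (by omega) h3
      omega

end Reduction

/-- Inverse Erdős–Ginzburg–Ziv theorem: in a family of `m * P + m - 2` elements of `ZMod m`, where
`m` is odd, without a zero-sum subfamily of length `m * P` there are just two values. -/
theorem ZMod.isTwoValued {m : ℕ} (hm : 2 ≤ m) (hodd : Odd m) {P : ℕ} (hP : 1 ≤ P) {F : Finset ι}
    {v : ι → ZMod m} (hF : #F + 2 = m * P + m) (hfree : ZeroSumFree P F v) :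
    IsTwoValued P F v := by
  induction m using Nat.strong_induction_on generalizing P with
  | _ n ih =>
    by_cases hn : n.Prime
    · have : Fact n.Prime := ⟨hn⟩
      exact ZMod.isTwoValued_of_prime hP hF hfree
    obtain ⟨m, hmn⟩ := Nat.minFac_dvd n
    have hq : n.minFac.Prime := Nat.minFac_prime (by omega)
    rw [mul_comm] at hmn
    set q := n.minFac with hqdef
    clear_value q
    rw [mul_comm] at hmn
    subst hmn
    have : Fact q.Prime := ⟨hq⟩
    have hm0 : m ≠ 0 := by rintro rfl; simp at hm
    have hm1 : m ≠ 1 := by rintro rfl; rw [mul_one] at hn; exact hn hq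
    have : NeZero m := ⟨hm0⟩
    have : NeZero q := ⟨hq.ne_zero⟩
    -- Oddness of the modulus enters here: the exchange argument needs q ≥ 3.
    have hq3 : 3 ≤ q := by
      have h1 := hq.two_le
      have h2 := (Nat.odd_mul.1 hodd).1
      rcases h1.lt_or_eq with h | h
      · exact h
      · rw [← h] at h2; exact absurd h2 (by decide)
    have hlt : m < q * m := by nlinarith [Nat.pos_of_ne_zero hm0]
    obtain ⟨a, b, k₁, k₂, hab, hk₁, hk₂, hk, ha, hb, -⟩ := ih m hlt (by omega)
      (Nat.odd_mul.1 hodd).2 (P := q * P + q - 1) (by omega) (by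
        rw [hF]
        have h1 : q * P + q - 1 + 1 = q * P + q := by omega
        calc q * m * P + q * m = m * (q * P + q) := by ring
          _ = m * (q * P + q - 1 + 1) := by rw [h1]
          _ = _ := by ring) hfree.castHom
    have hk' : k₁ + k₂ = q * P + q := by omega
    have hne : a ≠ b := by
      rintro rfl
      rw [sub_self] at hab
      have : Fact (1 < m) := ⟨by omega⟩
      exact not_isUnit_zero hab
    -- Since k₁ + k₂ ≥ 2q, one residue class modulo m has at least qm - 1 terms. They are all equal
    -- by exchange, so their value is popular.
    have hfin : ∀ a b k₁ k₂, q ≤ k₁ → 1 ≤ k₂ → k₁ + k₂ = q * P + q → a ≠ b →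
        #{i ∈ F | ZMod.castHom (dvd_mul_left m q) (ZMod m) (v i) = a} + 1 = k₁ * m →
        #{i ∈ F | ZMod.castHom (dvd_mul_left m q) (ZMod m) (v i) = b} + 1 = k₂ * m →
        IsTwoValued P F v := by
      intro a b k₁ k₂ hk₁ hk₂ hk hne ha hb
      have hqk : q * m ≤ k₁ * m := Nat.mul_le_mul_right _ hk₁
      obtain ⟨i, hi⟩ : {i ∈ F | ZMod.castHom (dvd_mul_left m q) (ZMod m) (v i) = a}.Nonempty := by
        rw [← card_pos]; omega
      rw [mem_filter] at hi
      refine ZMod.isTwoValued_of_popular hm hF hfree (a := v i) ?_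
      have hsub : {i ∈ F | ZMod.castHom (dvd_mul_left m q) (ZMod m) (v i) = a} ⊆
          {j ∈ F | v j = v i} := by
        intro j hj
        rw [mem_filter] at hj ⊢
        exact ⟨hj.1, hfree.eq_of_castHom_eq hq3 (by omega) hP hk₁ hk₂ hk hne ha hb hj.1 hi.1 hj.2
          hi.2⟩
      have := card_le_card hsub
      omega
    have h2q : q * 1 ≤ q * P := Nat.mul_le_mul_left _ hP
    by_cases hqk : q ≤ k₁
    · exact hfin a b k₁ k₂ hqk hk₂ hk' hne ha hb
    · exact hfin b a k₂ k₁ (by omega) hk₁ (by omega) hne.symm hb ha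

end InverseZeroSums

/-! ### Orderings of terms and the insertion of class-zero blocks. -/

section Realization

variable {p m : ℕ} [hp : Fact p.Prime] [NeZero m] {ω : ZMod p → ZMod m} {ι : Type*} [DecidableEq ι]

/-- The component in `ZMod p` of a product of elements of `ZMod m ⋊ ZMod p`. -/
def seqClass (el : ι → ZMod p × ZMod m) (l : List ι) : ZMod p := (l.map fun i => (el i).1).sum

/-- The component in `ZMod m` of a product of elements of `ZMod m ⋊ ZMod p`. -/
def seqValue (ω : ZMod p → ZMod m) (el : ι → ZMod p × ZMod m) : List ι → ZMod m
  | [] => 0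
  | i :: l => ω (seqClass el l) * (el i).2 + seqValue ω el l

/-- The terms indexed by `T` can be ordered so that their product is `(0, g)` and all elements of
`P` occur as components of products of final segments. -/
def Realizes (ω : ZMod p → ZMod m) (el : ι → ZMod p × ZMod m) (P : Set (ZMod p)) (T : Finset ι)
    (g : ZMod m) : Prop :=
  ∃ l : List ι, l.Nodup ∧ l.toFinset = T ∧ seqClass el l = 0 ∧ seqValue ω el l = g ∧
    ∀ j ∈ P, ∃ l', l' <:+ l ∧ seqClass el l' = j

variable {el : ι → ZMod p × ZMod m}

@[simp] lemma seqClass_nil : seqClass el [] = 0 := rfl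

@[simp] lemma seqClass_cons (i : ι) (l : List ι) :
    seqClass el (i :: l) = (el i).1 + seqClass el l := by simp [seqClass]

@[simp] lemma seqClass_append (l l' : List ι) :
    seqClass el (l ++ l') = seqClass el l + seqClass el l' := by simp [seqClass]

lemma seqClass_eq_sum {l : List ι} (h : l.Nodup) :
    seqClass el l = ∑ i ∈ l.toFinset, (el i).1 := by
  rw [seqClass, List.sum_toFinset _ h]

@[simp] lemma seqValue_nil : seqValue ω el [] = 0 := rfl

lemma seqValue_cons (i : ι) (l : List ι) :
    seqValue ω el (i :: l) = ω (seqClass el l) * (el i).2 + seqValue ω el l := rfl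

namespace IsWeight

variable (hω : IsWeight ω)
include hω

/-- The multiplication rule of the semidirect product: the value of the left factor is twisted by
the class of the right one. -/
lemma seqValue_append (l l' : List ι) :
    seqValue ω el (l ++ l') = ω (seqClass el l') * seqValue ω el l + seqValue ω el l' := by
  induction l with
  | nil => simp
  | cons i l ih =>
    rw [List.cons_append, seqValue_cons, ih, seqValue_cons, seqClass_append, hω.map_add]
    ring

lemma realizes_insert {P Q : Set (ZMod p)} {T B : Finset ι} {g v : ZMod m} {j : ZMod p}
    (hT : Realizes ω el P T g) (hB : Realizes ω el Q B v) (hd : Disjoint T B)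
    (hj : j = 0 ∨ j ∈ P) : Realizes ω el P (T ∪ B) (g + ω j * v) := by
  obtain ⟨l, h1, h2, h3, h4, h5⟩ := hT
  obtain ⟨b, b1, b2, b3, b4, -⟩ := hB
  have hs : ∃ l', l' <:+ l ∧ seqClass el l' = j := by
    rcases hj with rfl | hj
    · exact ⟨[], List.nil_suffix, rfl⟩
    · exact h5 j hj
  obtain ⟨l₂, ⟨l₁, rfl⟩, hl₂⟩ := hs
  have hperm : (l₁ ++ (b ++ l₂)).Perm ((l₁ ++ l₂) ++ b) := by
    rw [List.append_assoc]
    exact List.Perm.append_left _ List.perm_append_comm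
  refine ⟨l₁ ++ (b ++ l₂), ?_, ?_, ?_, ?_, ?_⟩
  · rw [hperm.nodup_iff, List.nodup_append]
    refine ⟨h1, b1, fun x hx y hy hxy => ?_⟩
    subst hxy
    exact disjoint_left.1 hd (h2 ▸ List.mem_toFinset.2 hx) (b2 ▸ List.mem_toFinset.2 hy)
  · rw [List.toFinset_eq_of_perm _ _ hperm, List.toFinset_append, h2, b2]
  · rw [seqClass_append] at h3
    rw [seqClass_append, seqClass_append, b3, zero_add, h3]
  · rw [hω.seqValue_append] at h4
    rw [hω.seqValue_append, hω.seqValue_append, seqClass_append, b3, zero_add, ← h4, b4, hl₂]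
    ring
  · intro k hk
    obtain ⟨l', hl', hk'⟩ := h5 k hk
    -- A final segment of the old word either lies in l₂ and survives, or contains l₂ and is
    -- lengthened by b, which has class 0. So no suffix class is lost.
    rcases List.suffix_or_suffix_of_suffix hl' (List.suffix_append l₁ l₂) with h | ⟨t, rfl⟩
    · exact ⟨l', (h.trans (List.suffix_append _ _)).trans (List.suffix_append _ _), hk'⟩
    · obtain ⟨t', ht'⟩ := hl'
      rw [← List.append_assoc, List.append_left_inj] at ht'
      subst ht'
      refine ⟨t ++ (b ++ l₂), ⟨t', by simp⟩, ?_⟩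
      rw [← hk', seqClass_append, seqClass_append, seqClass_append, b3, zero_add]

lemma realizes_union {P Q : Set (ZMod p)} {T B : Finset ι} {g v : ZMod m}
    (hT : Realizes ω el P T g) (hB : Realizes ω el Q B v) (hd : Disjoint T B) :
    Realizes ω el P (T ∪ B) (g + v) := by
  simpa [hω.map_zero] using hω.realizes_insert hT hB hd (Or.inl rfl)

omit hω in
lemma _root_.Realizes.mono {P Q : Set (ZMod p)} {T : Finset ι} {g : ZMod m}
    (hT : Realizes ω el P T g) (h : Q ⊆ P) : Realizes ω el Q T g := by
  obtain ⟨l, h1, h2, h3, h4, h5⟩ := hT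
  exact ⟨l, h1, h2, h3, h4, fun j hj => h5 j (h hj)⟩

omit hω in
lemma _root_.realizes_empty : Realizes ω el ∅ ∅ 0 := ⟨[], by simp, by simp, rfl, rfl, by simp⟩

lemma realizes_singleton {i : ι} (hi : (el i).1 = 0) : Realizes ω el ∅ {i} (el i).2 :=
  ⟨[i], by simp, by simp, by simp [hi], by simp [seqValue_cons, hω.map_zero], by simp⟩

/-- Inserting several blocks. -/
lemma realizes_biUnion {κ : Type*} [DecidableEq κ] {P : Set (ZMod p)} {T : Finset ι} {g : ZMod m}
    (hT : Realizes ω el P T g) (J : Finset κ) (B : κ → Finset ι) (v : κ → ZMod m) (e : κ → ZMod p)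
    (hB : ∀ k ∈ J, Realizes ω el ∅ (B k) (v k)) (hTB : ∀ k ∈ J, Disjoint T (B k))
    (hd : (J : Set κ).PairwiseDisjoint B) (he : ∀ k ∈ J, e k = 0 ∨ e k ∈ P) :
    Realizes ω el P (T ∪ J.biUnion B) (g + ∑ k ∈ J, ω (e k) * v k) := by
  induction J using Finset.induction_on with
  | empty => simpa using hT
  | insert k J hk ih =>
    have h1 := ih (fun i hi => hB i (mem_insert_of_mem hi))
      (fun i hi => hTB i (mem_insert_of_mem hi)) (hd.subset (by simp))
      (fun i hi => he i (mem_insert_of_mem hi))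
    have h2 := hω.realizes_insert h1 (hB k (mem_insert_self _ _)) (j := e k) (by
      rw [disjoint_union_left, disjoint_biUnion_left]
      refine ⟨hTB k (mem_insert_self _ _), fun i hi => ?_⟩
      exact hd (by simp [hi]) (by simp) (fun h => hk (h ▸ hi))) (he k (mem_insert_self _ _))
    rw [sum_insert hk, biUnion_insert, union_comm (B k), ← union_assoc]
    convert h2 using 1
    ring

/-- Inserting several elements of class zero. -/
lemma realizes_inner {P : Set (ZMod p)} {T : Finset ι} {g : ZMod m}
    (hT : Realizes ω el P T g) (J : Finset ι) (e : ι → ZMod p)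
    (hJ : ∀ i ∈ J, (el i).1 = 0) (hTJ : Disjoint T J) (he : ∀ k ∈ J, e k = 0 ∨ e k ∈ P) :
    Realizes ω el P (T ∪ J) (g + ∑ k ∈ J, ω (e k) * (el k).2) := by
  have := hω.realizes_biUnion hT J (fun i => {i}) (fun i => (el i).2) e
    (fun k hk => hω.realizes_singleton (hJ k hk))
    (fun k hk => disjoint_singleton_right.2 fun h => disjoint_left.1 hTJ h hk)
    (fun a _ b _ hab => disjoint_singleton.2 hab) he
  rwa [biUnion_singleton_eq_self] at this

/-- Rotating a product. -/
lemma realizes_rotate {P : Set (ZMod p)} {T : Finset ι} {g : ZMod m} {j : ZMod p}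
    (hT : Realizes ω el P T g) (hj : j ∈ P) : Realizes ω el ∅ T (ω (-j) * g) := by
  obtain ⟨l, h1, h2, h3, h4, h5⟩ := hT
  obtain ⟨l₂, ⟨l₁, rfl⟩, hl₂⟩ := h5 j hj
  rw [seqClass_append] at h3
  refine ⟨l₂ ++ l₁, ?_, ?_, ?_, ?_, by simp⟩
  · rwa [List.perm_append_comm.nodup_iff]
  · rw [List.toFinset_eq_of_perm _ _ List.perm_append_comm, h2]
  · rw [seqClass_append, add_comm, h3]
  · rw [hω.seqValue_append] at h4
    rw [hω.seqValue_append, ← h4]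
    have h6 : seqClass el l₁ = -j := by rw [← hl₂]; exact eq_neg_of_add_eq_zero_left h3
    rw [h6, hl₂, mul_add, ← mul_assoc, ← hω.map_add, neg_add_cancel, hω.map_zero]
    ring

omit hω in
/-- A set of terms of class zero can be ordered with a prescribed last term. -/
lemma _root_.exists_realizes {T : Finset ι} (hT : ∑ i ∈ T, (el i).1 = 0) {i : ι} (hi : i ∈ T) :
    ∃ g, Realizes ω el {(el i).1} T g := by
  have h1 : ((T.erase i).toList ++ [i]).Nodup := by
    rw [List.nodup_append]
    refine ⟨nodup_toList _, by simp, fun a ha b hb hab => ?_⟩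
    rw [List.mem_singleton] at hb
    rw [mem_toList, hab, hb] at ha
    exact notMem_erase _ _ ha
  have h2 : ((T.erase i).toList ++ [i]).toFinset = T := by
    rw [List.toFinset_append, toList_toFinset]
    ext x
    simp only [mem_union, mem_erase, List.toFinset_cons, List.toFinset_nil, insert_empty_eq,
      mem_singleton]
    by_cases hx : x = i <;> simp [hx, hi]
  refine ⟨_, (T.erase i).toList ++ [i], h1, h2, ?_, rfl, ?_⟩
  · rw [seqClass_eq_sum h1, h2, hT]
  · rintro j rfl
    exact ⟨[i], List.suffix_append _ _, by simp⟩

omit hω in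
lemma _root_.exists_realizes' {T : Finset ι} (hT : ∑ i ∈ T, (el i).1 = 0) :
    ∃ g, Realizes ω el ∅ T g := by
  refine ⟨_, T.toList, nodup_toList _, toList_toFinset _, ?_, rfl, by simp⟩
  rw [seqClass_eq_sum (nodup_toList _), toList_toFinset, hT]

/-- `p` terms of the same nonzero class, in the order prescribed by `h`. -/
lemma realizes_of_class_eq {e : ZMod p} (he : e ≠ 0) {h : ℕ → ι}
    (hinj : Set.InjOn h (range p : Finset ℕ)) (hcl : ∀ k < p, (el (h k)).1 = e) :
    Realizes ω el Set.univ ((range p).image h) (∑ k ∈ range p, ω (k * e) * (el (h k)).2) := by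
  have hgen : ∀ n ≤ p, ∃ l : List ι, l.Nodup ∧ l.toFinset = (range n).image h ∧
      seqClass el l = n * e ∧ seqValue ω el l = ∑ k ∈ range n, ω (k * e) * (el (h k)).2 ∧
      ∀ k ≤ n, ∃ l', l' <:+ l ∧ seqClass el l' = k * e := by
    intro n
    induction n with
    | zero =>
      intro _
      refine ⟨[], by simp, by simp, by simp, by simp, fun k hk => ⟨[], List.suffix_rfl, ?_⟩⟩
      rw [Nat.le_zero.1 hk]; simp
    | succ n ih =>
      intro hn
      obtain ⟨l, h1, h2, h3, h4, h5⟩ := ih (by omega)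
      have hcls : seqClass el (h n :: l) = (n + 1 : ℕ) * e := by
        rw [seqClass_cons, h3, hcl n (by omega)]; push_cast; ring
      refine ⟨h n :: l, ?_, ?_, hcls, ?_, ?_⟩
      · rw [List.nodup_cons]
        refine ⟨fun hmem => ?_, h1⟩
        rw [← List.mem_toFinset, h2] at hmem
        obtain ⟨k, hk, hkn⟩ := Finset.mem_image.1 hmem
        have hk' := mem_range.1 hk
        have := hinj (by simp; omega) (by simp; omega) hkn
        omega
      · rw [List.toFinset_cons, h2, range_add_one, image_insert]
      · rw [seqValue_cons, h3, h4, sum_range_succ, add_comm]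
      · intro k hk
        rcases Nat.le_succ_iff.1 hk with hk | rfl
        · obtain ⟨l', hl', hk'⟩ := h5 k hk
          exact ⟨l', hl'.trans (List.suffix_cons _ _), hk'⟩
        · exact ⟨_, List.suffix_rfl, hcls⟩
  obtain ⟨l, h1, h2, h3, h4, h5⟩ := hgen p le_rfl
  -- The final segment of length k has class ke, and e is invertible modulo p. So class j is
  -- attained at k = j e⁻¹.
  refine ⟨l, h1, h2, by rw [h3]; simp, h4, fun j _ => ?_⟩
  obtain ⟨l', hl', hj⟩ := h5 (j * e⁻¹).val (ZMod.val_lt _).le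
  refine ⟨l', hl', ?_⟩
  rw [hj, ZMod.natCast_zmod_val, inv_mul_cancel_right₀ he]

lemma sum_range_weight {e : ZMod p} (he : e ≠ 0) : ∑ k ∈ range p, ω (k * e) = 0 := by
  rw [← hω.sum_eq_zero]
  refine sum_bij (fun k _ => (k : ZMod p) * e) (fun _ _ => mem_univ _) ?_ ?_ (fun _ _ => rfl)
  · intro a ha b hb hab
    have h1 := mul_right_cancel₀ he hab
    have h2 := (ZMod.natCast_eq_natCast_iff' _ _ _).1 h1
    rwa [Nat.mod_eq_of_lt (mem_range.1 ha), Nat.mod_eq_of_lt (mem_range.1 hb)] at h2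
  · intro j _
    refine ⟨(j * e⁻¹).val, mem_range.2 (ZMod.val_lt _), ?_⟩
    rw [ZMod.natCast_zmod_val, inv_mul_cancel_right₀ he]

omit hω in
lemma _root_.Finset.exists_enumeration {T : Finset ι} (hT : T.Nonempty) :
    ∃ h : ℕ → ι, Set.InjOn h (range #T : Finset ℕ) ∧ (range #T).image h = T := by
  obtain ⟨u, h1, h2, -⟩ := exists_monotone_enumeration T hT (fun _ => 0)
  have hinj : Set.InjOn u (range #T : Finset ℕ) := fun a ha b hb hab =>
    h2 a (mem_range.1 ha) b (mem_range.1 hb) hab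
  refine ⟨u, hinj, eq_of_subset_of_card_le ?_ ?_⟩
  · intro x hx
    obtain ⟨k, hk, rfl⟩ := Finset.mem_image.1 hx
    exact h1 k (mem_range.1 hk)
  · rw [card_image_of_injOn hinj, card_range]

lemma exists_realizes_univ {e : ZMod p} (he : e ≠ 0) {T : Finset ι} (hT : #T = p)
    (hcl : ∀ i ∈ T, (el i).1 = e) : ∃ g, Realizes ω el Set.univ T g := by
  obtain ⟨h, h1, h2⟩ := T.exists_enumeration (card_pos.1 (by rw [hT]; exact hp.out.pos))
  rw [hT] at h1 h2
  have := hω.realizes_of_class_eq (el := el) he h1 (fun k hk => hcl _ (by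
    rw [← h2]; exact mem_image_of_mem _ (mem_range.2 hk)))
  rw [h2] at this
  exact ⟨_, this⟩

/-- `p * n` equal terms. -/
lemma realizes_of_eq {x : ZMod p × ZMod m} (hx : x.1 ≠ 0) (n : ℕ) {T : Finset ι}
    (hT : #T = p * n) (hel : ∀ i ∈ T, el i = x) (hn : 1 ≤ n) : Realizes ω el Set.univ T 0 := by
  obtain ⟨k, rfl⟩ : ∃ k, n = k + 1 := ⟨n - 1, by omega⟩
  clear hn
  induction k generalizing T with
  | zero =>
    obtain ⟨h, h1, h2⟩ := T.exists_enumeration (card_pos.1 (by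
      rw [hT]; exact Nat.mul_pos hp.out.pos (by omega)))
    rw [zero_add, mul_one] at hT
    rw [hT] at h1 h2
    have hmem : ∀ k < p, h k ∈ T := fun k hk => by
      rw [← h2]; exact mem_image_of_mem _ (mem_range.2 hk)
    have := hω.realizes_of_class_eq (el := el) hx h1 (fun k hk => by rw [hel _ (hmem k hk)])
    -- The common value factors out of the sum of all weights, which is 0: the p-th power of an
    -- outer element is trivial.
    rw [h2, sum_congr rfl fun k hk => by rw [hel _ (hmem k (mem_range.1 hk))], ← sum_mul,
      hω.sum_range_weight hx, zero_mul] at this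
    exact this
  | succ k ih =>
    obtain ⟨T', hT', hT'c⟩ := exists_subset_card_eq (s := T) (n := p * (k + 1)) (by
      rw [hT]; exact Nat.mul_le_mul_left _ (by omega))
    have h1 := ih (fun i hi => hel i (hT' hi)) hT'c
    obtain ⟨h, h2, h3⟩ := (T \ T').exists_enumeration (card_pos.1 (by
      rw [card_sdiff_of_subset hT', hT, hT'c, ← Nat.mul_sub]
      exact Nat.mul_pos hp.out.pos (by omega)))
    have hc : #(T \ T') = p := by
      rw [card_sdiff_of_subset hT', hT, hT'c, ← Nat.mul_sub]
      simp
    rw [hc] at h2 h3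
    have hmem : ∀ k < p, h k ∈ T := fun k hk => by
      apply sdiff_subset (s := T) (t := T')
      rw [← h3]; exact mem_image_of_mem _ (mem_range.2 hk)
    have := hω.realizes_of_class_eq (el := el) hx h2 (fun k hk => by rw [hel _ (hmem k hk)])
    rw [h3, sum_congr rfl fun k hk => by rw [hel _ (hmem k (mem_range.1 hk))], ← sum_mul,
      hω.sum_range_weight hx, zero_mul] at this
    have h4 := hω.realizes_union h1 this disjoint_sdiff
    rwa [union_sdiff_of_subset hT', add_zero] at h4

end IsWeight

/-- No subfamily of length `n` has product one. -/
def ProductOneFree (ω : ZMod p → ZMod m) (el : ι → ZMod p × ZMod m) (F : Finset ι) (n : ℕ) : Prop :=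
  ∀ T ⊆ F, #T = n → ¬ Realizes ω el ∅ T 0

end Realization

/-! ### Free families containing p terms of one nonzero class. -/

section Blocks

variable {p m : ℕ} [hp : Fact p.Prime] [NeZero m] {ω : ZMod p → ZMod m} {ι : Type*} [DecidableEq ι]
  {el : ι → ZMod p × ZMod m}

namespace IsWeight

variable (hω : IsWeight ω)
include hω

lemma not_realizes {F : Finset ι} {n : ℕ} (hfree : ProductOneFree ω el F n) {P : Set (ZMod p)}
    {T : Finset ι} (hT : T ⊆ F) (hTc : #T = n) : ¬ Realizes ω el P T 0 := fun h =>
  hfree T hT hTc (h.mono (Set.empty_subset _))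

/-- Blocks of length `p` in a product-one free family. -/
lemma not_hasWeightedZero_blocks {F : Finset ι} (hfree : ProductOneFree ω el F (m * p)) {κ : Type*}
    [DecidableEq κ] {I : Finset κ} {B : κ → Finset ι} {c : κ → ZMod m} {U : Finset ι} {g : ZMod m}
    (hU : U ⊆ F) (hUc : #U = p) (hUr : Realizes ω el Set.univ U g)
    (hB : ∀ k ∈ I, B k ⊆ F ∧ #(B k) = p ∧ Realizes ω el ∅ (B k) (c k))
    (hd : (I : Set κ).PairwiseDisjoint B) (hUB : ∀ k ∈ I, Disjoint U (B k)) :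
    ¬ HasWeightedZero ω I c g ∧ ¬ HasPlainZero I c := by
  have hcard : ∀ J ⊆ I, #(J.biUnion B) = p * #J := by
    intro J hJ
    rw [card_biUnion (hd.subset (coe_subset.2 hJ)), sum_congr rfl fun k hk => (hB k (hJ hk)).2.1,
      sum_const, smul_eq_mul, mul_comm]
  have hsub : ∀ J ⊆ I, J.biUnion B ⊆ F := by
    intro J hJ
    rw [biUnion_subset]
    exact fun k hk => (hB k (hJ hk)).1
  constructor
  · rintro ⟨J, hJI, hJc, e, he⟩
    -- U has suffixes of every class, so each block can be inserted with any prescribed weight. The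
    -- total length is p + p(m - 1) = mp.
    have h1 := hω.realizes_biUnion hUr J B c e (fun k hk => (hB k (hJI hk)).2.2)
      (fun k hk => hUB k (hJI hk)) (hd.subset (coe_subset.2 hJI)) (fun _ _ => Or.inr trivial)
    rw [he] at h1
    refine hω.not_realizes hfree (union_subset hU (hsub J hJI)) ?_ h1
    rw [card_union_of_disjoint, hUc, hcard J hJI, ← hJc]
    · ring
    · rw [disjoint_biUnion_right]
      exact fun k hk => hUB k (hJI hk)
  · rintro ⟨J, hJI, hJc, hs⟩
    have h1 := hω.realizes_biUnion realizes_empty J B c (fun _ => 0)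
      (fun k hk => (hB k (hJI hk)).2.2) (fun k hk => disjoint_empty_left _)
      (hd.subset (coe_subset.2 hJI)) (fun _ _ => Or.inl rfl)
    simp only [hω.map_zero, one_mul, hs, add_zero, empty_union] at h1
    refine hω.not_realizes hfree (hsub J hJI) ?_ h1
    rw [hcard J hJI, hJc, mul_comm]

/-- The exceptional case of `weighted_zero_sum` needs exactly m + β - 2 blocks, so one block more
always produces a product-one subfamily. -/
lemma not_le_card_blocks {β : ℕ} (hm : m = 1 + p * β) (hβ : 1 ≤ β) {F : Finset ι}
    (hfree : ProductOneFree ω el F (m * p)) {κ : Type*} [DecidableEq κ] {I : Finset κ}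
    {B : κ → Finset ι} {c : κ → ZMod m} {U : Finset ι} {g : ZMod m}
    (hU : U ⊆ F) (hUc : #U = p) (hUr : Realizes ω el Set.univ U g)
    (hB : ∀ k ∈ I, B k ⊆ F ∧ #(B k) = p ∧ Realizes ω el ∅ (B k) (c k))
    (hd : (I : Set κ).PairwiseDisjoint B) (hUB : ∀ k ∈ I, Disjoint U (B k)) :
    ¬ m + β ≤ #I + 1 := by
  intro hI
  obtain ⟨h1, h2⟩ := hω.not_hasWeightedZero_blocks hfree hU hUc hUr hB hd hUB
  rcases hω.weighted_zero_sum hm hβ c g (by omega : m + β ≤ #I + 2) with h | h | h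
  · exact h1 h
  · exact h2 h
  · omega

/-- Few inner terms lie in a subgroup. -/
lemma card_inner_subgroup {F : Finset ι} (hfree : ProductOneFree ω el F (m * p))
    (K : AddSubgroup (ZMod m)) {s : Finset ι} (hs : s ⊆ F) (hs0 : ∀ i ∈ s, (el i).1 = 0)
    (hsK : ∀ i ∈ s, (el i).2 ∈ K) : ¬ m * p + Nat.card K ≤ #s + 1 := by
  intro hc
  obtain ⟨T, hT, hTc, hT0⟩ := ZMod.exists_sum_eq_zero_of_mem_subgroup K (fun i => (el i).2) (m * p)
    (by
      have := K.card_addSubgroup_dvd_card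
      rw [Nat.card_zmod] at this
      exact this.mul_right _) s hsK hc
  have h1 := hω.realizes_inner (el := el) realizes_empty T (fun _ => 0) (fun i hi => hs0 i (hT hi))
    (disjoint_empty_left _) (fun _ _ => Or.inl rfl)
  simp only [hω.map_zero, one_mul, hT0, add_zero, empty_union] at h1
  exact hω.not_realizes hfree (hT.trans hs) hTc h1

/-- A block of `p` terms of the same nonzero class together with `m * p + m - p - 2` inner terms. -/
theorem inner_eq_zero_of_block {β : ℕ} (hm : m = 1 + p * β) (hβ : 1 ≤ β) {F : Finset ι}
    (hfree : ProductOneFree ω el F (m * p)) {U : Finset ι} {g : ZMod m}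
    (hU : U ⊆ F) (hUc : #U = p) (hUr : Realizes ω el Set.univ U g) {N : Finset ι} (hN : N ⊆ F)
    (hUN : Disjoint U N) (hN0 : ∀ i ∈ N, (el i).1 = 0) (hNc : #N + p + 2 = m * p + m) :
    g ≠ 0 ∧ β = 1 ∧ ∀ i ∈ N, (el i).2 = 0 := by
  have hp2 := hp.out.two_le
  set c : ι → ZMod m := fun i => (el i).2 with hc
  set F₀ := {i ∈ N | c i ≠ 0} with hF₀
  have hF₀N : F₀ ⊆ N := filter_subset _ _
  obtain ⟨m', rfl⟩ : ∃ m', m = m' + 1 := ⟨m - 1, by have := NeZero.pos m; omega⟩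
  have hexp : (m' + 1) * p = m' * p + p := by ring
  have hm'p : m' * 2 ≤ m' * p := Nat.mul_le_mul_left _ hp2
  have hpβ : 2 * 1 ≤ p * β := Nat.mul_le_mul hp2 hβ
  have hdirect : ∀ J ⊆ N, #J = m' * p → ∀ e : ι → ZMod p,
      g + ∑ i ∈ J, ω (e i) * c i ≠ 0 := by
    intro J hJ hJc e he
    have h1 := hω.realizes_inner hUr J e (fun i hi => hN0 i (hJ hi)) (hUN.mono_right hJ)
      (fun _ _ => Or.inr trivial)
    rw [he] at h1
    refine hω.not_realizes hfree (union_subset hU (hJ.trans hN)) ?_ h1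
    rw [card_union_of_disjoint (hUN.mono_right hJ), hUc, hJc]
    omega
  have hsub : ∀ K : AddSubgroup (ZMod (m' + 1)), K ≠ ⊥ → K ≠ ⊤ → ∀ B : Finset ι,
      (∀ i ∈ F₀, c i ∉ K → i ∈ B) → ¬ Nat.card K * (#B + 2) ≤ m' + 1 := by
    intro K hK0 hK1 B hB hKB
    refine hω.card_inner_subgroup hfree K (s := N \ B) (sdiff_subset.trans hN)
      (fun i hi => hN0 i (mem_sdiff.1 hi).1) (fun i hi => ?_) ?_
    · by_contra h
      rw [mem_sdiff] at hi
      exact hi.2 (hB i (mem_filter.2 ⟨hi.1, fun h0 => h (by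
        have : (el i).2 = 0 := h0
        rw [this]; exact K.zero_mem)⟩) h)
    · obtain ⟨a, b, ha, hab, -, ha1, hb1⟩ := hω.card_arith (K := K) hm
      have h1 := ha1 hK0
      have h2 := hb1 hK1
      rw [ha] at hKB ⊢
      have h3 : #B + 2 ≤ 1 + p * b :=
        Nat.le_of_mul_le_mul_left (hKB.trans hab.le) (by omega)
      have h4 := le_card_sdiff B N
      have h5 : p ≤ p * a * (p * b) := by
        calc p = p * 1 * (1 * 1) := by ring
          _ ≤ p * a * (p * b) := by gcongr; omega
      have h6 : (1 + p * a) * (1 + p * b) = 1 + p * a + p * b + p * a * (p * b) := by ring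
      omega
  obtain ⟨Λ, -, hΛF, hΛc, hΛ⟩ := exists_sum_eq_or_subgroup (⊤ : AddSubgroup (ZMod (m' + 1)))
    (fun i => weightOrbit ω (c i)) c F₀ ∅ (empty_subset _)
    (fun i _ x _ => mem_ofSubgroup.2 (AddSubgroup.mem_top _))
    (fun i _ => ⟨c i, hω.self_mem_weightOrbit _⟩)
    (fun i _ K h => hω.mem_of_weightOrbit_sub_mem h)
  rcases hΛ with hΛ | ⟨K, hK1, B, hB, hKc⟩
  · exfalso
    rw [hΛ, card_ofSubgroup, AddSubgroup.card_top, Nat.card_zmod, sum_empty, card_zero,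
      card_empty] at hΛc
    have hΛN := hΛF.trans hF₀N
    obtain ⟨E, hE, hEc⟩ := exists_subset_card_eq (s := N \ Λ) (n := m' * p - #Λ) (by
      rw [card_sdiff_of_subset hΛN]; omega)
    have ht : -(g + ∑ i ∈ E, ω 0 * c i) ∈ ∑ i ∈ Λ, weightOrbit ω (c i) := by
      rw [hΛ, mem_ofSubgroup]; trivial
    obtain ⟨e, he⟩ := exists_of_mem_sum_weightOrbit ht
    have hd : Disjoint Λ E := disjoint_sdiff.mono_right hE
    obtain ⟨e', he'⟩ := sum_weights_union (ω := ω) hd c e (fun _ => 0)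
    refine hdirect (Λ ∪ E) (union_subset hΛN (hE.trans sdiff_subset)) ?_ e' ?_
    · rw [card_union_of_disjoint hd, hEc]; omega
    · rw [he', ← he]; ring
  -- For trivial K, fewer than mp inner terms vanish, so at least p(β - 1) are nonzero. As -g is not
  -- reached by hulls, at most β - 1 are nonzero. Hence β = 1 and all inner values vanish.
  · by_cases hK0 : K = ⊥
    · subst hK0
      rw [AddSubgroup.card_bot, one_mul, AddSubgroup.card_top, Nat.card_zmod] at hKc
      have hν : #F₀ ≤ #B := card_le_card fun i hi => hB i hi (by simpa using (mem_filter.1 hi).2)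
      have hZc : #(N \ F₀) + #F₀ = #N := card_sdiff_add_card_eq_card hF₀N
      have hZ0 : ∀ i ∈ N \ F₀, c i = 0 := by
        intro i hi
        rw [mem_sdiff] at hi
        by_contra h
        exact hi.2 (mem_filter.2 ⟨hi.1, h⟩)
      have h1 := hω.card_inner_subgroup hfree ⊥ (sdiff_subset.trans hN)
        (fun i hi => hN0 i (mem_sdiff.1 hi).1) (fun i hi => by
          rw [AddSubgroup.mem_bot]; exact hZ0 i hi)
      rw [AddSubgroup.card_bot] at h1
      have hpad : ∀ J ⊆ F₀, ∀ e : ι → ZMod p, g + ∑ i ∈ J, ω (e i) * c i ≠ 0 := by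
        intro J hJ e he
        have hJc := card_le_card hJ
        obtain ⟨Z, hZ, hZc'⟩ := exists_subset_card_eq (s := N \ F₀) (n := m' * p - #J) (by omega)
        have hd : Disjoint J Z := (disjoint_sdiff.mono_left hJ).mono_right hZ
        refine hdirect (J ∪ Z) (union_subset (hJ.trans hF₀N) (hZ.trans sdiff_subset)) ?_ e ?_
        · rw [card_union_of_disjoint hd, hZc']; omega
        · rw [sum_union hd, Finset.sum_eq_zero (s := Z)
            (fun i hi => by rw [hZ0 i (hZ hi), mul_zero]), add_zero, he]
      have hg : g ≠ 0 := by
        have := hpad ∅ (empty_subset _) (fun _ => 0)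
        simpa using this
      refine ⟨hg, ?_⟩
      rcases hω.hull_dichotomy c F₀ with h2 | ⟨K', hK1', B', hB', -, -, hKc'⟩
      · exfalso
        have h3 : -g ∈ ∑ i ∈ F₀, weightHull ω (c i) := by rw [h2]; exact mem_univ _
        obtain ⟨J, hJ, e, he⟩ := exists_of_mem_sum_weightHull h3
        exact hpad J hJ e (by rw [← he]; ring)
      · by_cases hK0' : K' = ⊥
        · subst hK0'
          rw [AddSubgroup.card_bot, one_mul] at hKc'
          have hν' : #F₀ ≤ #B' :=
            card_le_card fun i hi => hB' i hi (by simpa using (mem_filter.1 hi).2)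
          have h3 : p * (#B' + 1) ≤ p * β := by rw [mul_add]; omega
          have h4 := Nat.le_of_mul_le_mul_left h3 hp.out.pos
          obtain ⟨b, rfl⟩ : ∃ b, β = b + 1 := ⟨β - 1, by omega⟩
          rw [mul_add, mul_one] at hm
          have h5 : 2 * b ≤ p * b := Nat.mul_le_mul_right _ hp2
          have hb : b = 0 := by omega
          have hF0 : F₀ = ∅ := by rw [← card_eq_zero]; omega
          refine ⟨by omega, fun i hi => ?_⟩
          by_contra h
          have : i ∈ F₀ := mem_filter.2 ⟨hi, h⟩
          rw [hF0] at this
          exact notMem_empty _ this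
        · exfalso
          refine hsub K' hK0' hK1' B' hB' (le_trans (Nat.mul_le_mul_left _ ?_) hKc')
          have : 1 * #B' ≤ p * #B' := Nat.mul_le_mul_right _ (by omega)
          omega
    · exfalso
      rw [AddSubgroup.card_top, Nat.card_zmod] at hKc
      exact hsub K hK0 hK1.ne B hB hKc

/-- The classes of the terms outside a block of equal class take just two values. -/
theorem isTwoValued_class {β : ℕ} (hm : m = 1 + p * β) (hβ : 1 ≤ β) {F : Finset ι}
    (hF : #F + 3 = m * p + m + p) (hfree : ProductOneFree ω el F (m * p)) {U : Finset ι}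
    (hU : U ⊆ F) (hUc : #U = p) {e : ZMod p} (he : e ≠ 0) (hUe : ∀ i ∈ U, (el i).1 = e) :
    IsTwoValued (m + β - 1) (F \ U) (fun i => (el i).1) := by
  have hp2 := hp.out.two_le
  obtain ⟨g, hg⟩ := hω.exists_realizes_univ he hUc hUe
  -- Outside U there remain p(m + β - 1) + p - 2 terms, the extremal length for EGZ modulo p with P
  -- = m + β - 1.
  have h1 : p * (m + β - 1) + p = m * p + p * β := by
    obtain ⟨b, rfl⟩ : ∃ b, β = b + 1 := ⟨β - 1, by omega⟩
    rw [show m + (b + 1) - 1 = m + b by omega]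
    ring
  refine ZMod.isTwoValued_of_prime (by omega) ?_ ?_
  · rw [card_sdiff_of_subset hU, hUc]
    omega
  · intro T hT hTc hTs
    obtain ⟨B, hB, hd⟩ := ZMod.exists_blocks_of_sum_eq_zero hp.out.pos _ _ T hTc hTs
    choose! c hc using fun k (hk : k < m + β - 1) => exists_realizes' (ω := ω) (hB k hk).2.2
    refine hω.not_le_card_blocks hm hβ hfree (I := range (m + β - 1)) (B := B) (c := c) hU hUc hg
      (fun k hk => ?_) (pairwiseDisjoint_of_lt hd subset_rfl) (fun k hk => ?_) ?_
    · rw [mem_range] at hk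
      exact ⟨(hB k hk).1.trans (hT.trans sdiff_subset), (hB k hk).2.1, hc k hk⟩
    · rw [mem_range] at hk
      exact disjoint_sdiff.mono_right ((hB k hk).1.trans hT)
    · rw [card_range]; omega

end IsWeight

end Blocks

/-! ### Only two classes occur. -/

lemma ZMod.eq_of_ne_zero_of_ne_zero : ∀ a b : ZMod 2, a ≠ 0 → b ≠ 0 → a = b := by decide

section TwoClasses

variable {p m : ℕ} [hp : Fact p.Prime] [NeZero m] {ω : ZMod p → ZMod m} {ι : Type*} [DecidableEq ι]
  {el : ι → ZMod p × ZMod m}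

namespace IsWeight

variable (hω : IsWeight ω)
include hω

/-- If some nonzero class contains `p` terms, then that class and one other contain all terms. -/
theorem exists_two_classes {β : ℕ} (hm : m = 1 + p * β) (hβ : 1 ≤ β) {F : Finset ι}
    (hF : #F + 3 = m * p + m + p) (hfree : ProductOneFree ω el F (m * p)) {d : ZMod p} (hd0 : d ≠ 0)
    (hd : p ≤ #{i ∈ F | (el i).1 = d}) :
    ∃ b k₁ k₂, b ≠ d ∧ 2 ≤ k₁ ∧ 1 ≤ k₂ ∧ k₁ + k₂ = m + β + 1 ∧
      #{i ∈ F | (el i).1 = d} + 1 = k₁ * p ∧ #{i ∈ F | (el i).1 = b} + 1 = k₂ * p ∧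
      ∀ i ∈ F, (el i).1 = d ∨ (el i).1 = b := by
  have hp2 := hp.out.two_le
  have hpβ : 2 * 1 ≤ p * β := Nat.mul_le_mul hp2 hβ
  obtain ⟨U, hU, hUc⟩ := exists_subset_card_eq hd
  have hUF : U ⊆ F := hU.trans (filter_subset _ _)
  have hUd : ∀ i ∈ U, (el i).1 = d := fun i hi => (mem_filter.1 (hU hi)).2
  have hUne : U.Nonempty := card_pos.1 (by omega)
  have hcount : ∀ x ≠ d, #{i ∈ F | (el i).1 = x} = #{i ∈ F \ U | (el i).1 = x} := by
    intro x hx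
    congr 1
    ext i
    simp only [mem_filter, mem_sdiff]
    constructor
    · rintro ⟨h1, h2⟩
      exact ⟨⟨h1, fun h => hx (h2.symm.trans (hUd i h))⟩, h2⟩
    · rintro ⟨⟨h1, -⟩, h2⟩
      exact ⟨h1, h2⟩
  have hcountd : #{i ∈ F | (el i).1 = d} = #{i ∈ F \ U | (el i).1 = d} + p := by
    have hU' : #{i ∈ F | (el i).1 = d} = #{i ∈ F \ U | (el i).1 = d} + #U := by
     rw [← card_union_of_disjoint]
     · congr 1
       ext i
       simp only [mem_filter, mem_union, mem_sdiff]
       constructor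
       · rintro ⟨h1, h2⟩
         by_cases h : i ∈ U
         · exact Or.inr h
         · exact Or.inl ⟨⟨h1, h⟩, h2⟩
       · rintro (⟨⟨h1, -⟩, h2⟩ | h)
         · exact ⟨h1, h2⟩
         · exact ⟨hUF h, hUd i h⟩
     · rw [disjoint_left]
       intro i hi
       rw [mem_filter, mem_sdiff] at hi
       exact hi.1.2
    rw [hU', hUc]
  have hfin : ∀ b k₁ k₂, b ≠ d → 1 ≤ k₁ → 1 ≤ k₂ → k₁ + k₂ = m + β - 1 + 1 →
      #{i ∈ F \ U | (el i).1 = d} + 1 = k₁ * p → #{i ∈ F \ U | (el i).1 = b} + 1 = k₂ * p →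
      (∀ i ∈ F \ U, (el i).1 = d ∨ (el i).1 = b) →
      ∃ b k₁ k₂, b ≠ d ∧ 2 ≤ k₁ ∧ 1 ≤ k₂ ∧ k₁ + k₂ = m + β + 1 ∧
      #{i ∈ F | (el i).1 = d} + 1 = k₁ * p ∧ #{i ∈ F | (el i).1 = b} + 1 = k₂ * p ∧
      ∀ i ∈ F, (el i).1 = d ∨ (el i).1 = b := by
    intro b k₁ k₂ hbd hk₁ hk₂ hk h1 h2 h3
    refine ⟨b, k₁ + 1, k₂, hbd, by omega, hk₂, by omega, ?_, ?_, fun i hi => ?_⟩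
    · rw [hcountd, add_mul]; omega
    · rw [hcount b hbd, h2]
    · by_cases h : i ∈ U
      · exact Or.inl (hUd i h)
      · exact h3 i (mem_sdiff.2 ⟨hi, h⟩)
  obtain ⟨a, b, k₁, k₂, hab, hk₁, hk₂, hk, ha, hb, hall⟩ :=
    hω.isTwoValued_class hm hβ hF hfree hUF hUc hd0 hUd
  have hne : a ≠ b := by
    rintro rfl
    rw [sub_self] at hab
    exact not_isUnit_zero hab
  by_cases hda : d = a
  · subst hda
    exact hfin b k₁ k₂ hne.symm hk₁ hk₂ hk ha hb hall
  by_cases hdb : d = b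
  · subst hdb
    exact hfin a k₂ k₁ hne hk₂ hk₁ (by omega) hb ha fun i hi => (hall i hi).symm
  exfalso
  -- If x had 2p - 1 terms outside U, a block taken from x could replace U, and three classes d, x,
  -- y would remain outside it, against `isTwoValued_class`.
  have hone : ∀ x y k l, x ≠ y → d ≠ x → d ≠ y → x ≠ 0 → 1 ≤ l →
      #{i ∈ F \ U | (el i).1 = x} + 1 = k * p → #{i ∈ F \ U | (el i).1 = y} + 1 = l * p →
      ¬ 2 ≤ k := by
    intro x y k l hxy hdx hdy hx0 hl hx hy hk
    have h1 : 2 * p ≤ k * p := Nat.mul_le_mul_right _ hk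
    have h2 : 1 * p ≤ l * p := Nat.mul_le_mul_right _ hl
    obtain ⟨U', hU', hU'c⟩ := exists_subset_card_eq (s := {i ∈ F \ U | (el i).1 = x}) (n := p)
      (by omega)
    have hU'x : ∀ i ∈ U', (el i).1 = x := fun i hi => (mem_filter.1 (hU' hi)).2
    obtain ⟨a', b', -, -, -, -, -, -, -, -, hall'⟩ := hω.isTwoValued_class hm hβ hF hfree
      (hU'.trans ((filter_subset _ _).trans sdiff_subset)) hU'c hx0 hU'x
    obtain ⟨i, hi⟩ := hUne
    have hi' := hall' i (mem_sdiff.2 ⟨hUF hi, fun h => hdx ((hUd i hi).symm.trans (hU'x i h))⟩)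
    obtain ⟨j, hj⟩ : ({i ∈ F \ U | (el i).1 = x} \ U').Nonempty := by
      rw [← card_pos, card_sdiff_of_subset hU', hU'c]; omega
    rw [mem_sdiff, mem_filter, mem_sdiff] at hj
    have hj' := hall' j (mem_sdiff.2 ⟨hj.1.1.1, hj.2⟩)
    obtain ⟨l, hl⟩ : ({i ∈ F \ U | (el i).1 = y}).Nonempty := by
      rw [← card_pos]; omega
    rw [mem_filter, mem_sdiff] at hl
    have hl' := hall' l (mem_sdiff.2 ⟨hl.1.1, fun h => hxy ((hU'x l h).symm.trans hl.2)⟩)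
    simp only [hUd i hi] at hi'
    simp only [hj.1.2] at hj'
    simp only [hl.2] at hl'
    rcases hi' with rfl | rfl <;> rcases hj' with rfl | rfl <;> rcases hl' with rfl | rfl <;>
      contradiction
  -- The inner terms then have the number required by `inner_eq_zero_of_block`, so β = 1 and m = p +
  -- 1. As m is odd, p = 2, where d and b cannot be distinct nonzero classes.
  have hspecial : ∀ b k₁, b ≠ 0 → d ≠ b → k₁ = m + β - 1 →
      #{i ∈ F \ U | (el i).1 = 0} + 1 ≠ k₁ * p := by
    intro b k₁ hb0 hdb hk₁ hz
    obtain ⟨g, hg⟩ := hω.exists_realizes_univ hd0 hUc hUd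
    obtain ⟨-, hβ1, -⟩ := hω.inner_eq_zero_of_block hm hβ hfree hUF hUc hg
      (N := {i ∈ F | (el i).1 = 0}) (filter_subset _ _) (by
        rw [disjoint_left]
        intro i hi hi'
        exact hd0 ((hUd i hi).symm.trans (mem_filter.1 hi').2)) (fun i hi => (mem_filter.1 hi).2) (by
        rw [hcount 0 hd0.symm]
        obtain ⟨c, rfl⟩ : ∃ c, β = c + 1 := ⟨β - 1, by omega⟩
        have h1 : k₁ * p = m * p + c * p := by
          rw [hk₁, show m + (c + 1) - 1 = m + c by omega, add_mul]
        have h2 : p * (c + 1) = c * p + p := by ring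
        omega)
    rw [hβ1, mul_one] at hm
    have hodd := hω.odd_modulus
    rw [hm, Nat.odd_add] at hodd
    have hpe : Even p := hodd.1 odd_one
    have hp2' : p = 2 := (Nat.Prime.even_iff hp.out).1 hpe
    subst hp2'
    exact hdb (ZMod.eq_of_ne_zero_of_ne_zero d b hd0 hb0)
  by_cases ha0 : a = 0
  · have hb0 : b ≠ 0 := fun h => hne (ha0.trans h.symm)
    have h1 := hone b a k₂ k₁ hne.symm hdb hda hb0 hk₁ hb ha
    subst ha0
    exact hspecial b k₁ hb0 hdb (by omega) ha
  · have h1 := hone a b k₁ k₂ hne hda hdb ha0 hk₂ ha hb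
    by_cases hb0 : b = 0
    · subst hb0
      exact hspecial a k₂ ha0 hda (by omega) hb
    · have h2 := hone b a k₂ k₁ hne.symm hdb hda hb0 hk₁ hb ha
      omega

/-- The products of `p` terms from a small subset of a class are all zero or all nonzero; in the
latter case there are few of them. -/
theorem products_dichotomy {β : ℕ} (hm : m = 1 + p * β) (hβ : 1 ≤ β) {F : Finset ι}
    (hfree : ProductOneFree ω el F (m * p)) {e f : ZMod p} (he : e ≠ 0) (hfe : f ≠ e) {k₁ k₂ : ℕ}
    (hk₁ : 2 ≤ k₁) (hk₂ : 1 ≤ k₂) (hk : k₁ + k₂ = m + β + 1)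
    (h₁ : #{i ∈ F | (el i).1 = e} + 1 = k₁ * p) (h₂ : #{i ∈ F | (el i).1 = f} + 1 = k₂ * p)
    {X : Finset ι} (hX : X ⊆ {i ∈ F | (el i).1 = e}) (hXc : #X + 1 ≤ 2 * p) :
    (∀ h : ℕ → ι, Set.InjOn h (range p : Finset ℕ) → (∀ k < p, h k ∈ X) →
      ∑ k ∈ range p, ω (k * e) * (el (h k)).2 = 0) ∨
    ∃ O : Finset (ZMod m), #O ≤ p ∧
      ∀ h : ℕ → ι, Set.InjOn h (range p : Finset ℕ) → (∀ k < p, h k ∈ X) →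
      ∑ k ∈ range p, ω (k * e) * (el (h k)).2 ≠ 0 ∧
      ∑ k ∈ range p, ω (k * e) * (el (h k)).2 ∈ O := by
  set E := {i ∈ F | (el i).1 = e} with hE
  set E' := {i ∈ F | (el i).1 = f} with hE'
  have hEE' : Disjoint E E' := by
    rw [disjoint_left]
    intro i hi hi'
    exact hfe ((mem_filter.1 hi').2.symm.trans (mem_filter.1 hi).2)
  obtain ⟨l₁, rfl⟩ : ∃ l, k₁ = l + 2 := ⟨k₁ - 2, by omega⟩
  obtain ⟨l₂, rfl⟩ : ∃ l, k₂ = l + 1 := ⟨k₂ - 1, by omega⟩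
  have hmul₁ : (l₁ + 2) * p = p * l₁ + 2 * p := by ring
  have hmul₂ : (l₂ + 1) * p = p * l₂ + p := by ring
  have hp2 := hp.out.two_le
  -- Outside X the two classes supply (k₁ - 2) + (k₂ - 1) = m + β - 2 class-zero blocks, the same
  -- for every choice of p terms in X. So the number of nonzero block values decides the alternative
  -- once and for all.
  obtain ⟨Y₁, hY₁, hY₁c⟩ := exists_subset_card_eq (s := E \ X) (n := p * l₁) (by
    rw [card_sdiff_of_subset hX]; omega)
  obtain ⟨Y₂, hY₂, hY₂c⟩ := exists_subset_card_eq (s := E') (n := p * l₂) (by omega)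
  have hY₁E : Y₁ ⊆ E := hY₁.trans sdiff_subset
  have hYd : Disjoint Y₁ Y₂ := (hEE'.mono_left hY₁E).mono_right hY₂
  have hYF : Y₁ ∪ Y₂ ⊆ F :=
    union_subset (hY₁E.trans (filter_subset _ _)) (hY₂.trans (filter_subset _ _))
  have hXY : Disjoint X (Y₁ ∪ Y₂) := by
    rw [disjoint_union_right]
    exact ⟨disjoint_sdiff.mono_right hY₁, (hEE'.mono_left hX).mono_right hY₂⟩
  obtain ⟨B, hB, hd⟩ := ZMod.exists_blocks_of_sum_eq_zero hp.out.pos (fun i => (el i).1)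
    (l₁ + l₂) (Y₁ ∪ Y₂) (by rw [card_union_of_disjoint hYd, hY₁c, hY₂c, mul_add]) (by
      rw [sum_union hYd, sum_congr rfl fun i hi => (mem_filter.1 (hY₁E hi)).2,
        sum_congr (s₁ := Y₂) rfl fun i hi => (mem_filter.1 (hY₂ hi)).2, sum_const, sum_const, hY₁c,
        hY₂c]
      simp)
  choose! c hc using fun k (hk : k < l₁ + l₂) => exists_realizes' (ω := ω) (hB k hk).2.2
  have hI : m + β = #(range (l₁ + l₂)) + 2 := by rw [card_range]; omega
  have hmain : ∀ h : ℕ → ι, Set.InjOn h (range p : Finset ℕ) → (∀ k < p, h k ∈ X) →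
      ¬ HasWeightedZero ω (range (l₁ + l₂)) c (∑ k ∈ range p, ω (k * e) * (el (h k)).2) ∧
      ¬ HasPlainZero (range (l₁ + l₂)) c := by
    intro h hinj hhX
    have himg : (range p).image h ⊆ X := by
      intro x hx
      obtain ⟨k, hk, rfl⟩ := Finset.mem_image.1 hx
      exact hhX k (mem_range.1 hk)
    refine hω.not_hasWeightedZero_blocks hfree (himg.trans (hX.trans (filter_subset _ _)))
      (by rw [card_image_of_injOn hinj, card_range]) (hω.realizes_of_class_eq he hinj
        (fun k hk => (mem_filter.1 (hX (hhX k hk))).2)) (B := B) (fun k hk => ?_)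
        (pairwiseDisjoint_of_lt hd subset_rfl) (fun k hk => ?_)
    · rw [mem_range] at hk
      exact ⟨(hB k hk).1.trans hYF, (hB k hk).2.1, hc k hk⟩
    · rw [mem_range] at hk
      exact (hXY.mono_left himg).mono_right (hB k hk).1
  by_cases hz : #{k ∈ range (l₁ + l₂) | c k ≠ 0} + 1 = β
  · right
    rcases hω.weighted_zero_sum_extremal hm c hI hz with h | ⟨O, hO, hOw⟩
    · exact ⟨∅, by simp, fun h' h1 h2 => absurd h (hmain h' h1 h2).2⟩
    · refine ⟨O, hO, fun h h1 h2 => ⟨fun h0 => ?_, ?_⟩⟩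
      · obtain ⟨h3, h4⟩ := hmain h h1 h2
        rcases hω.weighted_zero_sum hm hβ c _ hI.le with h5 | h5 | ⟨-, h5 | h5⟩
        · exact h3 h5
        · exact h4 h5
        · omega
        · exact h5.1 h0
      · by_contra hO'
        exact (hmain h h1 h2).1 (hOw _ hO')
  · left
    intro h h1 h2
    obtain ⟨h3, h4⟩ := hmain h h1 h2
    rcases hω.weighted_zero_sum hm hβ c _ hI.le with h5 | h5 | ⟨-, h5 | h5⟩
    · exact absurd h5 h3
    · exact absurd h5 h4
    · exact h5.1
    · omega

/-- If all products of `p` terms of a class vanish then the terms are equal. -/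
lemma eq_of_products_eq_zero {e : ZMod p} (he : e ≠ 0) {X : Finset ι} (hX : p ≤ #X)
    (h0 : ∀ h : ℕ → ι, Set.InjOn h (range p : Finset ℕ) → (∀ k < p, h k ∈ X) →
      ∑ k ∈ range p, ω (k * e) * (el (h k)).2 = 0) {i j : ι} (hi : i ∈ X) (hj : j ∈ X) :
    (el i).2 = (el j).2 := by
  by_cases hij : i = j
  · rw [hij]
  have hp2 := hp.out.two_le
  have hsub : {i, j} ⊆ X := by
    intro x hx
    rw [mem_insert, mem_singleton] at hx
    rcases hx with rfl | rfl <;> assumption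
  obtain ⟨Y, hijY, hYX, hYc⟩ := exists_subsuperset_card_eq hsub (n := p)
    (by rw [card_pair hij]; exact hp2) hX
  obtain ⟨h, h1, h2⟩ := Y.exists_enumeration (card_pos.1 (by omega))
  rw [hYc] at h1 h2
  have hsurj : ∀ x ∈ Y, ∃ k < p, h k = x := by
    intro x hx
    rw [← h2] at hx
    obtain ⟨k, hk, rfl⟩ := Finset.mem_image.1 hx
    exact ⟨k, mem_range.1 hk, rfl⟩
  obtain ⟨a, ha, rfl⟩ := hsurj i (hijY (by simp))
  obtain ⟨b, hb, rfl⟩ := hsurj j (hijY (by simp))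
  have hab : a ≠ b := fun h => hij (by rw [h])
  have hmem : ∀ k < p, h k ∈ X := fun k hk => hYX (by
    rw [← h2]; exact mem_image_of_mem _ (mem_range.2 hk))
  have e1 := h0 h h1 hmem
  have hswap : ∀ k < p, Equiv.swap a b k < p := by
    intro k hk
    rw [Equiv.swap_apply_def]
    split_ifs <;> assumption
  -- Exchanging the terms in positions a and b changes the product by (ω(ae) - ω(be)) times the
  -- difference of their values, and the first factor is a unit.
  have e2 := h0 (fun k => h (Equiv.swap a b k)) (fun x hx y hy hxy => by
      have := h1 (mem_coe.2 (mem_range.2 (hswap x (mem_range.1 hx))))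
        (mem_coe.2 (mem_range.2 (hswap y (mem_range.1 hy)))) hxy
      exact (Equiv.swap a b).injective this) (fun k hk => hmem _ (hswap k hk))
  have ha' : a ∈ range p := mem_range.2 ha
  have hb' : b ∈ (range p).erase a := mem_erase.2 ⟨hab.symm, mem_range.2 hb⟩
  rw [← add_sum_erase _ _ ha', ← add_sum_erase _ _ hb'] at e1 e2
  rw [Equiv.swap_apply_left, Equiv.swap_apply_right] at e2
  have e3 : ∑ k ∈ ((range p).erase a).erase b, ω (k * e) * (el (h (Equiv.swap a b k))).2 =
      ∑ k ∈ ((range p).erase a).erase b, ω (k * e) * (el (h k)).2 := by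
    apply sum_congr rfl
    intro k hk
    rw [mem_erase, mem_erase] at hk
    rw [Equiv.swap_apply_of_ne_of_ne hk.2.1 hk.1]
  rw [e3] at e2
  have e4 : (ω (a * e) - ω (b * e)) * ((el (h a)).2 - (el (h b)).2) = 0 := by
    linear_combination e1 - e2
  have hne : (a : ZMod p) * e ≠ b * e := by
    intro h
    have h1 := (ZMod.natCast_eq_natCast_iff' _ _ _).1 (mul_right_cancel₀ he h)
    rw [Nat.mod_eq_of_lt ha, Nat.mod_eq_of_lt hb] at h1
    exact hab h1
  exact sub_eq_zero.1 ((hω.isUnit_sub hne).mul_right_eq_zero.1 e4)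

end IsWeight

end TwoClasses

/-- The Cauchy–Davenport theorem for several summands in a finite group. -/
lemma Finset.min_le_card_sum {V κ : Type*} [AddCommGroup V] [DecidableEq V] [DecidableEq κ] {n : ℕ}
    (hn : ∀ K : AddSubgroup V, K ≠ ⊥ → n ≤ Nat.card K) (R : Finset κ) (A : κ → Finset V)
    (hA : ∀ j ∈ R, (A j).Nonempty) (hn0 : 1 ≤ n) :
    min n (1 + ∑ j ∈ R, (#(A j) - 1)) ≤ #(∑ j ∈ R, A j) := by
  induction R using Finset.induction_on with
  | empty => simp
  | insert i R hi ih =>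
    rw [sum_insert hi, sum_insert hi]
    have h1 := ih fun j hj => hA j (mem_insert_of_mem hj)
    have h2 := (hA i (mem_insert_self _ _))
    have h4 : (∑ j ∈ R, A j).Nonempty := by
      rw [← card_pos]
      omega
    have h3 := cauchy_davenport_minOrder_add h2 h4
    have h5 : ((n : ℕ) : ℕ∞) ≤ AddMonoid.minOrder V :=
      AddMonoid.le_minOrder_iff_forall_addSubgroup.2 fun K hK _ => by exact_mod_cast hn K hK
    have h6 := (min_le_min_right _ h5).trans h3
    have h7 : min n (#(A i) + #(∑ j ∈ R, A j) - 1) ≤ #(A i + ∑ j ∈ R, A j) := by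
      rcases min_le_iff.1 h6 with h | h
      · exact min_le_iff.2 (Or.inl (by exact_mod_cast h))
      · exact min_le_iff.2 (Or.inr (by exact_mod_cast h))
    have := h2.card_pos
    omega

/-! ### A large nonzero class is constant, or has three terms and p = 2. -/

section EqualClasses

variable {p m : ℕ} [hp : Fact p.Prime] [NeZero m] {ω : ZMod p → ZMod m} {ι : Type*} [DecidableEq ι]
  {el : ι → ZMod p × ZMod m}

namespace IsWeight

variable (hω : IsWeight ω)
include hω

lemma two_ne_zero_of_ne {c : ZMod m} (hc : c ≠ 0) : c + c ≠ 0 := by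
  intro h
  have h1 : (2 : ℕ).Coprime m := (Nat.coprime_two_left).2 hω.odd_modulus
  have h2 := (ZMod.isUnit_iff_coprime 2 m).2 h1
  apply hc
  apply h2.mul_right_eq_zero.1
  push_cast
  linear_combination h

/-- Two of three distinct values can be combined in at least three ways. -/
lemma exists_three_values (hp2 : p ≠ 2) {i j : ZMod p} (hij : i ≠ j) {x y z : ZMod m} (hxy : x ≠ y)
    (hxz : x ≠ z) (hyz : y ≠ z) : ∃ D : Finset (ZMod m), #D = 3 ∧ ∀ t ∈ D,
      ∃ a b, a ∈ ({x, y, z} : Finset (ZMod m)) ∧ b ∈ ({x, y, z} : Finset (ZMod m)) ∧ a ≠ b ∧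
        t = ω i * a + ω j * b := by
  have hcan : ∀ (k : ZMod p) (a b : ZMod m), a ≠ b → ω k * a ≠ ω k * b := fun k a b hab h =>
    hab ((hω.isUnit k).mul_left_cancel h)
  have h12 : ω i * x + ω j * y ≠ ω i * x + ω j * z := fun h =>
    hcan j y z hyz (add_left_cancel h)
  have hmem : ∀ t, (∃ a b, a ∈ ({x, y, z} : Finset (ZMod m)) ∧ b ∈ ({x, y, z} : Finset (ZMod m)) ∧
      a ≠ b ∧ t = ω i * a + ω j * b) → t ≠ ω i * x + ω j * y → t ≠ ω i * x + ω j * z →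
      ∃ D : Finset (ZMod m), #D = 3 ∧ ∀ t ∈ D,
      ∃ a b, a ∈ ({x, y, z} : Finset (ZMod m)) ∧ b ∈ ({x, y, z} : Finset (ZMod m)) ∧ a ≠ b ∧
        t = ω i * a + ω j * b := by
    intro t ht h1 h2
    refine ⟨{ω i * x + ω j * y, ω i * x + ω j * z, t},
      card_eq_three.2 ⟨_, _, _, h12, h1.symm, h2.symm, rfl⟩, fun s hs => ?_⟩
    rw [mem_insert, mem_insert, mem_singleton] at hs
    rcases hs with rfl | rfl | rfl
    · exact ⟨x, y, by simp, by simp, hxy, rfl⟩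
    · exact ⟨x, z, by simp, by simp, hxz, rfl⟩
    · exact ht
  -- The combinations (x, y) and (x, z) differ. If none of (z, y), (y, z), (y, x) gives a third
  -- value, the resulting equations force ω(2i) = ω(2j), which is impossible for odd p.
  by_cases c1 : ω i * z + ω j * y = ω i * x + ω j * z
  · by_cases c2 : ω i * y + ω j * z = ω i * x + ω j * y
    · by_cases c3 : ω i * y + ω j * x = ω i * x + ω j * z
      · exfalso
        have e1 : ω i * ((z - x) + (y - x)) = 0 := by linear_combination c1 + c2
        have e2 : (z - x) + (y - x) = 0 := (hω.isUnit i).mul_right_eq_zero.1 e1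
        have e3 : ω i * (x - z) = ω j * (z - x) := by linear_combination c3 - ω i * e2
        have e4 : ω (i + i) * (x - z) = ω (j + j) * (x - z) := by
          rw [hω.map_add, hω.map_add]
          linear_combination (ω i - ω j) * e3
        have e5 := hω.mul_right_injective (sub_ne_zero.2 hxz) e4
        have e6 : (2 : ZMod p) * (i - j) = 0 := by linear_combination e5
        rcases mul_eq_zero.1 e6 with h | h
        · apply hp2
          have h2 : ((2 : ℕ) : ZMod p) = 0 := by exact_mod_cast h
          rw [ZMod.natCast_eq_zero_iff] at h2
          exact (Nat.prime_dvd_prime_iff_eq hp.out Nat.prime_two).1 h2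
        · exact hij (sub_eq_zero.1 h)
      · refine hmem _ ⟨y, x, by simp, by simp, hxy.symm, rfl⟩ ?_ c3
        intro h
        have : (ω i - ω j) * (y - x) = 0 := by linear_combination h
        exact hxy (sub_eq_zero.1 ((hω.isUnit_sub hij).mul_right_eq_zero.1 this)).symm
    · refine hmem _ ⟨y, z, by simp, by simp, hyz, rfl⟩ c2 ?_
      intro h
      exact hcan i y x hxy.symm (add_right_cancel h)
  · refine hmem _ ⟨z, y, by simp, by simp, hyz.symm, rfl⟩ ?_ c1
    intro h
    exact hcan i z x hxz.symm (add_right_cancel h)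

/-- For odd `p` the products of `p` terms among `2 * p - 1` in a class that avoid zero take more
than `p` values. -/
theorem not_few_products (hp2 : p ≠ 2) {e : ZMod p} (he : e ≠ 0) {X : Finset ι}
    (hX : #X + 1 = 2 * p) {O : Finset (ZMod m)} (hO : #O ≤ p)
    (h0 : ∀ h : ℕ → ι, Set.InjOn h (range p : Finset ℕ) → (∀ k < p, h k ∈ X) →
      ∑ k ∈ range p, ω (k * e) * (el (h k)).2 ≠ 0 ∧
      ∑ k ∈ range p, ω (k * e) * (el (h k)).2 ∈ O) : False := by
  have hp3 : 3 ≤ p := by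
    have := hp.out.two_le
    omega
  obtain ⟨r, hr⟩ : ∃ r, p = r + 2 := ⟨p - 2, by omega⟩
  obtain ⟨u, hu1, hu2, hu3⟩ := exists_monotone_enumeration X (card_pos.1 (by omega))
    (fun i => (el i).2.val)
  set v : ℕ → ZMod m := fun j => (el (u j)).2 with hv
  -- In sorted order equality would give p equal terms, whose product vanishes, contrary to the
  -- hypothesis on X.
  have hdist : ∀ j < p, v j ≠ v (j + (r + 1)) := by
    intro j hj he'
    have heq : ∀ k < p, v (j + k) = v j := by
      intro k hk
      apply ZMod.val_injective
      apply le_antisymm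
      · rw [he']
        exact hu3 _ _ (by omega) (by omega)
      · exact hu3 _ _ (by omega) (by omega)
    refine (h0 (fun k => u (j + k)) (fun a ha b hb hab => ?_) (fun k hk => hu1 _ (by omega))).1 ?_
    · have ha := mem_range.1 ha
      have hb := mem_range.1 hb
      have := hu2 _ (by omega) _ (by omega) hab
      omega
    · rw [sum_congr rfl fun k hk => by
        rw [show (el (u (j + k))).2 = v j from heq k (mem_range.1 hk)], ← sum_mul,
        hω.sum_range_weight he, zero_mul]
  have hne : ∀ a < p, ∀ b < p, a ≠ b → (a : ZMod p) * e ≠ b * e := by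
    intro a ha b hb hab h
    have h1 := (ZMod.natCast_eq_natCast_iff' _ _ _).1 (mul_right_cancel₀ he h)
    rw [Nat.mod_eq_of_lt ha, Nat.mod_eq_of_lt hb] at h1
    exact hab h1
  have d1 : v 0 ≠ v (r + 1) := by simpa using hdist 0 (by omega)
  have d2 : v (r + 1) ≠ v (2 * (r + 1)) := by
    have := hdist (r + 1) (by omega)
    rwa [← two_mul] at this
  have d3 : v 0 ≠ v (2 * (r + 1)) := by
    intro h
    have h3 : (v 0).val ≤ (v (r + 1)).val := hu3 0 (r + 1) (by omega) (by omega)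
    have h4 : (v (r + 1)).val ≤ (v (2 * (r + 1))).val := hu3 _ _ (by omega) (by omega)
    rw [← h] at h4
    exact d1 (ZMod.val_injective _ (le_antisymm h3 h4))
  obtain ⟨D, hD3, hD⟩ := hω.exists_three_values hp2
    (hne 0 (by omega) (r + 1) (by omega) (by omega)) d1 d3 d2
  -- Positions 0 and r + 1 = p - 1 receive two of the three terms with index divisible by r + 1; any
  -- other position k receives index k or k + r + 1.
  let A : ℕ → Finset (ZMod m) := fun k => if k = 0 then D else
    {ω (k * e) * v k, ω (k * e) * v (k + (r + 1))}
  have hA0 : A 0 = D := if_pos rfl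
  have hA1 : ∀ k, A (k + 1) = {ω ((k + 1 : ℕ) * e) * v (k + 1),
      ω ((k + 1 : ℕ) * e) * v (k + 1 + (r + 1))} := fun k => if_neg (Nat.succ_ne_zero k)
  have hA1c : ∀ k < r, #(A (k + 1)) = 2 := by
    intro k hk
    rw [hA1]
    exact card_pair fun h => hdist (k + 1) (by omega) ((hω.isUnit _).mul_left_cancel h)
  -- Nontrivial subgroups have order at least p + 1, so Cauchy–Davenport yields min(p + 1, 1 + 2 +
  -- r) = p + 1 products, more than O can hold.
  have hcard := Finset.min_le_card_sum (n := p + 1) (fun K hK => by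
      obtain ⟨b, hb⟩ := hω.exists_card_subgroup K
      have : b ≠ 0 := by
        rintro rfl
        exact hK (AddSubgroup.card_eq_one.1 (by simpa using hb))
      have : p * 1 ≤ p * b := Nat.mul_le_mul_left _ (by omega)
      omega) (range (r + 1)) A (fun j hj => by
      rw [← card_pos]
      rcases j with _ | j
      · rw [hA0, hD3]; omega
      · rw [hA1c j (by have := mem_range.1 hj; omega)]; omega) (by omega)
  rw [sum_range_succ', hA0, hD3, sum_congr rfl (fun j hj => by rw [hA1c j (mem_range.1 hj)])]
    at hcard
  simp only [Nat.reduceSub, sum_const, card_range, smul_eq_mul, mul_one] at hcard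
  have hsub : ∑ j ∈ range (r + 1), A j ⊆ O := by
    intro x hx
    obtain ⟨g, hg, rfl⟩ := exists_choice_of_mem_sum hx
    obtain ⟨a, b, ha, hb, hab, hgab⟩ := hD (g 0) (by
      rw [← hA0]; exact hg 0 (mem_range.2 (by omega)))
    have hidx : ∀ a ∈ ({v 0, v (r + 1), v (2 * (r + 1))} : Finset (ZMod m)),
        ∃ n ≤ 2 * (r + 1), n % (r + 1) = 0 ∧ v n = a := by
      intro a ha
      simp only [mem_insert, mem_singleton] at ha
      rcases ha with rfl | rfl | rfl
      · exact ⟨0, by omega, by simp, rfl⟩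
      · exact ⟨r + 1, by omega, by simp, rfl⟩
      · exact ⟨2 * (r + 1), by omega, by simp, rfl⟩
    obtain ⟨n₁, hn₁, hm₁, rfl⟩ := hidx a ha
    obtain ⟨n₂, hn₂, hm₂, rfl⟩ := hidx b hb
    have hn₁₂ : n₁ ≠ n₂ := fun h => hab (by rw [h])
    have hch : ∀ k, ∃ n, k < r → n ≤ 2 * (r + 1) ∧ n % (r + 1) = k + 1 ∧
        ω ((k + 1 : ℕ) * e) * v n = g (k + 1) := by
      intro k
      by_cases hk : k < r
      · have h1 := hg (k + 1) (mem_range.2 (by omega))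
        rw [hA1, mem_insert, mem_singleton] at h1
        rcases h1 with h1 | h1
        · exact ⟨k + 1, fun _ => ⟨by omega, Nat.mod_eq_of_lt (by omega), h1.symm⟩⟩
        · refine ⟨k + 1 + (r + 1), fun _ => ⟨by omega, ?_, h1.symm⟩⟩
          rw [Nat.add_mod_right]
          exact Nat.mod_eq_of_lt (by omega)
      · exact ⟨0, fun h => absurd h hk⟩
    choose c hc using hch
    -- The index used in position k is congruent to k modulo r + 1. So indices can collide only in
    -- positions 0 and r + 1, where n₁ ≠ n₂.
    let idx : ℕ → ℕ := fun k => if k = 0 then n₁ else if k = r + 1 then n₂ else c (k - 1)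
    have i0 : idx 0 = n₁ := if_pos rfl
    have i1 : idx (r + 1) = n₂ := by simp [idx]
    have i2 : ∀ k < r, idx (k + 1) = c k := by
      intro k hk
      have : k ≠ r := hk.ne
      simp [idx, this]
    have hcases : ∀ k < p, idx k ≤ 2 * (r + 1) ∧ idx k % (r + 1) = k % (r + 1) := by
      intro k hk
      rcases k with _ | k
      · rw [i0]; exact ⟨hn₁, by simpa using hm₁⟩
      · rcases (show k < r ∨ k = r by omega) with h | rfl
        · rw [i2 k h, Nat.mod_eq_of_lt (by omega : k + 1 < r + 1)]
          exact ⟨(hc k h).1, (hc k h).2.1⟩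
        · rw [i1]; exact ⟨hn₂, by simpa using hm₂⟩
    have hinj : Set.InjOn (fun k => u (idx k)) (range p : Finset ℕ) := by
      intro a ha b hb hab
      have ha := mem_range.1 ha
      have hb := mem_range.1 hb
      have ha' := hcases a ha
      have hb' := hcases b hb
      have h1 := hu2 _ (by omega) _ (by omega) hab
      have h2 : a % (r + 1) = b % (r + 1) := by rw [← ha'.2, ← hb'.2, h1]
      rcases (show a < r + 1 ∨ a = r + 1 by omega) with h | h <;>
      rcases (show b < r + 1 ∨ b = r + 1 by omega) with h' | h'
      · rwa [Nat.mod_eq_of_lt h, Nat.mod_eq_of_lt h'] at h2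
      · rw [Nat.mod_eq_of_lt h, h', Nat.mod_self] at h2
        rw [h2, h', i0, i1] at h1
        exact absurd h1 hn₁₂
      · rw [Nat.mod_eq_of_lt h', h, Nat.mod_self] at h2
        rw [← h2, h, i0, i1] at h1
        exact absurd h1.symm hn₁₂
      · rw [h, h']
    have hS := (h0 (fun k => u (idx k)) hinj
      (fun k hk => hu1 _ (by have := hcases k hk; omega))).2
    have hsum : ∑ k ∈ range p, ω (k * e) * (el (u (idx k))).2 = ∑ j ∈ range (r + 1), g j := by
      have hval : ∀ n, (el (u n)).2 = v n := fun _ => rfl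
      have hrange : range p = range (r + 1 + 1) := by rw [hr]
      rw [hrange, sum_range_succ, sum_range_succ', sum_range_succ', i0, i1, hgab,
        hval, hval, sum_congr rfl fun k hk => by
          rw [i2 k (mem_range.1 hk), hval, (hc k (mem_range.1 hk)).2.2]]
      ring
    rwa [← hsum]
  have := card_le_card hsub
  omega

end IsWeight

end EqualClasses

section EqualClasses

variable {p m : ℕ} [hp : Fact p.Prime] [NeZero m] {ω : ZMod p → ZMod m} {ι : Type*} [DecidableEq ι]
  {el : ι → ZMod p × ZMod m}

namespace IsWeight

variable (hω : IsWeight ω)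
include hω

/-- For `p = 2` a class with more than one value consists of three distinct terms. -/
lemma card_eq_three_of_two (hp2 : p = 2) {e : ZMod p} (he : e ≠ 0) {E : Finset ι} (hE : 3 ≤ #E)
    (hdich : ∀ X ⊆ E, #X + 1 ≤ 2 * p →
      (∀ h : ℕ → ι, Set.InjOn h (range p : Finset ℕ) → (∀ k < p, h k ∈ X) →
      ∑ k ∈ range p, ω (k * e) * (el (h k)).2 = 0) ∨
      ∃ O : Finset (ZMod m), #O ≤ p ∧
      ∀ h : ℕ → ι, Set.InjOn h (range p : Finset ℕ) → (∀ k < p, h k ∈ X) →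
      ∑ k ∈ range p, ω (k * e) * (el (h k)).2 ≠ 0 ∧
      ∑ k ∈ range p, ω (k * e) * (el (h k)).2 ∈ O) {i j : ι} (hi : i ∈ E) (hj : j ∈ E)
    (hij : (el i).2 ≠ (el j).2) : #E = 3 ∧ Set.InjOn (fun i => (el i).2) E := by
  subst hp2
  have hωe : ω e = -1 := by
    have h1 : ω e * ω e = 1 := by
      rw [← hω.map_add, CharTwo.add_self_eq_zero, hω.map_zero]
    have h2 : (ω e - 1) * (ω e + 1) = 0 := by linear_combination h1
    have h3 := (hω.isUnit_sub_one e he).mul_right_eq_zero.1 h2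
    linear_combination h3
  have hpair : ∀ i ∈ E, ∀ j ∈ E, ∀ x ∈ E, i ≠ j → (el i).2 ≠ (el j).2 →
      ∃ O : Finset (ZMod m), #O ≤ 2 ∧ ∀ a b, a ∈ ({i, j, x} : Finset ι) →
      b ∈ ({i, j, x} : Finset ι) → a ≠ b →
      (el a).2 - (el b).2 ≠ 0 ∧ (el a).2 - (el b).2 ∈ O := by
    intro i hi j hj x hx hij hvij
    have hX : ({i, j, x} : Finset ι) ⊆ E := by
      intro y hy
      simp only [mem_insert, mem_singleton] at hy
      rcases hy with rfl | rfl | rfl <;> assumption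
    have hXc : #({i, j, x} : Finset ι) ≤ 3 := card_le_three
    have hX2 : 2 ≤ #({i, j, x} : Finset ι) := by
      rw [← card_pair hij]
      apply card_le_card
      intro y hy
      simp only [mem_insert, mem_singleton] at hy ⊢
      tauto
    rcases hdich _ hX (by omega) with h | ⟨O, hO, h⟩
    · exact absurd (hω.eq_of_products_eq_zero he hX2 h (by simp) (by simp)) hvij
    · refine ⟨O, hO, fun a b ha hb hab => ?_⟩
      have h1 := h (fun k => if k = 0 then a else b) (by
        intro s hs t ht hst
        have hs := mem_range.1 hs
        have ht := mem_range.1 ht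
        interval_cases s <;> interval_cases t <;> simp_all) (by
        intro k _
        split_ifs
        · exact ha
        · exact hb)
      simp only [sum_range_succ, sum_range_zero, if_true, one_ne_zero, if_false, Nat.cast_zero,
        zero_mul, Nat.cast_one, one_mul, hω.map_zero, hωe, zero_add, neg_mul, ← sub_eq_add_neg]
        at h1
      exact h1
  have hne : i ≠ j := fun h => hij (by rw [h])
  -- Since ω(e) = -1, products are differences of values. Those of i and j, in both orders, exhaust
  -- O, so a third term must have value 2v_i - v_j. Two further terms would then agree in value,
  -- which is excluded as well.
  have hthird : ∀ x ∈ E, x ≠ i → x ≠ j →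
      (el x).2 = (el i).2 + ((el i).2 - (el j).2) ∧ (el i).2 ≠ (el x).2 := by
    intro x hx hxi hxj
    obtain ⟨O, hO, h⟩ := hpair i hi j hj x hx hne hij
    have h1 := h i j (by simp) (by simp) hne
    have h2 := h j i (by simp) (by simp) hne.symm
    have h3 := h i x (by simp) (by simp) hxi.symm
    have h4 := h j x (by simp) (by simp) hxj.symm
    have h5 : (el i).2 - (el j).2 ≠ (el j).2 - (el i).2 := by
      intro h'
      apply hω.two_ne_zero_of_ne h1.1
      linear_combination h'
    have h6 : ({(el i).2 - (el j).2, (el j).2 - (el i).2} : Finset (ZMod m)) = O := by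
      apply eq_of_subset_of_card_le
      · intro y hy
        simp only [mem_insert, mem_singleton] at hy
        rcases hy with rfl | rfl
        · exact h1.2
        · exact h2.2
      · rw [card_pair h5]; exact hO
    have h7 := h3.2
    rw [← h6, mem_insert, mem_singleton] at h7
    refine ⟨?_, sub_ne_zero.1 h3.1⟩
    rcases h7 with h7 | h7
    · exact absurd (by linear_combination h7) h4.1
    · linear_combination -h7
  have hsub : {i, j} ⊆ E := by
    intro y hy
    simp only [mem_insert, mem_singleton] at hy
    rcases hy with rfl | rfl <;> assumption
  have hsd : #(E \ {i, j}) + 2 = #E := by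
    rw [← card_pair hne]; exact card_sdiff_add_card_eq_card hsub
  have hcard : #E = 3 := by
    by_contra hE4
    obtain ⟨x, hx, y, hy, hxy⟩ := one_lt_card.1 (show 1 < #(E \ {i, j}) by omega)
    simp only [mem_sdiff, mem_insert, mem_singleton, not_or] at hx hy
    have h1 := hthird x hx.1 hx.2.1 hx.2.2
    have h2 := hthird y hy.1 hy.2.1 hy.2.2
    obtain ⟨O, hO, h⟩ := hpair i hi x hx.1 y hy.1 (Ne.symm hx.2.1) h1.2
    refine (h x y (by simp) (by simp) hxy).1 ?_
    rw [h1.1, h2.1, sub_self]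
  refine ⟨hcard, ?_⟩
  obtain ⟨x, hx⟩ : (E \ {i, j}).Nonempty := by rw [← card_pos]; omega
  simp only [mem_sdiff, mem_insert, mem_singleton, not_or] at hx
  obtain ⟨O, hO, h⟩ := hpair i hi j hj x hx.1 hne hij
  have hEeq : ({i, j, x} : Finset ι) = E := by
    apply eq_of_subset_of_card_le
    · intro y hy
      simp only [mem_insert, mem_singleton] at hy
      rcases hy with rfl | rfl | rfl
      · exact hi
      · exact hj
      · exact hx.1
    · rw [hcard, card_eq_three.2 ⟨i, j, x, hne, Ne.symm hx.2.1, Ne.symm hx.2.2, rfl⟩]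
  intro a ha b hb hab
  rw [← hEeq] at ha hb
  by_contra hne'
  exact (h a b ha hb hne').1 (sub_eq_zero.2 hab)

/-- Given two unequal terms, `products_dichotomy` is applied to a set X containing them. Vanishing
products would make them equal; nonvanishing products confined to O are impossible for odd p, and
for p = 2 they leave only three terms. -/
theorem equal_or_three {β : ℕ} (hm : m = 1 + p * β) (hβ : 1 ≤ β) {F : Finset ι}
    (hfree : ProductOneFree ω el F (m * p)) {e f : ZMod p} (he : e ≠ 0) (hfe : f ≠ e) {k₁ k₂ : ℕ}
    (hk₁ : 2 ≤ k₁) (hk₂ : 1 ≤ k₂) (hk : k₁ + k₂ = m + β + 1)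
    (h₁ : #{i ∈ F | (el i).1 = e} + 1 = k₁ * p) (h₂ : #{i ∈ F | (el i).1 = f} + 1 = k₂ * p) :
    (∃ x : ZMod p × ZMod m, x.1 = e ∧ ∀ i ∈ F, (el i).1 = e → el i = x) ∨
    (p = 2 ∧ #{i ∈ F | (el i).1 = e} = 3 ∧
      Set.InjOn (fun i => (el i).2) ({i ∈ F | (el i).1 = e} : Finset ι)) := by
  set E := {i ∈ F | (el i).1 = e} with hE
  have hmul : 2 * p ≤ k₁ * p := Nat.mul_le_mul_right _ hk₁
  have hp2 := hp.out.two_le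
  by_cases hall : ∀ i ∈ E, ∀ j ∈ E, (el i).2 = (el j).2
  · left
    obtain ⟨i₀, hi₀⟩ : E.Nonempty := by rw [← card_pos]; omega
    refine ⟨el i₀, (mem_filter.1 hi₀).2, fun i hi hie => ?_⟩
    exact Prod.ext (hie.trans (mem_filter.1 hi₀).2.symm)
      (hall i (mem_filter.2 ⟨hi, hie⟩) i₀ hi₀)
  · right
    push Not at hall
    obtain ⟨i, hi, j, hj, hij⟩ := hall
    have hdich : ∀ X ⊆ E, #X + 1 ≤ 2 * p → _ := fun X hX hXc =>
      hω.products_dichotomy hm hβ hfree he hfe hk₁ hk₂ hk h₁ h₂ hX hXc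
    by_cases hpt : p = 2
    · exact ⟨hpt, hω.card_eq_three_of_two hpt he (by omega) hdich hi hj hij⟩
    · exfalso
      have hsub : {i, j} ⊆ E := by
        intro y hy
        simp only [mem_insert, mem_singleton] at hy
        rcases hy with rfl | rfl <;> assumption
      obtain ⟨X, hijX, hXE, hXc⟩ := exists_subsuperset_card_eq hsub (n := 2 * p - 1)
        (card_le_two.trans (by omega)) (by omega)
      rcases hdich X hXE (by omega) with h | ⟨O, hO, h⟩
      · exact hij (hω.eq_of_products_eq_zero he (by omega) h (hijX (by simp)) (hijX (by simp)))
      · exact hω.not_few_products hpt he (by omega) hO h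

/-- The terms of one nonzero class are equal, and all other terms have class zero. -/
theorem not_equal_outer {β : ℕ} (hm : m = 1 + p * β) (hβ : 1 ≤ β) {F : Finset ι}
    (hfree : ProductOneFree ω el F (m * p)) {x : ZMod p × ZMod m} (hx : x.1 ≠ 0) {E N : Finset ι}
    (hE : E ⊆ F) (hN : N ⊆ F) (hEx : ∀ i ∈ E, el i = x) (hN0 : ∀ i ∈ N, (el i).1 = 0) {a b : ℕ}
    (hEc : #E + 1 = p * a + p) (hNc : #N + 1 = p * b + p) (hab : a + b + 1 = m + β)
    (ha : 1 ≤ a) : False := by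
  have hp2 := hp.out.two_le
  have hpβ : 2 * β ≤ p * β := Nat.mul_le_mul_right _ hp2
  have hEN : Disjoint E N := by
    rw [disjoint_left]
    intro i hi hi'
    exact hx (by rw [← hEx i hi, hN0 i hi'])
  set c : ι → ZMod m := fun i => (el i).2 with hc
  -- The pi copies of x multiply to 1 and have suffixes of every class, so the inner terms may be
  -- weighted freely. For i = 0 no outer term is present and only the trivial weight remains.
  have hdirect : ∀ i ≤ a, i ≤ m → ∀ J ⊆ N, #J = p * (m - i) → ∀ w : ι → ZMod p,
      (i = 0 → ∀ k, w k = 0) → ∑ k ∈ J, ω (w k) * c k ≠ 0 := by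
    intro i hia him J hJ hJc w hw hs
    obtain ⟨T, hT, hTc⟩ := exists_subset_card_eq (s := E) (n := p * i) (by
      have := Nat.mul_le_mul_left p hia
      omega)
    have hTJ : Disjoint T J := (hEN.mono_left hT).mono_right hJ
    have hcard : #(T ∪ J) = m * p := by
      rw [card_union_of_disjoint hTJ, hTc, hJc, ← mul_add, Nat.add_sub_cancel' him, mul_comm]
    have hsubF : T ∪ J ⊆ F := union_subset (hT.trans hE) (hJ.trans hN)
    by_cases hi : i = 0
    · have hT0 : T = ∅ := by rw [← card_eq_zero, hTc, hi, mul_zero]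
      subst hT0
      have h1 := hω.realizes_inner (el := el) realizes_empty J w (fun k hk => hN0 k (hJ hk)) hTJ
        (fun k _ => Or.inl (hw hi k))
      rw [hs, add_zero] at h1
      exact hω.not_realizes hfree hsubF hcard h1
    · have h1 := hω.realizes_inner (hω.realizes_of_eq hx i hTc (fun k hk => hEx k (hT hk)) (by omega))
        J w (fun k hk => hN0 k (hJ hk)) hTJ (fun _ _ => Or.inr trivial)
      rw [hs, add_zero] at h1
      exact hω.not_realizes hfree hsubF hcard h1
  have ham : a < m := by
    by_contra h
    exact hdirect m (by omega) le_rfl ∅ (empty_subset _) (by simp) (fun _ => 0) (fun _ _ => rfl)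
      (by simp)
  obtain ⟨b', rfl⟩ : ∃ b', b = b' + β := ⟨b - β, by omega⟩
  have hb' : m - a = b' + 1 := by omega
  have hpb : p * (b' + β) = p * b' + p * β := mul_add _ _ _
  have hpb1 : p * (b' + 1) = p * b' + p := by ring
  set F₀ := {i ∈ N | c i ≠ 0} with hF₀
  have hF₀N : F₀ ⊆ N := filter_subset _ _
  obtain ⟨Λ, -, hΛF, hΛc, hΛ⟩ := exists_sum_eq_or_subgroup (⊤ : AddSubgroup (ZMod m))
    (fun i => weightOrbit ω (c i)) c F₀ ∅ (empty_subset _)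
    (fun i _ x _ => mem_ofSubgroup.2 (AddSubgroup.mem_top _))
    (fun i _ => ⟨c i, hω.self_mem_weightOrbit _⟩)
    (fun i _ K h => hω.mem_of_weightOrbit_sub_mem h)
  rcases hΛ with hΛ | ⟨K, hK1, B, hB, hKc⟩
  · rw [hΛ, card_ofSubgroup, AddSubgroup.card_top, Nat.card_zmod, sum_empty, card_zero,
      card_empty] at hΛc
    have hΛN := hΛF.trans hF₀N
    -- The number p(m - i) of inner terms must not exceed #N and must leave room for Λ, where #Λ ≤ m
    -- - 1 = pβ. This suggests i = m - β, replaced by a if that is smaller.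
    obtain ⟨i, hi0, hia, him, hiN, hiΛ⟩ : ∃ i, i ≠ 0 ∧ i ≤ a ∧ i ≤ m ∧ p * (m - i) ≤ #N ∧
        #Λ ≤ p * (m - i) := by
      by_cases h : a + β ≤ m
      · refine ⟨a, by omega, le_rfl, ham.le, ?_, ?_⟩
        · rw [hb']
          have : p * 1 ≤ p * β := Nat.mul_le_mul_left _ hβ
          omega
        · have : p * β ≤ p * (m - a) := Nat.mul_le_mul_left _ (by omega)
          omega
      · refine ⟨m - β, by omega, by omega, by omega, ?_, ?_⟩
        · rw [Nat.sub_sub_self (by omega)]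
          omega
        · rw [Nat.sub_sub_self (by omega)]
          omega
    obtain ⟨E', hE', hE'c⟩ := exists_subset_card_eq (s := N \ Λ) (n := p * (m - i) - #Λ) (by
      rw [card_sdiff_of_subset hΛN]; omega)
    have ht : -(∑ i ∈ E', ω 0 * c i) ∈ ∑ i ∈ Λ, weightOrbit ω (c i) := by
      rw [hΛ, mem_ofSubgroup]; trivial
    obtain ⟨e, he⟩ := exists_of_mem_sum_weightOrbit ht
    have hd : Disjoint Λ E' := disjoint_sdiff.mono_right hE'
    obtain ⟨e', he'⟩ := sum_weights_union (ω := ω) hd c e (fun _ => 0)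
    refine hdirect i hia him (Λ ∪ E') (union_subset hΛN (hE'.trans sdiff_subset)) ?_ e'
      (fun h => absurd h hi0) ?_
    · rw [card_union_of_disjoint hd, hE'c]; omega
    · rw [he', ← he]; ring
  · rw [AddSubgroup.card_top, Nat.card_zmod] at hKc
    by_cases hK0 : K = ⊥
    · subst hK0
      rw [AddSubgroup.card_bot, one_mul] at hKc
      have hν : #F₀ ≤ #B := card_le_card fun i hi => hB i hi (by simpa using (mem_filter.1 hi).2)
      have hZc : #(N \ F₀) + #F₀ = #N := card_sdiff_add_card_eq_card hF₀N
      -- At most m - 2 = pβ - 1 inner terms are nonzero, which leaves p(b' + 1) = p(m - a) zeros.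
      obtain ⟨J, hJ, hJc⟩ := exists_subset_card_eq (s := N \ F₀) (n := p * (m - a)) (by
        rw [hb']; omega)
      refine hdirect a le_rfl ham.le J (hJ.trans sdiff_subset) hJc (fun _ => 0) (fun _ _ => rfl) ?_
      refine Finset.sum_eq_zero fun i hi => ?_
      have h1 := mem_sdiff.1 (hJ hi)
      have : c i = 0 := by
        by_contra h
        exact h1.2 (mem_filter.2 ⟨h1.1, h⟩)
      rw [this, mul_zero]
    · obtain ⟨u, s, hu, hus, -, hu1, hs1⟩ := hω.card_arith (K := K) hm
      replace hu1 := hu1 hK0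
      replace hs1 := hs1 hK1.ne
      have hkpos : 0 < Nat.card K := Nat.card_pos
      set k := Nat.card K with hk
      -- kq is m - a rounded up to a multiple of k, still at most m. EGZ in K gives pkq inner terms
      -- of sum zero, completed by p(m - kq) copies of x.
      set q := (m - a + (k - 1)) / k with hq
      have hq1 : k * q ≤ m - a + (k - 1) := Nat.mul_div_le _ _
      have hq2 : m - a ≤ k * q := by
        have := Nat.lt_mul_div_succ (m - a + (k - 1)) hkpos
        rw [← hq, mul_add] at this
        omega
      have hq3 : k * q ≤ m := by
        rw [hus, ← hu]
        apply Nat.mul_le_mul_left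
        rw [hq]
        apply Nat.le_of_lt_succ
        rw [Nat.div_lt_iff_lt_mul hkpos, Nat.succ_mul, mul_comm, hu, ← hus]
        omega
      obtain ⟨T, hT, hTc, hTs⟩ := ZMod.exists_sum_eq_zero_of_mem_subgroup K c (p * (k * q))
        ⟨p * q, by rw [← hk]; ring⟩ (N \ B) (fun i hi => by
          rw [mem_sdiff] at hi
          by_contra h
          exact hi.2 (hB i (mem_filter.2 ⟨hi.1, fun h0 => h (by rw [h0]; exact K.zero_mem)⟩) h)) (by
          have h1 := le_card_sdiff B N
          have h2 := Nat.mul_le_mul_left p hq1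
          rw [hb'] at h2
          have h3 : #B + 2 ≤ 1 + p * s := by
            refine Nat.le_of_mul_le_mul_left (c := 1 + p * u) ?_ (by omega)
            rw [← hus, ← hu]
            exact hKc
          have h4 : p * (b' + 1 + (k - 1)) = p * b' + p + p * (p * u) := by
            rw [hu, Nat.add_sub_cancel_left]; ring
          have h5 : p * β = p * u + p * s + p * u * (p * s) := by
            have : 1 + p * β = 1 + (p * u + p * s + p * u * (p * s)) := by
              rw [← hm, hus]; ring
            omega
          have h6 : p * (p * u) ≤ p * u * (p * s) := by
            calc p * (p * u) = p * u * (p * 1) := by ring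
              _ ≤ _ := by gcongr
          rw [← hk]
          omega)
      refine hdirect (m - k * q) (by omega) (by omega) T (hT.trans sdiff_subset) ?_ (fun _ => 0)
        (fun _ _ => rfl) ?_
      · rw [hTc, Nat.sub_sub_self hq3]
      · simp only [hω.map_zero, one_mul, hTs]

end IsWeight

end EqualClasses

/-! ### A nonzero class with p terms leads to the group of order six. -/

section BlockCase

variable {p m : ℕ} [hp : Fact p.Prime] [NeZero m] {ω : ZMod p → ZMod m} {ι : Type*} [DecidableEq ι]
  {el : ι → ZMod p × ZMod m}

namespace IsWeight

variable (hω : IsWeight ω)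
include hω

/-- If a nonzero class contains `p` terms then the family is the exceptional one for the
non-abelian group of order six. -/
theorem exceptional_of_block {β : ℕ} (hm : m = 1 + p * β) (hβ : 1 ≤ β) {F : Finset ι}
    (hF : #F + 3 = m * p + m + p) (hfree : ProductOneFree ω el F (m * p)) {d : ZMod p} (hd0 : d ≠ 0)
    (hd : p ≤ #{i ∈ F | (el i).1 = d}) :
    p = 2 ∧ β = 1 ∧ #{i ∈ F | (el i).1 ≠ 0} = 3 ∧
      Set.InjOn (fun i => (el i).2) ({i ∈ F | (el i).1 ≠ 0} : Finset ι) ∧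
      ∀ i ∈ F, (el i).1 = 0 → (el i).2 = 0 := by
  obtain ⟨b, k₁, k₂, hbd, hk₁, hk₂, hk, h₁, h₂, hall⟩ :=
    hω.exists_two_classes hm hβ hF hfree hd0 hd
  have htwo : ∀ x : ZMod p, p = 2 → x ≠ 0 → x = d := by
    intro x h hx
    subst h
    exact ZMod.eq_of_ne_zero_of_ne_zero x d hx hd0
  obtain ⟨l₁, rfl⟩ : ∃ l, k₁ = l + 1 := ⟨k₁ - 1, by omega⟩
  obtain ⟨l₂, rfl⟩ : ∃ l, k₂ = l + 1 := ⟨k₂ - 1, by omega⟩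
  have hpos := hp.out.pos
  have hmul₁ : (l₁ + 1) * p = p * l₁ + p := by ring
  have hmul₂ : (l₂ + 1) * p = p * l₂ + p := by ring
  rcases hω.equal_or_three hm hβ hfree hd0 hbd hk₁ hk₂ hk h₁ h₂ with ⟨x, hxd, hx⟩ | ⟨hp2, hE, hinj⟩
  · exfalso
    by_cases hb0 : b = 0
    · subst hb0
      exact hω.not_equal_outer hm hβ hfree (x := x) (by rw [hxd]; exact hd0)
        (E := {i ∈ F | (el i).1 = d}) (N := {i ∈ F | (el i).1 = 0}) (filter_subset _ _)
        (filter_subset _ _) (fun i hi => hx i (mem_filter.1 hi).1 (mem_filter.1 hi).2)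
        (fun i hi => (mem_filter.1 hi).2) (a := l₁) (b := l₂) (by omega) (by omega) (by omega)
        (by omega)
    -- With two nonzero classes, mp copies of x have product one if there are enough. Otherwise the
    -- second class is also constant, and p·l₁ copies of x with p(m - l₁) copies of its common term
    -- do. For p = 2 there is no second nonzero class.
    · by_cases hml : m ≤ l₁
      · have h3 := Nat.mul_le_mul_left p hml
        obtain ⟨T, hT, hTc⟩ := exists_subset_card_eq (s := {i ∈ F | (el i).1 = d}) (n := p * m)
          (by omega)
        exact hω.not_realizes hfree (hT.trans (filter_subset _ _)) (by rw [hTc, mul_comm])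
          (hω.realizes_of_eq (x := x) (by rw [hxd]; exact hd0) m hTc
            (fun i hi => hx i (mem_filter.1 (hT hi)).1 (mem_filter.1 (hT hi)).2)
            (NeZero.pos m))
      · rcases hω.equal_or_three hm hβ hfree hb0 hbd.symm (k₁ := l₂ + 1) (k₂ := l₁ + 1)
          (by omega) (by omega) (by omega) h₂ h₁ with ⟨y, hyb, hy⟩ | ⟨hp2, -, -⟩
        · have h3 := Nat.mul_le_mul_left p (show m - l₁ ≤ l₂ by omega)
          obtain ⟨T, hT, hTc⟩ := exists_subset_card_eq (s := {i ∈ F | (el i).1 = d}) (n := p * l₁)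
            (by omega)
          obtain ⟨T', hT', hT'c⟩ := exists_subset_card_eq (s := {i ∈ F | (el i).1 = b})
            (n := p * (m - l₁)) (by omega)
          have hd' : Disjoint T T' := by
            rw [disjoint_left]
            intro i hi hi'
            exact hbd ((mem_filter.1 (hT' hi')).2.symm.trans (mem_filter.1 (hT hi)).2)
          have h4 := hω.realizes_union (hω.realizes_of_eq (x := x) (by rw [hxd]; exact hd0) l₁ hTc
            (fun i hi => hx i (mem_filter.1 (hT hi)).1 (mem_filter.1 (hT hi)).2) (by omega))
            (hω.realizes_of_eq (x := y) (by rw [hyb]; exact hb0) (m - l₁) hT'c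
            (fun i hi => hy i (mem_filter.1 (hT' hi)).1 (mem_filter.1 (hT' hi)).2) (by omega)) hd'
          rw [add_zero] at h4
          refine hω.not_realizes hfree (union_subset (hT.trans (filter_subset _ _))
            (hT'.trans (filter_subset _ _))) ?_ h4
          rw [card_union_of_disjoint hd', hTc, hT'c, ← mul_add, Nat.add_sub_cancel' (by omega),
            mul_comm]
        · exact hbd (htwo b hp2 hb0)
  · have hb0 : b = 0 := by
      by_contra hb0
      exact hbd (htwo b hp2 hb0)
    subst hb0
    have houter : {i ∈ F | (el i).1 ≠ 0} = {i ∈ F | (el i).1 = d} :=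
      filter_congr fun i _ => ⟨fun h => htwo _ hp2 h, fun h => by rw [h]; exact hd0⟩
    obtain ⟨U, hU, hUc⟩ := exists_subset_card_eq (s := {i ∈ F | (el i).1 = d}) (n := p) (by omega)
    obtain ⟨g, hg⟩ := hω.exists_realizes_univ hd0 hUc (fun i hi => (mem_filter.1 (hU hi)).2)
    have hl₁ : l₁ = 1 := by
      have h3 : (l₁ + 1) * p = (l₁ + 1) * 2 := by rw [hp2]
      omega
    obtain ⟨-, hβ1, hz⟩ := hω.inner_eq_zero_of_block hm hβ hfree (hU.trans (filter_subset _ _)) hUc hg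
      (N := {i ∈ F | (el i).1 = 0}) (filter_subset _ _) (by
        rw [disjoint_left]
        intro i hi hi'
        exact hd0 ((mem_filter.1 (hU hi)).2.symm.trans (mem_filter.1 hi').2))
      (fun i hi => (mem_filter.1 hi).2) (by
        have h3 : l₂ + 1 = m + β - 1 := by omega
        obtain ⟨b, rfl⟩ : ∃ b, β = b + 1 := ⟨β - 1, by omega⟩
        have h4 : l₂ + 1 = m + b := by omega
        rw [h4] at h₂
        have h5 : (m + b) * p + p = m * p + p * (b + 1) := by ring
        omega)
    refine ⟨hp2, hβ1, ?_, ?_, fun i hi hi0 => hz i (mem_filter.2 ⟨hi, hi0⟩)⟩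
    · rw [houter, hE]
    · rw [houter]; exact hinj

end IsWeight

end BlockCase

/-! ### Zero-sum free families in groups of prime order. -/

section ZeroSumFreeFamilies

variable {q : ℕ} [hq : Fact q.Prime] {ι : Type*} [DecidableEq ι]

lemma ZMod.min_le_card_sum_pair {c : ι → ZMod q} {s : Finset ι} (hs : ∀ i ∈ s, c i ≠ 0) :
    min q (1 + #s) ≤ #(∑ i ∈ s, ({0, c i} : Finset (ZMod q))) := by
  have := ZMod.min_le_card_sum s (fun i => ({0, c i} : Finset (ZMod q)))
    (fun i _ => ⟨0, by simp⟩)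
  rw [sum_congr rfl fun i hi => by rw [card_pair (hs i hi).symm]] at this
  simpa using this

/-- The Davenport constant of a group of prime order. -/
lemma ZMod.exists_nonempty_sum_eq_zero (c : ι → ZMod q) {s : Finset ι} (hs : q ≤ #s) :
    ∃ T ⊆ s, T.Nonempty ∧ ∑ i ∈ T, c i = 0 := by
  by_cases h0 : ∃ i ∈ s, c i = 0
  · obtain ⟨i, hi, hi0⟩ := h0
    exact ⟨{i}, by simpa using hi, by simp, by simpa using hi0⟩
  push Not at h0
  have hpos := hq.out.pos
  obtain ⟨i, hi⟩ : s.Nonempty := by rw [← card_pos]; omega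
  have h1 := ZMod.min_le_card_sum_pair (c := c) (s := s.erase i)
    (fun j hj => h0 j (mem_of_mem_erase hj))
  have h2 := card_erase_add_one hi
  have hu : ∑ i ∈ s.erase i, ({0, c i} : Finset (ZMod q)) = univ := by
    apply Finset.eq_univ_of_card
    rw [ZMod.card]
    exact le_antisymm ((card_le_univ _).trans_eq (ZMod.card q)) (by omega)
  have h3 : -c i ∈ ∑ i ∈ s.erase i, ({0, c i} : Finset (ZMod q)) := by rw [hu]; exact mem_univ _
  obtain ⟨J, hJ, hJs⟩ := exists_of_mem_sum_pair h3
  refine ⟨insert i J, insert_subset hi (hJ.trans (erase_subset _ _)), by simp, ?_⟩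
  rw [sum_insert fun h => notMem_erase _ _ (hJ h), hJs, add_neg_cancel]

/-- A zero-sum free family of maximal length in a group of prime order is constant. -/
lemma ZMod.eq_of_zero_sum_free {c : ι → ZMod q} {s : Finset ι} (hs : #s + 1 = q)
    (hfree : ∀ T ⊆ s, T.Nonempty → ∑ i ∈ T, c i ≠ 0) {i j : ι} (hi : i ∈ s) (hj : j ∈ s) :
    c i = c j := by
  by_contra hij
  have hne : i ≠ j := fun h => hij (by rw [h])
  have h0 : ∀ i ∈ s, c i ≠ 0 := fun i hi => by
    simpa using hfree {i} (by simpa using hi) (by simp)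
  have hsub : {i, j} ⊆ s := by
    intro y hy
    simp only [mem_insert, mem_singleton] at hy
    rcases hy with rfl | rfl <;> assumption
  have h1 := ZMod.min_le_card_sum_pair (c := c) (s := s \ {i, j})
    (fun k hk => h0 k (mem_sdiff.1 hk).1)
  have h2 : #(s \ {i, j}) + 2 = #s := by
    rw [← card_pair hne]; exact card_sdiff_add_card_eq_card hsub
  have hsum : c i + c j ≠ 0 := by
    have := hfree {i, j} hsub (by simp)
    rwa [sum_pair hne] at this
  -- The other q - 3 terms have at least q - 2 subset sums, so they meet this three-element set, and
  -- each meeting point completes a zero sum.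
  have h3 : #({-c i, -c j, -(c i + c j)} : Finset (ZMod q)) = 3 := by
    refine card_eq_three.2 ⟨_, _, _, fun h => hij (neg_injective h), fun h => h0 j hj ?_,
      fun h => h0 i hi ?_, rfl⟩
    · simpa using neg_injective h
    · simpa using neg_injective h
  have h4 : ¬ Disjoint (∑ i ∈ s \ {i, j}, ({0, c i} : Finset (ZMod q)))
      {-c i, -c j, -(c i + c j)} := by
    intro hd
    have h5 := card_union_of_disjoint hd
    have h6 := card_le_univ ((∑ i ∈ s \ {i, j}, ({0, c i} : Finset (ZMod q))) ∪
      {-c i, -c j, -(c i + c j)})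
    rw [ZMod.card] at h6
    omega
  rw [not_disjoint_iff] at h4
  obtain ⟨x, hx, hx'⟩ := h4
  obtain ⟨J, hJ, rfl⟩ := exists_of_mem_sum_pair hx
  have hJs : J ⊆ s := hJ.trans sdiff_subset
  have hiJ : i ∉ J := fun h => (mem_sdiff.1 (hJ h)).2 (by simp)
  have hjJ : j ∉ J := fun h => (mem_sdiff.1 (hJ h)).2 (by simp)
  simp only [mem_insert, mem_singleton] at hx'
  rcases hx' with h | h | h
  · apply hfree (insert i J) (insert_subset hi hJs) (by simp)
    rw [sum_insert hiJ, h, add_neg_cancel]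
  · apply hfree (insert j J) (insert_subset hj hJs) (by simp)
    rw [sum_insert hjJ, h, add_neg_cancel]
  · apply hfree (insert i (insert j J)) (insert_subset hi (insert_subset hj hJs)) (by simp)
    rw [sum_insert (by simp [hne, hiJ]), sum_insert hjJ, h]
    ring

/-- A zero-sum subfamily of maximal length. -/
lemma ZMod.exists_max_zero_sum (c : ι → ZMod q) (s : Finset ι) :
    ∃ Z ⊆ s, ∑ i ∈ Z, c i = 0 ∧ (∀ Z' ⊆ s, ∑ i ∈ Z', c i = 0 → #Z' ≤ #Z) ∧
      (∀ T ⊆ s \ Z, T.Nonempty → ∑ i ∈ T, c i ≠ 0) ∧ #(s \ Z) + 1 ≤ q := by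
  obtain ⟨Z, hZ, hmax⟩ := exists_max_image (s.powerset.filter fun Z => ∑ i ∈ Z, c i = 0)
    Finset.card
    ⟨∅, by simp⟩
  simp only [mem_filter, mem_powerset] at hZ hmax
  have hfree : ∀ T ⊆ s \ Z, T.Nonempty → ∑ i ∈ T, c i ≠ 0 := by
    intro T hT hTne hTs
    have hd : Disjoint Z T := disjoint_sdiff.mono_right hT
    have := hmax (Z ∪ T) ⟨union_subset hZ.1 (hT.trans sdiff_subset), by
      rw [sum_union hd, hZ.2, hTs, add_zero]⟩
    rw [card_union_of_disjoint hd] at this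
    have := hTne.card_pos
    omega
  refine ⟨Z, hZ.1, hZ.2, fun Z' h h' => hmax Z' ⟨h, h'⟩, hfree, ?_⟩
  by_contra hcon
  obtain ⟨T, hT, hTne, hTs⟩ := ZMod.exists_nonempty_sum_eq_zero c (s := s \ Z) (by omega)
  exact hfree T hT hTne hTs

end ZeroSumFreeFamilies

/-! ### Values of product-one free families for prime m. -/

section PrimeModulus

variable {p m : ℕ} [hp : Fact p.Prime] [NeZero m] {ω : ZMod p → ZMod m} {ι : Type*} [DecidableEq ι]
  {el : ι → ZMod p × ZMod m}

namespace IsWeight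

variable (hω : IsWeight ω)
include hω

/-- The rotations of a minimal block. -/
lemma exists_rotations {W : Finset ι} (hW : ∑ i ∈ W, (el i).1 = 0)
    (hmin : ∀ T ⊆ W, T.Nonempty → ∑ i ∈ T, (el i).1 = 0 → #W ≤ #T)
    (h0 : ¬ Realizes ω el ∅ W 0) :
    ∃ A : Finset (ZMod m), #A = #W ∧ ∀ a ∈ A, Realizes ω el ∅ W a := by
  set l := W.toList with hl
  have hnd : l.Nodup := nodup_toList _
  have hlW : l.toFinset = W := toList_toFinset _
  have hlen : l.length = #W := length_toList _
  have hcl : seqClass el l = 0 := by rw [seqClass_eq_sum hnd, hlW, hW]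
  have hreal : Realizes ω el (Set.range fun k => seqClass el (l.drop k)) W (seqValue ω el l) := by
    refine ⟨l, hnd, hlW, hcl, rfl, ?_⟩
    rintro j ⟨k, rfl⟩
    exact ⟨l.drop k, List.drop_suffix _ _, rfl⟩
  have hg : seqValue ω el l ≠ 0 := fun h => h0 (by
    rw [h] at hreal
    exact hreal.mono (Set.empty_subset _))
  -- Equal suffix classes would enclose a shorter nonempty part of class zero. So the #W cuts have
  -- distinct classes, and rotating there multiplies the nonzero value by distinct weights.
  have hlt : ∀ i j, i < j → j < #W → seqClass el (l.drop i) ≠ seqClass el (l.drop j) := by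
    intro i j hij hj h
    have h1 : (l.drop i).take (j - i) ++ l.drop j = l.drop i := by
      conv_rhs => rw [← List.take_append_drop (j - i) (l.drop i)]
      rw [List.drop_drop, Nat.add_sub_cancel' hij.le]
    rw [← h1, seqClass_append, add_eq_right] at h
    have hnd' : ((l.drop i).take (j - i)).Nodup :=
      (hnd.sublist (List.drop_sublist _ _)).sublist (List.take_sublist _ _)
    have hcard : #((l.drop i).take (j - i)).toFinset = j - i := by
      rw [List.toFinset_card_of_nodup hnd', List.length_take, List.length_drop, hlen]
      omega
    have := hmin ((l.drop i).take (j - i)).toFinset (by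
      intro x hx
      rw [List.mem_toFinset] at hx
      rw [← hlW, List.mem_toFinset]
      exact List.mem_of_mem_drop (List.mem_of_mem_take hx)) (by rw [← card_pos]; omega)
      (by rw [← seqClass_eq_sum hnd', h])
    omega
  refine ⟨(range #W).image fun k => ω (-seqClass el (l.drop k)) * seqValue ω el l, ?_, ?_⟩
  · rw [card_image_of_injOn, card_range]
    intro i hi j hj hij
    have hi := mem_range.1 hi
    have hj := mem_range.1 hj
    have h1 := neg_injective (hω.mul_right_injective hg hij)
    rcases lt_trichotomy i j with h | h | h
    · exact absurd h1 (hlt i j h hj)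
    · exact h
    · exact absurd h1.symm (hlt j i h hi)
  · intro a ha
    obtain ⟨k, -, rfl⟩ := Finset.mem_image.1 ha
    exact hω.realizes_rotate hreal ⟨k, rfl⟩

/-- The values of the subfamilies of `Y`. -/
noncomputable def _root_.realizedValues (ω : ZMod p → ZMod m) (el : ι → ZMod p × ZMod m)
    (Y : Finset ι) : Finset (ZMod m) := by
  classical exact univ.filter fun x => ∃ T ⊆ Y, Realizes ω el ∅ T x

omit hω in
lemma _root_.mem_realizedValues {Y : Finset ι} {x : ZMod m} :
    x ∈ realizedValues ω el Y ↔ ∃ T ⊆ Y, Realizes ω el ∅ T x := by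
  simp [realizedValues]

/-- In a product-one free family over a group with `m` prime the subfamilies of a family of class
zero take many values. -/
theorem card_realizedValues (hm : m.Prime) {R : Finset ι}
    (hR : ∀ T ⊆ R, T.Nonempty → ¬ Realizes ω el ∅ T 0) {Y : Finset ι} (hY : Y ⊆ R)
    (hY0 : ∑ i ∈ Y, (el i).1 = 0) : #Y + 1 ≤ m ∧ #Y + 1 ≤ #(realizedValues ω el Y) := by
  induction Y using Finset.strongInduction with
  | H Y ih =>
    have : Fact m.Prime := ⟨hm⟩
    by_cases hne : Y.Nonempty
    · obtain ⟨W, hW, hmin⟩ := exists_min_image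
        (Y.powerset.filter fun W => W.Nonempty ∧ ∑ i ∈ W, (el i).1 = 0) card
        ⟨Y, by simp [hne, hY0]⟩
      simp only [mem_filter, mem_powerset] at hW hmin
      obtain ⟨hWY, hWne, hW0⟩ := hW
      obtain ⟨A, hAc, hA⟩ := hω.exists_rotations hW0
        (fun T hT h1 h2 => hmin T ⟨hT.trans hWY, h1, h2⟩) (hR W (hWY.trans hY) hWne)
      have hsum : ∑ i ∈ Y \ W, (el i).1 = 0 := by
        rw [← sum_sdiff hWY, hW0, add_zero] at hY0
        exact hY0
      obtain ⟨-, h2⟩ := ih (Y \ W) (sdiff_ssubset hWY hWne) (sdiff_subset.trans hY) hsum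
      have hYc : #(Y \ W) + #W = #Y := card_sdiff_add_card_eq_card hWY
      -- A common element would give a product-one subfamily of R. Disjointness bounds #Y from
      -- above; adding {0} ∪ A by Cauchy–Davenport then gains #W values.
      have hd : Disjoint (realizedValues ω el (Y \ W)) (A.image fun a => -a) := by
        rw [disjoint_left]
        intro x hx hx'
        obtain ⟨T, hT, hTr⟩ := mem_realizedValues.1 hx
        obtain ⟨a, ha, rfl⟩ := Finset.mem_image.1 hx'
        have hTW : Disjoint T W := sdiff_disjoint.mono_left hT
        have h3 := hω.realizes_union hTr (hA a ha) hTW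
        rw [neg_add_cancel] at h3
        exact hR (T ∪ W) (union_subset (hT.trans (sdiff_subset.trans hY)) (hWY.trans hY))
          (hWne.mono subset_union_right) h3
      have h3 := card_union_of_disjoint hd
      have h4 := card_le_univ (realizedValues ω el (Y \ W) ∪ A.image fun a => -a)
      rw [card_image_of_injective _ neg_injective] at h3
      rw [ZMod.card] at h4
      have h5 : #Y + 1 ≤ m := by omega
      refine ⟨h5, ?_⟩
      have h6 : realizedValues ω el (Y \ W) + insert 0 A ⊆ realizedValues ω el Y := by
        intro x hx
        obtain ⟨y, hy, a, ha, rfl⟩ := Finset.mem_add.1 hx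
        obtain ⟨T, hT, hTr⟩ := mem_realizedValues.1 hy
        rw [mem_realizedValues]
        rcases mem_insert.1 ha with rfl | ha
        · exact ⟨T, hT.trans sdiff_subset, by rwa [add_zero]⟩
        · exact ⟨T ∪ W, union_subset (hT.trans sdiff_subset) hWY,
            hω.realizes_union hTr (hA a ha) (sdiff_disjoint.mono_left hT)⟩
      have h7 := ZMod.cauchy_davenport hm
        (s := realizedValues ω el (Y \ W)) (t := insert 0 A)
        (by rw [← card_pos]; omega) ⟨0, by simp⟩
      have h8 : (0 : ZMod m) ∉ A := fun h => hR W (hWY.trans hY) hWne (hA 0 h)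
      rw [card_insert_of_notMem h8] at h7
      have h9 := card_le_card h6
      omega
    · rw [not_nonempty_iff_eq_empty] at hne
      subst hne
      refine ⟨by have := NeZero.pos m; rw [card_empty]; omega, ?_⟩
      rw [card_empty, zero_add, Nat.one_le_iff_ne_zero, ← Nat.pos_iff_ne_zero, card_pos]
      exact ⟨0, mem_realizedValues.2 ⟨∅, subset_rfl, realizes_empty⟩⟩

omit hω in
/-- A product with an outer term has a final segment of nonzero class. -/
lemma _root_.Realizes.exists_suffix {P : Set (ZMod p)} {T : Finset ι} {g : ZMod m}
    (h : Realizes ω el P T g) {i : ι} (hi : i ∈ T) (hi0 : (el i).1 ≠ 0) :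
    ∃ j, j ≠ 0 ∧ Realizes ω el {j} T g := by
  obtain ⟨l, h1, h2, h3, h4, -⟩ := h
  by_contra hcon
  push Not at hcon
  have hsuf : ∀ l', l' <:+ l → seqClass el l' = 0 := by
    intro l' hl'
    by_contra hne
    exact hcon _ hne ⟨l, h1, h2, h3, h4, fun j hj => ⟨l', hl', hj.symm⟩⟩
  rw [← h2, List.mem_toFinset] at hi
  -- The final segments starting at i and just after i differ by the class of i, so they cannot both
  -- have class 0.
  obtain ⟨s, t, rfl⟩ := List.append_of_mem hi
  have e1 := hsuf (i :: t) (List.suffix_append _ _)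
  have e2 := hsuf t ((List.suffix_cons _ _).trans (List.suffix_append _ _))
  rw [seqClass_cons, e2, add_zero] at e1
  exact hi0 e1

end IsWeight

end PrimeModulus

/-! ### Growth of sums of the sets {0, c, ω(j)c}. -/

section ThreeElementSets

/-- Adding a three-element set to a periodic set without changing the period. -/
lemma Finset.card_add_two_mul_le {V : Type*} [AddCommGroup V] [Fintype V] [DecidableEq V]
    {K : AddSubgroup V} {Z : Finset V} {c d : V} (hc : c ∉ K) (hd : d ∉ K) (hcd : d - c ∉ K)
    (hZ : Z.period = K) (hZA : (Z + {0, c, d}).period = K) :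
    #Z + 2 * Nat.card K ≤ #(Z + {0, c, d}) := by
  classical
  set X := Z + {0, c, d} with hX
  have hsub : Z ⊆ X := fun x hx => by
    simpa using Finset.add_mem_add hx (mem_insert_self 0 {c, d})
  have hXc : ∀ x ∈ Z, x + c ∈ X := fun x hx => Finset.add_mem_add hx (by simp)
  have hXd : ∀ x ∈ Z, x + d ∈ X := fun x hx => Finset.add_mem_add hx (by simp)
  by_contra hcon
  have hDc : #(X \ Z) < 2 * Nat.card K := by
    rw [card_sdiff_of_subset hsub]
    have := card_le_card hsub
    omega
  have hper : ∀ y ∈ X \ Z, ∀ k ∈ K, y + k ∈ X \ Z := fun y hy k hk =>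
    sdiff_add_mem hZ.ge hZA.ge hy hk
  -- Under the assumption for contradiction the new elements are fewer than two cosets of K, so they
  -- lie in a single one.
  have hone : ∀ y ∈ X \ Z, ∀ z ∈ X \ Z, y - z ∈ K := by
    intro y hy z hz
    by_contra hyz
    have h1 : Nat.card K ≤ #{x ∈ X \ Z | x - z ∈ K} := card_subgroup_le (x := z) fun k hk => by
      rw [mem_filter]
      exact ⟨hper z hz k hk, by simpa using hk⟩
    have h2 : Nat.card K ≤ #{x ∈ X \ Z | x - z ∉ K} := card_subgroup_le (x := y) fun k hk => by
      rw [mem_filter]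
      refine ⟨hper y hy k hk, fun h => hyz ?_⟩
      have := K.sub_mem h hk
      rwa [show y + k - z - k = y - z by abel] at this
    have h3 := card_filter_add_card_filter_not (s := X \ Z) (fun x => x - z ∈ K)
    omega
  have hex : ∀ e, e ∉ K → ∃ x ∈ Z, x + e ∉ Z := by
    intro e he
    by_contra h
    push Not at h
    exact he (by rw [← hZ]; exact h)
  obtain ⟨x, hx, hxc⟩ := hex c hc
  obtain ⟨y, hy, hyd⟩ := hex d hd
  have hz : x + c ∈ X \ Z := mem_sdiff.2 ⟨hXc x hx, hxc⟩
  -- Otherwise x + c and x + d would be new elements in different cosets. So x + c + d ∈ X, and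
  -- since every new element is congruent to x + c modulo K, d would be a period of X.
  have hxd : x + d ∈ Z := by
    by_contra h
    have h1 := hone _ (mem_sdiff.2 ⟨hXd x hx, h⟩) _ hz
    exact hcd (by rwa [show x + d - (x + c) = d - c by abel] at h1)
  have hzd : x + c + d ∈ X := by
    have := hXc _ hxd
    rwa [show x + d + c = x + c + d by abel] at this
  apply hd
  rw [← hZA]
  intro w hw
  by_cases hwZ : w ∈ Z
  · exact hXd w hwZ
  · have h1 := hone w (mem_sdiff.2 ⟨hw, hwZ⟩) _ hz
    rw [← hZA] at h1
    have h2 := h1 _ hzd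
    rwa [show x + c + d + (w - (x + c)) = w + d by abel] at h2

variable {p m : ℕ} [hp : Fact p.Prime] [NeZero m] {ω : ZMod p → ZMod m} {ι : Type*} [DecidableEq ι]

/-- Meant for products in which only one nonzero suffix class j is known, so that inner terms can be
inserted with weight ω(0) or ω(j) only. -/
lemma exists_of_mem_sum_two {j : ZMod p} {c : ι → ZMod m} {Λ : Finset ι} {x : ZMod m}
    (hω : IsWeight ω) (hx : x ∈ ∑ i ∈ Λ, ({c i, ω j * c i} : Finset (ZMod m))) :
    ∃ w : ι → ZMod p, (∀ i, w i = 0 ∨ w i = j) ∧ x = ∑ i ∈ Λ, ω (w i) * c i := by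
  obtain ⟨g, hg, rfl⟩ := exists_choice_of_mem_sum hx
  refine ⟨fun i => if g i = c i then 0 else j, fun i => ?_, sum_congr rfl fun i hi => ?_⟩
  · by_cases h : g i = c i <;> simp [h]
  · have := hg i hi
    rw [mem_insert, mem_singleton] at this
    by_cases h : g i = c i
    · simp [h, hω.map_zero]
    · simp only [h, if_false]
      exact this.resolve_left h

lemma exists_of_mem_sum_three {j : ZMod p} {c : ι → ZMod m} {Λ : Finset ι} {x : ZMod m}
    (hω : IsWeight ω) (hx : x ∈ ∑ i ∈ Λ, ({0, c i, ω j * c i} : Finset (ZMod m))) :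
    ∃ J ⊆ Λ, ∃ w : ι → ZMod p, (∀ i, w i = 0 ∨ w i = j) ∧ x = ∑ i ∈ J, ω (w i) * c i := by
  obtain ⟨g, hg, rfl⟩ := exists_choice_of_mem_sum hx
  refine ⟨Λ.filter fun i => g i ≠ 0, filter_subset _ _, fun i => if g i = c i then 0 else j,
    fun i => ?_, ?_⟩
  · by_cases h : g i = c i <;> simp [h]
  · rw [← sum_filter_ne_zero]
    refine sum_congr rfl fun i hi => ?_
    rw [mem_filter] at hi
    have := hg i hi.1
    rw [mem_insert, mem_insert, mem_singleton] at this
    by_cases h : g i = c i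
    · simp [h, hω.map_zero]
    · simp only [h, if_false]
      exact (this.resolve_left hi.2).resolve_left h

namespace IsWeight

variable (hω : IsWeight ω)
include hω

/-- The analogue of `hull_dichotomy` for two weights. The sums need not be weight-stable, so a term
outside K gains two cosets by `card_add_two_mul_le` instead of p, and the complement contains one
coset instead of p. -/
theorem three_dichotomy {j : ZMod p} (hj : j ≠ 0) (c : ι → ZMod m) (F : Finset ι) :
    ∑ i ∈ F, ({0, c i, ω j * c i} : Finset (ZMod m)) = univ ∨ ∃ K : AddSubgroup (ZMod m), K ≠ ⊤ ∧
      ∃ B : Finset ι, (∀ i ∈ F, c i ∉ K → i ∈ B) ∧ Nat.card K * (2 * #B + 2) ≤ m := by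
  classical
  set X := ∑ i ∈ F, ({0, c i, ω j * c i} : Finset (ZMod m)) with hX
  by_cases hXu : X = univ
  · exact Or.inl hXu
  right
  have hne : X.Nonempty := by
    rw [hX]
    clear_value X
    clear hX hXu
    induction F using Finset.induction_on with
    | empty => simp
    | insert i F hi ih =>
      rw [sum_insert hi]
      exact Finset.Nonempty.add ⟨0, by simp⟩ ih
  set K := X.period with hK
  have hKX : ofSubgroup K + X = X := ofSubgroup_add_eq le_rfl
  have hmain := card_sum_growth K 2 (fun i => ({0, c i, ω j * c i} : Finset (ZMod m)))
    (fun i => c i ∉ K) (fun _ => True) F trivial (fun _ _ _ _ => trivial)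
    (fun i _ => ⟨0, by simp⟩) (fun i _ hi Z _ hZ hZA => by
      refine Finset.card_add_two_mul_le hi
        (fun h => hi (ZMod.mem_of_unit_mul_mem K (hω.isUnit j) h)) (fun h => hi ?_) hZ hZA
      refine hω.mem_of_sub_mem hj (j := 0) ?_
      rwa [hω.map_zero, one_mul]) (by rw [← hX, hKX])
  rw [← hX, hKX] at hmain
  refine ⟨K, fun h => hXu (period_eq_top hne h), F.filter fun i => c i ∉ K,
    fun i hi h => by simp [hi, h], ?_⟩
  have h1 : ∀ y ∈ univ \ X, ∀ k ∈ K, y + k ∈ univ \ X := fun y hy k hk =>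
    sdiff_add_mem le_rfl (fun _ _ _ _ => mem_univ _) hy hk
  obtain ⟨y, hy⟩ : (univ \ X).Nonempty := by
    rw [sdiff_nonempty]
    exact fun h => hXu (subset_antisymm (subset_univ _) h)
  have h2 : Nat.card K ≤ #(univ \ X) := card_subgroup_le (x := y) (h1 y hy)
  rw [card_sdiff_of_subset (subset_univ _), card_univ, ZMod.card] at h2
  have h3 := card_le_univ X
  rw [ZMod.card] at h3
  calc _ = Nat.card K * (1 + 2 * #{i ∈ F | c i ∉ K}) + Nat.card K := by ring
    _ ≤ _ := by omega

end IsWeight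

end ThreeElementSets

/-! ### Odd p: some nonzero class has p terms. -/

section FewOuterTerms

variable {p m : ℕ} [hp : Fact p.Prime] [NeZero m] {ω : ZMod p → ZMod m} {ι : Type*} [DecidableEq ι]
  {el : ι → ZMod p × ZMod m}

namespace IsWeight

variable (hω : IsWeight ω)
include hω

/-- A product of few outer terms forces most of the inner terms to be trivial. -/
theorem two_mul_card_inner_le {β : ℕ} (hm : m = 1 + p * β) (hβ : 1 ≤ β) {F : Finset ι}
    (hF : #F + 3 = m * p + m + p) (hfree : ProductOneFree ω el F (m * p))
    (hN : p ≤ #{i ∈ F | (el i).1 ≠ 0}) (hN' : #{i ∈ F | (el i).1 ≠ 0} ≤ (p - 1) * (p - 1)) :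
    2 * #{i ∈ F | (el i).1 = 0 ∧ (el i).2 ≠ 0} + 2 ≤ m := by
  classical
  have hp2 := hp.out.two_le
  set O := {i ∈ F | (el i).1 ≠ 0} with hO
  set I := {i ∈ F | (el i).1 = 0} with hI
  set c : ι → ZMod m := fun i => (el i).2 with hc
  set F₀ := {i ∈ F | (el i).1 = 0 ∧ (el i).2 ≠ 0} with hF₀
  have hcardF : #I + #O = #F := card_filter_add_card_filter_not _
  have hF₀I : F₀ ⊆ I := fun i hi => by
    rw [mem_filter] at hi ⊢
    exact ⟨hi.1, hi.2.1⟩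
  have hI0 : ∀ i ∈ I, (el i).1 = 0 := fun i hi => (mem_filter.1 hi).2
  have hIF : I ⊆ F := filter_subset _ _
  have hOF : O ⊆ F := filter_subset _ _
  have hdisj : Disjoint O I := by
    rw [disjoint_left]
    exact fun i h h' => (mem_filter.1 h).2 (hI0 i h')
  -- Fewer than p outer terms remain outside Z, so Z is nonempty. Ordered with an outer term last,
  -- its product has a suffix of nonzero class j.
  obtain ⟨Z, hZO, hZ0, -, -, hZc⟩ := ZMod.exists_max_zero_sum (fun i => (el i).1) O
  have hZc' : #(O \ Z) + #Z = #O := card_sdiff_add_card_eq_card hZO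
  obtain ⟨i₀, hi₀⟩ : Z.Nonempty := by rw [← card_pos]; omega
  set j := (el i₀).1 with hj
  have hj0 : j ≠ 0 := (mem_filter.1 (hZO hi₀)).2
  obtain ⟨g, hg⟩ := exists_realizes (ω := ω) hZ0 hi₀
  have hdZ : Disjoint Z I := hdisj.mono_left hZO
  obtain ⟨q, hq⟩ : ∃ q, p = q + 1 := ⟨p - 1, by omega⟩
  have hq1 : p - 1 = q := by omega
  rw [hq1] at hN'
  have hpq : p * p = q * q + 2 * q + 1 := by rw [hq]; ring
  have hmp : m * p = p + p * p * β := by rw [hm]; ring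
  have hmq : m * p = m * q + m := by rw [hq]; ring
  have hppβ : p * p * 1 ≤ p * p * β := Nat.mul_le_mul_left _ hβ
  have hpβ : p * 1 ≤ p * β := Nat.mul_le_mul_left _ hβ
  have hmq' : q * q + 2 * q ≤ m * q := by
    have : (q + 2) * q ≤ m * q := by
      apply Nat.mul_le_mul_right
      omega
    linarith
  have hdirect : ∀ J ⊆ I, #Z + #J = m * p → ∀ w : ι → ZMod p, (∀ i ∈ J, w i = 0 ∨ w i = j) →
      g + ∑ i ∈ J, ω (w i) * c i ≠ 0 := by
    intro J hJ hJc w hw h0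
    have h1 := hω.realizes_inner hg J w (fun i hi => hI0 i (hJ hi)) (hdZ.mono_right hJ) hw
    rw [h0] at h1
    refine hω.not_realizes hfree (union_subset (hZO.trans hOF) (hJ.trans hIF)) ?_ h1
    rw [card_union_of_disjoint (hdZ.mono_right hJ), hJc]
  have hsub : ∀ K : AddSubgroup (ZMod m), K ≠ ⊥ → K ≠ ⊤ → ∀ B : Finset ι,
      (∀ i ∈ F₀, c i ∉ K → i ∈ B) → ¬ Nat.card K * (#B + 2) ≤ m := by
    intro K hK0 hK1 B hB hKB
    refine hω.card_inner_subgroup hfree K (s := I \ B) (sdiff_subset.trans hIF)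
      (fun i hi => hI0 i (mem_sdiff.1 hi).1) (fun i hi => ?_) ?_
    · by_contra h
      rw [mem_sdiff] at hi
      refine hi.2 (hB i (mem_filter.2 ⟨hIF hi.1, hI0 i hi.1, fun h0 => h ?_⟩) h)
      rw [h0]; exact K.zero_mem
    · obtain ⟨a, b, ha, hab, -, ha1, hb1⟩ := hω.card_arith (K := K) hm
      have h1 := ha1 hK0
      have h2 := hb1 hK1
      rw [ha] at hKB ⊢
      have h3 : #B + 2 ≤ 1 + p * b :=
        Nat.le_of_mul_le_mul_left (hKB.trans hab.le) (by omega)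
      have h4 := le_card_sdiff B I
      have h5 : p * p ≤ p * a * (p * b) := by
        calc p * p = p * 1 * (p * 1) := by ring
          _ ≤ p * a * (p * b) := by gcongr
      have h6 : (1 + p * a) * (1 + p * b) = 1 + p * a + p * b + p * a * (p * b) := by ring
      omega
  obtain ⟨Λ, -, hΛF, hΛc, hΛ⟩ := exists_sum_eq_or_subgroup (⊤ : AddSubgroup (ZMod m))
    (fun i => {c i, ω j * c i}) c F₀ ∅ (empty_subset _)
    (fun i _ x _ => mem_ofSubgroup.2 (AddSubgroup.mem_top _))
    (fun i _ => ⟨c i, by simp⟩)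
    (fun i _ K h => hω.mem_of_sub_mem (i := 0) (j := j) hj0.symm (by
      rw [hω.map_zero, one_mul]
      exact h _ (by simp) _ (by simp)))
  rcases hΛ with hΛ | ⟨K, hK1, B, hB, hKc⟩
  · exfalso
    rw [hΛ, card_ofSubgroup, AddSubgroup.card_top, Nat.card_zmod, sum_empty, card_zero,
      card_empty] at hΛc
    have hΛN := hΛF.trans hF₀I
    obtain ⟨E, hE, hEc⟩ := exists_subset_card_eq (s := I \ Λ) (n := m * p - #Z - #Λ) (by
      rw [card_sdiff_of_subset hΛN]; omega)
    have ht : -(g + ∑ i ∈ E, ω 0 * c i) ∈ ∑ i ∈ Λ, ({c i, ω j * c i} : Finset (ZMod m)) := by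
      rw [hΛ, mem_ofSubgroup]; trivial
    obtain ⟨w, hw, he⟩ := exists_of_mem_sum_two hω ht
    have hd : Disjoint Λ E := disjoint_sdiff.mono_right hE
    refine hdirect (Λ ∪ E) (union_subset hΛN (hE.trans sdiff_subset)) ?_
      (fun i => if i ∈ Λ then w i else 0) ?_ ?_
    · rw [card_union_of_disjoint hd, hEc]; omega
    · intro i _
      by_cases h : i ∈ Λ
      · simpa [h] using hw i
      · simp [h]
    · have e₁ : ∑ i ∈ Λ, ω (if i ∈ Λ then w i else 0) * c i = ∑ i ∈ Λ, ω (w i) * c i :=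
        sum_congr rfl fun i hi => by rw [if_pos hi]
      have e₂ : ∑ i ∈ E, ω (if i ∈ Λ then w i else 0) * c i = ∑ i ∈ E, ω 0 * c i :=
        sum_congr rfl fun i hi => by rw [if_neg (disjoint_right.1 hd hi)]
      rw [sum_union hd, e₁, e₂, ← he]
      ring
  rw [AddSubgroup.card_top, Nat.card_zmod] at hKc
  by_cases hK0 : K = ⊥
  · subst hK0
    rw [AddSubgroup.card_bot, one_mul] at hKc
    have hν : #F₀ ≤ #B := card_le_card fun i hi => hB i hi (by simpa using (mem_filter.1 hi).2.2)
    have hZI : #(I \ F₀) + #F₀ = #I := card_sdiff_add_card_eq_card hF₀I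
    have hpad : ∀ J ⊆ F₀, ∀ w : ι → ZMod p, (∀ i, w i = 0 ∨ w i = j) →
        g + ∑ i ∈ J, ω (w i) * c i ≠ 0 := by
      intro J hJ w hw he
      have hJc := card_le_card hJ
      obtain ⟨E, hE, hEc⟩ := exists_subset_card_eq (s := I \ F₀) (n := m * p - #Z - #J) (by omega)
      have hd : Disjoint J E := (disjoint_sdiff.mono_left hJ).mono_right hE
      refine hdirect (J ∪ E) (union_subset (hJ.trans hF₀I) (hE.trans sdiff_subset)) ?_ w
        (fun i _ => hw i) ?_
      · rw [card_union_of_disjoint hd, hEc]; omega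
      · rw [sum_union hd, Finset.sum_eq_zero (s := E), add_zero, he]
        intro i hi
        have hi' := mem_sdiff.1 (hE hi)
        have : c i = 0 := by
          by_contra h
          exact hi'.2 (mem_filter.2 ⟨hIF hi'.1, hI0 i hi'.1, h⟩)
        rw [this, mul_zero]
    -- By `hpad` the target -g is not reached, so the three-element sets do not fill ℤ/m. With K'
    -- trivial the resulting bound is the claim.
    rcases hω.three_dichotomy hj0 c F₀ with h | ⟨K', hK1', B', hB', hKc'⟩
    · exfalso
      have h3 : -g ∈ ∑ i ∈ F₀, ({0, c i, ω j * c i} : Finset (ZMod m)) := by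
        rw [h]; exact mem_univ _
      obtain ⟨J, hJ, w, hw, he⟩ := exists_of_mem_sum_three hω h3
      exact hpad J hJ w hw (by rw [← he]; ring)
    · by_cases hK0' : K' = ⊥
      · subst hK0'
        rw [AddSubgroup.card_bot, one_mul] at hKc'
        have hν' : #F₀ ≤ #B' :=
          card_le_card fun i hi => hB' i hi (by simpa using (mem_filter.1 hi).2.2)
        omega
      · exact absurd ((Nat.mul_le_mul_left _ (by omega)).trans hKc') (hsub K' hK0' hK1' B' hB')
  · exact absurd hKc (hsub K hK0 hK1.ne B hB)

/-- A small modulus is prime. -/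
lemma prime_modulus {β : ℕ} (hm : m = 1 + p * β) (hβ : 1 ≤ β) (hp' : p ≠ 2)
    (hlt : m < 4 * (p * p)) : m.Prime := by
  by_contra hnp
  have hm2 : 2 ≤ m := by
    have : 1 * 1 ≤ p * β := Nat.mul_le_mul hp.out.pos hβ
    omega
  have hd := Nat.minFac_dvd m
  have hd1 : 1 < m.minFac := (Nat.minFac_prime (by omega)).one_lt
  have hd2 : m.minFac < m := (Nat.not_prime_iff_minFac_lt hm2).1 hnp
  set K := AddSubgroup.zmultiples ((m.minFac : ℕ) : ZMod m) with hK
  have hKc : Nat.card K = m / m.minFac := by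
    rw [hK, Nat.card_zmultiples, ZMod.addOrderOf_coe _ (by omega), Nat.gcd_eq_right hd]
  have hmd := Nat.div_mul_cancel hd
  obtain ⟨a, b, ha, hab, -, ha1, hb1⟩ := hω.card_arith (K := K) hm
  have h1 := ha1 (fun h => by
    rw [h, AddSubgroup.card_bot] at hKc
    rw [← hKc] at hmd
    omega)
  have h2 := hb1 (fun h => by
    rw [h, AddSubgroup.card_top, Nat.card_zmod] at hKc
    rw [← hKc] at hmd
    have : m * 2 ≤ m * m.minFac := Nat.mul_le_mul_left _ hd1
    omega)
  have hodd := hω.odd_modulus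
  have hpodd := hp.out.odd_of_ne_two hp'
  -- A proper factorisation of m has factors 1 + pa and 1 + pb with a, b ≥ 1; as p and m are odd, a,
  -- b ≥ 2, so m > 4p².
  have heven : ∀ x, Odd (1 + p * x) → 1 ≤ x → 2 ≤ x := by
    intro x hx hx1
    by_contra h
    obtain rfl : x = 1 := by omega
    rw [mul_one] at hx
    exact (Nat.not_odd_iff_even.2 (Odd.add_odd odd_one hpodd)) hx
  rw [hab, Nat.odd_mul] at hodd
  have h3 := heven a hodd.1 h1
  have h4 := heven b hodd.2 h2
  have h5 : 2 * p * (2 * p) ≤ p * a * (p * b) := by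
    calc 2 * p * (2 * p) = p * 2 * (p * 2) := by ring
      _ ≤ _ := by gcongr
  have h6 : (1 + p * a) * (1 + p * b) = 1 + p * a + p * b + p * a * (p * b) := by ring
  have h7 : 2 * p * (2 * p) = 4 * (p * p) := by ring
  omega

/-- A long product-one free family over a group with `m` prime consists of `m - 1` terms of total
class zero and `p - 1` terms of the same class. -/
lemma inner_of_productOneFree (hm : m.Prime) {R : Finset ι}
    (hR : ∀ T ⊆ R, T.Nonempty → ¬ Realizes ω el ∅ T 0) (hRc : m + p ≤ #R + 2)
    (hlow : ∀ d, d ≠ 0 → #{i ∈ R | (el i).1 = d} + 1 ≤ p) :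
    ∃ Y ⊆ R, #Y + 1 = m ∧ #(R \ Y) + 1 = p ∧ ∀ i ∈ Y, (el i).1 = 0 := by
  have hp2 := hp.out.two_le
  obtain ⟨Y, hYR, hY0, hmax, hfree, hRY⟩ := ZMod.exists_max_zero_sum (fun i => (el i).1) R
  have hY := (hω.card_realizedValues hm hR hYR hY0).1
  have hc : #(R \ Y) + #Y = #R := card_sdiff_add_card_eq_card hYR
  refine ⟨Y, hYR, by omega, by omega, fun i hi => ?_⟩
  by_contra hi0
  set b := (el i).1 with hb
  obtain ⟨i₂, hi₂⟩ : (R \ Y).Nonempty := by rw [← card_pos]; omega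
  set a := (el i₂).1 with ha
  have ha0 : a ≠ 0 := by
    have := hfree {i₂} (by simpa using hi₂) (by simp)
    rwa [sum_singleton] at this
  have hall : ∀ k ∈ R \ Y, (el k).1 = a := fun k hk =>
    ZMod.eq_of_zero_sum_free (by omega) hfree hk hi₂
  have hiR : i ∉ R \ Y := fun h => (mem_sdiff.1 h).2 hi
  have hba : b ≠ a := by
    intro h
    have h1 : insert i (R \ Y) ⊆ {k ∈ R | (el k).1 = a} := by
      intro k hk
      rw [mem_filter]
      rcases mem_insert.1 hk with rfl | hk
      · exact ⟨hYR hi, h⟩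
      · exact ⟨(mem_sdiff.1 hk).1, hall k hk⟩
    have h2 := card_le_card h1
    rw [card_insert_of_notMem hiR] at h2
    have := hlow a ha0
    omega
  set t := (b * a⁻¹).val with ht
  have hta : (t : ZMod p) * a = b := by
    rw [ht, ZMod.natCast_zmod_val, inv_mul_cancel_right₀ ha0]
  have ht0 : t ≠ 0 := by
    intro h
    rw [h] at hta
    exact hi0 (by rw [← hta]; simp)
  have ht1 : t ≠ 1 := by
    intro h
    rw [h] at hta
    exact hba (by rw [← hta]; simp)
  have htp : t < p := ZMod.val_lt _
  -- The class of i is t times the common class a, with 2 ≤ t < p. Replacing i by t terms outside Y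
  -- would give a longer zero-sum set.
  obtain ⟨D, hD, hDc⟩ := exists_subset_card_eq (s := R \ Y) (n := t) (by omega)
  have hd : Disjoint (Y.erase i) D :=
    (disjoint_sdiff.mono_left (erase_subset _ _)).mono_right hD
  have h1 := hmax (Y.erase i ∪ D)
    (union_subset ((erase_subset _ _).trans hYR) (hD.trans sdiff_subset)) (by
      rw [sum_union hd, sum_congr rfl (fun k hk => hall k (hD hk)), sum_const, hDc, nsmul_eq_mul,
        hta, hb, sum_erase_add _ _ hi, hY0])
  rw [card_union_of_disjoint hd, hDc] at h1
  have := card_erase_add_one hi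
  omega

/-- A product-one free family with at least `p` outer terms has `p` terms of the same nonzero
class. -/
theorem exists_le_card_class {β : ℕ} (hm : m = 1 + p * β) (hβ : 1 ≤ β) {F : Finset ι}
    (hF : #F + 3 = m * p + m + p) (hfree : ProductOneFree ω el F (m * p)) (hp' : p ≠ 2)
    (hN : p ≤ #{i ∈ F | (el i).1 ≠ 0}) : ∃ d, d ≠ 0 ∧ p ≤ #{i ∈ F | (el i).1 = d} := by
  classical
  by_contra hcon
  push Not at hcon
  have hp2 := hp.out.two_le
  have hN' : #{i ∈ F | (el i).1 ≠ 0} ≤ (p - 1) * (p - 1) := by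
    have := card_le_mul_card_image_of_maps_to (s := {i ∈ F | (el i).1 ≠ 0})
      (t := univ.erase (0 : ZMod p)) (f := fun i => (el i).1)
      (fun i hi => mem_erase.2 ⟨(mem_filter.1 hi).2, mem_univ _⟩) (p - 1) (fun d hd => by
        have h1 := hcon d (mem_erase.1 hd).1
        have h2 : #{i ∈ {i ∈ F | (el i).1 ≠ 0} | (el i).1 = d} ≤ #{i ∈ F | (el i).1 = d} :=
          card_le_card (filter_subset_filter _ (filter_subset _ _))
        omega)
    rwa [card_erase_of_mem (mem_univ _), card_univ, ZMod.card] at this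
  have hν := hω.two_mul_card_inner_le hm hβ hF hfree hN hN'
  set O := {i ∈ F | (el i).1 ≠ 0} with hO
  set I := {i ∈ F | (el i).1 = 0} with hI
  set F₀ := {i ∈ F | (el i).1 = 0 ∧ (el i).2 ≠ 0} with hF₀
  set E := {i ∈ F | (el i).1 = 0 ∧ (el i).2 = 0} with hE
  have hcardF : #I + #O = #F := card_filter_add_card_filter_not _
  have hEI : #E + #F₀ = #I := by
    have := card_filter_add_card_filter_not (s := I) (fun i => (el i).2 = 0)
    rwa [hI, filter_filter, filter_filter] at this
  have hEF : E ⊆ F := filter_subset _ _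
  have hEc := hω.card_inner_subgroup hfree ⊥ hEF (fun i hi => (mem_filter.1 hi).2.1) (fun i hi => by
    rw [AddSubgroup.mem_bot]; exact (mem_filter.1 hi).2.2)
  rw [AddSubgroup.card_bot] at hEc
  obtain ⟨q, hq⟩ : ∃ q, p = q + 1 := ⟨p - 1, by omega⟩
  have hq1 : p - 1 = q := by omega
  rw [hq1] at hN'
  have hpq : p * p = q * q + 2 * q + 1 := by rw [hq]; ring
  have hmp : m * p = p + p * p * β := by rw [hm]; ring
  have hmq : m * p = m * q + m := by rw [hq]; ring
  have hpβ : p * 1 ≤ p * β := Nat.mul_le_mul_left _ hβ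
  have hmq' : q * q + 2 * q ≤ m * q := by
    have : (q + 2) * q ≤ m * q := by
      apply Nat.mul_le_mul_right
      omega
    linarith
  -- There are at most mp - 1 trivial terms, (p - 1)² outer terms and (m - 2)/2 nontrivial inner
  -- terms; comparing with #F bounds m below 4p².
  have hprime : m.Prime := hω.prime_modulus hm hβ hp' (by omega)
  set S := O ∪ F₀ with hS
  have hSF : S ⊆ F := union_subset (filter_subset _ _) (filter_subset _ _)
  have hSc : #S = #O + #F₀ := card_union_of_disjoint (by
    rw [disjoint_left]
    exact fun i h h' => (mem_filter.1 h).2 (mem_filter.1 h').2.1)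
  have hSE : Disjoint S E := by
    rw [hS, disjoint_union_left, disjoint_left, disjoint_left]
    exact ⟨fun i h h' => (mem_filter.1 h).2 (mem_filter.1 h').2.1,
      fun i h h' => (mem_filter.1 h).2.2 (mem_filter.1 h').2.2⟩
  -- Z is a largest product-one family of nontrivial terms. Padding with the trivial terms E shows
  -- #Z + #E < mp, so at least m + p - 2 terms of S remain, and these contain no nonempty
  -- product-one subfamily.
  obtain ⟨Z, hZ, hmax⟩ := exists_max_image (S.powerset.filter fun Z => Realizes ω el ∅ Z 0)
    Finset.card ⟨∅, by simp [realizes_empty]⟩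
  simp only [mem_filter, mem_powerset, and_imp] at hZ hmax
  obtain ⟨hZS, hZr⟩ := hZ
  have hZc : #(S \ Z) + #Z = #S := card_sdiff_add_card_eq_card hZS
  have hZE : #Z + #E + 1 ≤ m * p := by
    by_contra h
    obtain ⟨E', hE', hE'c⟩ := exists_subset_card_eq (s := E) (n := m * p - #Z) (by omega)
    have hd : Disjoint Z E' := (hSE.mono_left hZS).mono_right hE'
    have h1 := hω.realizes_inner hZr E' (fun _ => 0) (fun i hi => (mem_filter.1 (hE' hi)).2.1) hd
      (fun _ _ => Or.inl rfl)
    rw [Finset.sum_eq_zero (fun i hi => by rw [(mem_filter.1 (hE' hi)).2.2, mul_zero]),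
      add_zero] at h1
    refine hω.not_realizes hfree (union_subset (hZS.trans hSF) (hE'.trans hEF)) ?_ h1
    rw [card_union_of_disjoint hd, hE'c]
    omega
  have hR : ∀ T ⊆ S \ Z, T.Nonempty → ¬ Realizes ω el ∅ T 0 := by
    intro T hT hTne hTr
    have hd : Disjoint Z T := disjoint_sdiff.mono_right hT
    have h1 := hω.realizes_union hZr hTr hd
    rw [add_zero] at h1
    have h2 := hmax (Z ∪ T) (union_subset hZS (hT.trans sdiff_subset)) h1
    rw [card_union_of_disjoint hd] at h2
    have := hTne.card_pos
    omega
  have hRF : S \ Z ⊆ F := sdiff_subset.trans hSF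
  obtain ⟨Y, hYR, hYc, hRYc, hY0⟩ := hω.inner_of_productOneFree hprime hR (by omega) (fun d hd => by
    have h1 := hcon d hd
    have h2 : #{i ∈ S \ Z | (el i).1 = d} ≤ #{i ∈ F | (el i).1 = d} :=
      card_le_card (filter_subset_filter _ hRF)
    omega)
  -- Only p - 1 terms of S \ Z lie outside the inner set Y, so one of the at least p outer terms
  -- belongs to Z.
  obtain ⟨i₀, hi₀Z, hi₀⟩ : ∃ i ∈ Z, (el i).1 ≠ 0 := by
    by_contra h
    push Not at h
    have h1 : O ⊆ (S \ Z) \ Y := by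
      intro i hi
      have hi0 := (mem_filter.1 hi).2
      exact mem_sdiff.2 ⟨mem_sdiff.2 ⟨mem_union_left _ hi, fun h' => hi0 (h i h')⟩,
        fun h' => hi0 (hY0 i h')⟩
    have := card_le_card h1
    omega
  obtain ⟨j, hj, hZj⟩ := hZr.exists_suffix hi₀Z hi₀
  obtain ⟨i₁, hi₁⟩ : Y.Nonempty := by
    rw [← card_pos]
    have := hprime.two_le
    omega
  have hi₁S := hYR hi₁
  have hc0 : (el i₁).2 ≠ 0 := by
    rcases mem_union.1 (mem_sdiff.1 hi₁S).1 with h | h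
    · exact absurd (hY0 i₁ hi₁) (mem_filter.1 h).2
    · exact (mem_filter.1 h).2.2
  have h1 := (hω.card_realizedValues hprime hR ((erase_subset i₁ _).trans hYR)
    (Finset.sum_eq_zero fun i hi => hY0 i (mem_of_mem_erase hi))).2
  have h2 := card_erase_add_one hi₁
  have hne : -(el i₁).2 ≠ -(ω j * (el i₁).2) := by
    intro h
    have h3 := neg_injective h
    refine hj (hω.mul_right_injective hc0 (a₁ := j) (a₂ := 0) ?_)
    simp only [hω.map_zero, one_mul]
    exact h3.symm
  -- Y without i₁ takes at least m - 1 values, hence one of these two. The first gives a product-one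
  -- subfamily of S \ Z; the second enlarges Z once i₁ is inserted at a cut of class j.
  have hnd : ¬ Disjoint (realizedValues ω el (Y.erase i₁))
      {-(el i₁).2, -(ω j * (el i₁).2)} := by
    intro hd
    have h3 := card_union_of_disjoint hd
    have h4 := card_le_univ (realizedValues ω el (Y.erase i₁) ∪
      {-(el i₁).2, -(ω j * (el i₁).2)})
    rw [ZMod.card] at h4
    rw [card_pair hne] at h3
    omega
  rw [not_disjoint_iff] at hnd
  obtain ⟨x, hx, hx'⟩ := hnd
  obtain ⟨T, hT, hTr⟩ := mem_realizedValues.1 hx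
  have hi₁r := hω.realizes_singleton (el := el) (hY0 i₁ hi₁)
  have hiT : Disjoint T {i₁} := by
    rw [disjoint_singleton_right]
    exact fun h => notMem_erase _ _ (hT h)
  have hTR : T ⊆ S \ Z := hT.trans ((erase_subset _ _).trans hYR)
  have hTi : T ∪ {i₁} ⊆ S \ Z := union_subset hTR (by simpa using hi₁S)
  rw [mem_insert, mem_singleton] at hx'
  rcases hx' with rfl | rfl
  · have h3 := hω.realizes_union hTr hi₁r hiT
    rw [neg_add_cancel] at h3
    exact hR _ hTi ⟨i₁, by simp⟩ h3
  · have hZi : Disjoint Z {i₁} := by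
      rw [disjoint_singleton_right]
      exact (mem_sdiff.1 hi₁S).2
    have h3 := hω.realizes_insert hZj hi₁r hZi (j := j) (Or.inr rfl)
    have hZT : Disjoint (Z ∪ {i₁}) T := by
      rw [disjoint_union_left]
      exact ⟨disjoint_sdiff.mono_right hTR, hiT.symm⟩
    have h4 := hω.realizes_union h3 hTr hZT
    rw [zero_add, add_neg_cancel] at h4
    have h5 := hmax _ (union_subset (union_subset hZS
      (by simpa using (mem_sdiff.1 hi₁S).1)) (hTR.trans sdiff_subset))
      (h4.mono (Set.empty_subset _))
    rw [card_union_of_disjoint hZT, card_union_of_disjoint hZi, card_singleton] at h5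
    omega

end IsWeight

end FewOuterTerms

/-! ### The extremal families in coordinates. -/

section ModelStructure

variable {p m : ℕ} [hp : Fact p.Prime] [NeZero m] {ω : ZMod p → ZMod m} {ι : Type*} [DecidableEq ι]
  {el : ι → ZMod p × ZMod m}

/-- `p - 1` terms of the same nonzero class together with a two-valued family of inner terms. -/
def IsGenericFamily (el : ι → ZMod p × ZMod m) (F : Finset ι) : Prop :=
  #{i ∈ F | (el i).1 ≠ 0} + 1 = p ∧ (∃ a, a ≠ 0 ∧ ∀ i ∈ F, (el i).1 ≠ 0 → (el i).1 = a) ∧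
    IsTwoValued p {i ∈ F | (el i).1 = 0} (fun i => (el i).2)

/-- Three outer terms with distinct components together with trivial terms, for the group of order
six. -/
def IsExceptionalFamily (el : ι → ZMod p × ZMod m) (F : Finset ι) : Prop :=
  p = 2 ∧ m = 3 ∧ #{i ∈ F | (el i).1 ≠ 0} = 3 ∧
    Set.InjOn (fun i => (el i).2) ({i ∈ F | (el i).1 ≠ 0} : Finset ι) ∧
    ∀ i ∈ F, (el i).1 = 0 → (el i).2 = 0

/-- Lengths in a two-valued family together with a block of `w` terms. -/
lemma exists_two_valued_count [Fact (1 < m)] {w k₁ k₂ : ℕ} {a b g : ZMod m} (hab : IsUnit (a - b))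
    (hk₁ : 1 ≤ k₁) (hk₂ : 1 ≤ k₂) (hk : k₁ + k₂ = p + 1) (hw : 1 ≤ w) (hwm : w ≤ m) :
    ∃ u v, w + u + v = m * p ∧ u + 1 ≤ k₁ * m ∧ v + 1 ≤ k₂ * m ∧ g + (u * a + v * b) = 0 := by
  have hp2 := hp.out.two_le
  -- Substituting v = mp - w - u turns the equation into u(a - b) = wb - g, which fixes u modulo m.
  -- The bounds leave at least m consecutive admissible u.
  set x : ZMod m := (w * b - g) * (a - b)⁻¹ with hx
  have hxab : x * (a - b) = w * b - g := by
    rw [hx, mul_assoc, ZMod.inv_mul_of_unit _ hab, mul_one]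
  have hxm : x.val < m := ZMod.val_lt x
  have key : ∀ u : ℕ, (u : ZMod m) = x → u + w ≤ m * p →
      g + ((u : ZMod m) * a + ((m * p - w - u : ℕ) : ZMod m) * b) = 0 := by
    intro u hu huw
    have h1 : ((m * p - w - u : ℕ) : ZMod m) = -w - u := by
      rw [Nat.cast_sub (by omega), Nat.cast_sub (by omega)]
      simp
    rw [h1, hu]
    linear_combination hxab
  obtain ⟨q, rfl⟩ : ∃ q, p = q + 2 := ⟨p - 2, by omega⟩
  have e1 : m * (q + 2) = m * q + 2 * m := by ring
  rcases Nat.lt_or_ge 1 k₁ with h | h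
  · obtain ⟨l, rfl⟩ : ∃ l, k₁ = l + 2 := ⟨k₁ - 2, by omega⟩
    obtain ⟨n, rfl⟩ : ∃ n, k₂ = n + 1 := ⟨k₂ - 1, by omega⟩
    obtain rfl : q = l + n := by omega
    have e2 : m * (l + n) = l * m + n * m := by ring
    have e3 : (l + 2) * m = l * m + 2 * m := by ring
    have e4 : (n + 1) * m = n * m + m := by ring
    by_cases hxw : x.val + w ≤ m
    · refine ⟨x.val + l * m + m, m * (l + n + 2) - w - (x.val + l * m + m), by omega, by omega,
        by omega, key _ ?_ (by omega)⟩
      simp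
    · refine ⟨x.val + l * m, m * (l + n + 2) - w - (x.val + l * m), by omega, by omega,
        by omega, key _ ?_ (by omega)⟩
      simp
  · obtain rfl : k₁ = 1 := by omega
    obtain rfl : k₂ = q + 2 := by omega
    have e2 : (q + 2) * m = m * q + 2 * m := by ring
    refine ⟨x.val, m * (q + 2) - w - x.val, by omega, by omega, by omega, key _ ?_ (by omega)⟩
    simp

lemma IsTwoValued.zeroSumFree {P : ℕ} {F : Finset ι} {v : ι → ZMod m} (h : IsTwoValued P F v) :
    ZeroSumFree P F v := by
  obtain ⟨a, b, k₁, k₂, hab, hk₁, hk₂, hk, h₁, h₂, hall⟩ := h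
  intro T hT hTc hT0
  by_cases hm : m = 1
  · subst hm
    have h3 := card_filter_add_card_filter_not (s := F) (fun i => v i = a)
    have h4 : {i ∈ F | v i = a} = {i ∈ F | v i = b} := filter_congr fun i _ => by
      rw [Subsingleton.elim a b]
    have h5 : {i ∈ F | v i = a} = F := filter_true_of_mem fun i _ => Subsingleton.elim _ _
    rw [← h4, h5] at h₂
    rw [h5] at h₁
    have := card_le_card hT
    omega
  have hne : a ≠ b := by
    rintro rfl
    rw [sub_self, isUnit_zero_iff] at hab
    have := NeZero.pos m
    have : Fact (1 < m) := ⟨by omega⟩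
    exact zero_ne_one hab
  have h3 := card_filter_add_card_filter_not (s := T) (fun i => v i = a)
  have h4 : {i ∈ T | ¬ v i = a} ⊆ {i ∈ F | v i = b} := fun i hi => by
    rw [mem_filter] at hi ⊢
    exact ⟨hT hi.1, (hall i (hT hi.1)).resolve_left hi.2⟩
  have h5 := card_le_card h4
  have h6 : #{i ∈ T | v i = a} ≤ #{i ∈ F | v i = a} := card_le_card (filter_subset_filter _ hT)
  have h7 : ∑ i ∈ T, v i = (#{i ∈ T | v i = a} : ZMod m) * (a - b) + (#T : ZMod m) * b := by
    rw [← sum_filter_add_sum_filter_not T (fun i => v i = a),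
      sum_congr rfl (fun i hi => (mem_filter.1 hi).2), sum_const, nsmul_eq_mul,
      sum_congr (s₁ := {i ∈ T | ¬ v i = a}) rfl (fun i hi => (mem_filter.1 (h4 hi)).2), sum_const,
      nsmul_eq_mul, ← h3]
    push_cast
    ring
  rw [hT0, hTc] at h7
  -- The multiplicity of a in T is a multiple of m, hence at most (k₁ - 1)m. That of b is then at
  -- most (k₂ - 1)m, and together they fall short of mP.
  have h8 : ((#{i ∈ T | v i = a} : ℕ) : ZMod m) = 0 := by
    apply hab.mul_left_eq_zero.1
    rw [h7]
    simp
  obtain ⟨u, hu⟩ := (ZMod.natCast_eq_zero_iff _ _).1 h8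
  have h9 : m * u < m * k₁ := by rw [mul_comm m k₁]; omega
  have h10 := Nat.lt_of_mul_lt_mul_left h9
  have h11 : m * (u + 1) ≤ m * k₁ := Nat.mul_le_mul_left _ h10
  have h12 : m * (k₁ + k₂) = m * P + m := by rw [hk]; ring
  rw [mul_add] at h11 h12
  rw [mul_comm k₂] at h₂
  omega

/-- The value of a product of inner terms. -/
lemma IsWeight.seqValue_of_inner (hω : IsWeight ω) {l : List ι} (hl : ∀ i ∈ l, (el i).1 = 0) :
    seqClass el l = 0 ∧ seqValue ω el l = (l.map fun i => (el i).2).sum := by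
  induction l with
  | nil => simp
  | cons i l ih =>
    obtain ⟨h1, h2⟩ := ih fun k hk => hl k (List.mem_cons_of_mem _ hk)
    rw [seqClass_cons, h1, hl i List.mem_cons_self, seqValue_cons, h1, h2, hω.map_zero]
    simp

/-- Removing trivial terms does not change a product. -/
lemma seqValue_filter (ω : ZMod p → ZMod m) {l : List ι}
    (hl : ∀ i ∈ l, (el i).1 = 0 → (el i).2 = 0) :
    seqClass el (l.filter fun i => (el i).1 ≠ 0) = seqClass el l ∧
      seqValue ω el (l.filter fun i => (el i).1 ≠ 0) = seqValue ω el l := by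
  induction l with
  | nil => simp
  | cons i l ih =>
    obtain ⟨h1, h2⟩ := ih fun k hk => hl k (List.mem_cons_of_mem _ hk)
    by_cases h : (el i).1 = 0
    · rw [List.filter_cons_of_neg (by simpa using h), h1, h2, seqClass_cons, seqValue_cons, h,
        hl i List.mem_cons_self h]
      simp
    · rw [List.filter_cons_of_pos (by simpa using h), seqClass_cons, seqClass_cons, seqValue_cons,
        seqValue_cons, h1, h2]
      simp

/-- Between 1 and p - 1 terms of one nonzero class never have total class 0, so a product-one
subfamily would be inner, and the inner terms are zero-sum free. -/
theorem IsGenericFamily.productOneFree (hω : IsWeight ω) {F : Finset ι}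
    (h : IsGenericFamily el F) : ProductOneFree ω el F (m * p) := by
  obtain ⟨hO, ⟨a, ha, hcl⟩, htwo⟩ := h
  rintro T hT hTc ⟨l, hnd, hlT, hl0, hlv, -⟩
  rw [seqClass_eq_sum hnd, hlT] at hl0
  have h1 : ∑ i ∈ T, (el i).1 = (#{i ∈ T | (el i).1 ≠ 0} : ZMod p) * a := by
    rw [← sum_filter_ne_zero, sum_congr rfl (fun i hi => hcl i (hT (mem_filter.1 hi).1)
      (mem_filter.1 hi).2), sum_const, nsmul_eq_mul]
  rw [hl0] at h1
  have h2 : ((#{i ∈ T | (el i).1 ≠ 0} : ℕ) : ZMod p) = 0 :=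
    (mul_eq_zero.1 h1.symm).resolve_right ha
  have h3 : #{i ∈ T | (el i).1 ≠ 0} ≤ #{i ∈ F | (el i).1 ≠ 0} :=
    card_le_card (filter_subset_filter _ hT)
  have h4 := Nat.eq_zero_of_dvd_of_lt ((ZMod.natCast_eq_zero_iff _ _).1 h2) (by omega)
  have h5 : ∀ i ∈ T, (el i).1 = 0 := by
    rw [card_eq_zero, filter_eq_empty_iff] at h4
    exact fun i hi => not_not.1 (h4 hi)
  refine htwo.zeroSumFree T (fun i hi => mem_filter.2 ⟨hT hi, h5 i hi⟩) hTc ?_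
  rw [(hω.seqValue_of_inner fun i hi => h5 i (by rw [← hlT]; exact List.mem_toFinset.2 hi)).2]
    at hlv
  rw [← hlv, ← hlT, List.sum_toFinset _ hnd]

lemma ZMod.natCast_two_eq_zero_iff (n : ℕ) : (n : ZMod 2) = 0 ↔ n % 2 = 0 := by
  rw [ZMod.natCast_eq_zero_iff, Nat.dvd_iff_mod_eq_zero]

/-- Six of the eight terms include an outer one, and class 0 requires an even number, so exactly
two. As the nontrivial weight is -1, their product is a difference of distinct values. -/
theorem IsExceptionalFamily.productOneFree (hω : IsWeight ω) {F : Finset ι} (hF : #F = 8)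
    (h : IsExceptionalFamily el F) : ProductOneFree ω el F (m * p) := by
  obtain ⟨hp2, hm3, hO, hinj, h0⟩ := h
  rintro T hT hTc ⟨l, hnd, hlT, hl0, hlv, -⟩
  have hmp : m * p = 6 := by rw [hp2, hm3]
  have hmem : ∀ i ∈ l, i ∈ T := fun i hi => by rw [← hlT]; exact List.mem_toFinset.2 hi
  obtain ⟨h1, h2⟩ := seqValue_filter ω (l := l) fun i hi => h0 i (hT (hmem i hi))
  rw [hl0] at h1
  rw [hlv] at h2
  have hnd' := hnd.filter (p := fun i => decide ((el i).1 ≠ 0))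
  set l' := l.filter fun i => decide ((el i).1 ≠ 0) with hl'
  have hT' : l'.toFinset = {i ∈ T | (el i).1 ≠ 0} := by
    rw [hl', List.toFinset_filter, hlT]
    simp
  have hlen : l'.length = #{i ∈ T | (el i).1 ≠ 0} := by
    rw [← hT', List.toFinset_card_of_nodup hnd']
  have hsub : {i ∈ T | (el i).1 ≠ 0} ⊆ {i ∈ F | (el i).1 ≠ 0} := filter_subset_filter _ hT
  have hout : ∀ i ∈ l', i ∈ ({i ∈ F | (el i).1 ≠ 0} : Finset ι) := fun i hi =>
    hsub (by rw [← hT']; exact List.mem_toFinset.2 hi)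
  have h3 := card_le_card hsub
  have h4 := card_filter_add_card_filter_not (s := F) (fun i => (el i).1 = 0)
  have h5 := card_filter_add_card_filter_not (s := T) (fun i => (el i).1 = 0)
  have h6 : #{i ∈ T | (el i).1 = 0} ≤ #{i ∈ F | (el i).1 = 0} :=
    card_le_card (filter_subset_filter _ hT)
  have hpar : #{i ∈ T | (el i).1 ≠ 0} % 2 = 0 := by
    rw [seqClass_eq_sum hnd', hT', sum_congr rfl (g := fun _ => (1 : ZMod p)) (fun i hi => by
      have h7 := (mem_filter.1 hi).2
      subst hp2
      exact ZMod.eq_of_ne_zero_of_ne_zero _ _ h7 one_ne_zero), sum_const, nsmul_eq_mul,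
      mul_one] at h1
    subst hp2
    exact (ZMod.natCast_two_eq_zero_iff _).1 h1
  have hlen2 : l'.length = 2 := by
    simp only [ne_eq] at hO hlen h3 h4 h5 h6 hpar ⊢
    omega
  obtain ⟨i, k, hik⟩ := List.length_eq_two.1 hlen2
  rw [hik] at h2 hout hnd'
  have hi := hout i (by simp)
  have hk := hout k (by simp)
  have hik : i ≠ k := by simpa using hnd'
  rw [seqValue_cons, seqValue_cons, seqValue_nil, seqClass_nil, seqClass_cons, seqClass_nil,
    add_zero, add_zero, hω.map_zero, one_mul] at h2
  have hk0 := (mem_filter.1 hk).2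
  have hneg : ω (el k).1 = -1 := by
    have h7 : (ω (el k).1 - 1) * (ω (el k).1 + 1) = 0 := by
      have : (el k).1 + (el k).1 = 0 := by
        clear * - hp2
        subst hp2
        exact CharTwo.add_self_eq_zero _
      have h8 := hω.map_add (el k).1 (el k).1
      rw [this, hω.map_zero] at h8
      linear_combination -h8
    exact eq_neg_of_add_eq_zero_left ((hω.isUnit_sub_one _ hk0).mul_right_eq_zero.1 h7)
  rw [hneg] at h2
  exact hik (hinj hi hk (by
    change (el i).2 = (el k).2
    linear_combination -h2))

namespace IsWeight

variable (hω : IsWeight ω)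
include hω

/-- The product-one free families of length `m * p + m + p - 3`. -/
theorem isGenericFamily_or_isExceptionalFamily (hm : 2 ≤ m) {F : Finset ι}
    (hF : #F + 3 = m * p + m + p) (hfree : ProductOneFree ω el F (m * p)) :
    IsGenericFamily el F ∨ IsExceptionalFamily el F := by
  have hp2 := hp.out.two_le
  obtain ⟨β, hmβ⟩ := hω.exists_modulus_eq
  have hβ : 1 ≤ β := by
    by_contra h
    obtain rfl : β = 0 := by omega
    omega
  have hmp : p * 1 ≤ p * β := Nat.mul_le_mul_left _ hβ
  have hcardF : #{i ∈ F | (el i).1 = 0} + #{i ∈ F | (el i).1 ≠ 0} = #F :=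
    card_filter_add_card_filter_not _
  have hIF : {i ∈ F | (el i).1 = 0} ⊆ F := filter_subset _ _
  have hI0 : ∀ i ∈ ({i ∈ F | (el i).1 = 0} : Finset ι), (el i).1 = 0 :=
    fun i hi => (mem_filter.1 hi).2
  -- Fewer than p - 1 outer terms would leave at least mp + m - 1 inner ones, enough for EGZ in ℤ/m.
  have hN1 : p ≤ #{i ∈ F | (el i).1 ≠ 0} + 1 := by
    by_contra h
    have := hω.card_inner_subgroup hfree ⊤ hIF hI0 (fun _ _ => AddSubgroup.mem_top _)
    rw [AddSubgroup.card_top, Nat.card_zmod] at this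
    omega
  rcases Nat.lt_or_ge #{i ∈ F | (el i).1 ≠ 0} p with hN | hN
  · left
    have hO : #{i ∈ F | (el i).1 ≠ 0} + 1 = p := by omega
    have htwo : IsTwoValued p {i ∈ F | (el i).1 = 0} (fun i => (el i).2) := by
      refine ZMod.isTwoValued hm hω.odd_modulus (by omega) (by omega) fun T hT hTc hT0 => ?_
      have h1 := hω.realizes_inner (el := el) realizes_empty T (fun _ => 0)
        (fun i hi => hI0 i (hT hi)) (disjoint_empty_left _) (fun _ _ => Or.inl rfl)
      simp only [hω.map_zero, one_mul, hT0, add_zero, empty_union] at h1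
      exact hω.not_realizes hfree (hT.trans hIF) hTc h1
    refine ⟨hO, ?_, htwo⟩
    obtain ⟨i₀, hi₀⟩ : ({i ∈ F | (el i).1 ≠ 0} : Finset ι).Nonempty := by
      rw [← card_pos]; omega
    refine ⟨(el i₀).1, (mem_filter.1 hi₀).2, fun i hi hi0 => ?_⟩
    refine ZMod.eq_of_zero_sum_free (c := fun i => (el i).1) hO ?_ (mem_filter.2 ⟨hi, hi0⟩) hi₀
    intro W hW hWne hW0
    have hWc := card_le_card hW
    -- A class-zero set W has between 1 and p - 1 < m terms; `exists_two_valued_count` completes it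
    -- by inner terms to a product-one family of length mp.
    obtain ⟨g, hg⟩ := exists_realizes' (ω := ω) hW0
    obtain ⟨a, b, k₁, k₂, hab, hk₁, hk₂, hk, h₁, h₂, hall⟩ := htwo
    beta_reduce at h₁ h₂
    have : Fact (1 < m) := ⟨by omega⟩
    obtain ⟨u, v, huv, hu, hv, h0⟩ := exists_two_valued_count (g := g) hab hk₁ hk₂ hk
      (Nat.one_le_iff_ne_zero.2 hWne.card_pos.ne') (by omega)
    obtain ⟨A, hA, hAc⟩ := exists_subset_card_eq
      (s := {i ∈ {i ∈ F | (el i).1 = 0} | (el i).2 = a}) (n := u) (by omega)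
    obtain ⟨B, hB, hBc⟩ := exists_subset_card_eq
      (s := {i ∈ {i ∈ F | (el i).1 = 0} | (el i).2 = b}) (n := v) (by omega)
    have hAI := hA.trans (filter_subset _ _)
    have hBI := hB.trans (filter_subset _ _)
    have hne : a ≠ b := by
      rintro rfl
      rw [sub_self, isUnit_zero_iff] at hab
      exact zero_ne_one hab
    have hdAB : Disjoint A B := by
      rw [disjoint_left]
      exact fun i h h' => hne ((mem_filter.1 (hA h)).2.symm.trans (mem_filter.1 (hB h')).2)
    have hABI : A ∪ B ⊆ {i ∈ F | (el i).1 = 0} := union_subset hAI hBI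
    have hdW : Disjoint W (A ∪ B) := by
      rw [disjoint_left]
      exact fun i h h' => (mem_filter.1 (hW h)).2 (hI0 i (hABI h'))
    have h3 := hω.realizes_inner hg (A ∪ B) (fun _ => 0) (fun i hi => hI0 i (hABI hi)) hdW
      (fun _ _ => Or.inl rfl)
    have h4 : g + ∑ k ∈ A ∪ B, ω 0 * (el k).2 = 0 := by
      simp only [hω.map_zero, one_mul]
      rw [sum_union hdAB, sum_congr rfl (fun i hi => (mem_filter.1 (hA hi)).2),
        sum_congr (s₁ := B) rfl (fun i hi => (mem_filter.1 (hB hi)).2), sum_const, sum_const, hAc,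
        hBc, nsmul_eq_mul, nsmul_eq_mul, h0]
    rw [h4] at h3
    refine hω.not_realizes hfree
      (union_subset (hW.trans (filter_subset _ _)) (hABI.trans hIF)) ?_ h3
    rw [card_union_of_disjoint hdW, card_union_of_disjoint hdAB, hAc, hBc, ← huv, add_assoc]
  · right
    obtain ⟨d, hd0, hd⟩ : ∃ d, d ≠ 0 ∧ p ≤ #{i ∈ F | (el i).1 = d} := by
      by_cases hp' : p = 2
      · refine ⟨1, one_ne_zero, hN.trans (card_le_card fun i hi => ?_)⟩
        rw [mem_filter] at hi ⊢
        refine ⟨hi.1, ?_⟩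
        have := hi.2
        clear * - this hp'
        subst hp'
        exact ZMod.eq_of_ne_zero_of_ne_zero _ _ this one_ne_zero
      · exact hω.exists_le_card_class hmβ hβ hF hfree hp' hN
    obtain ⟨h1, h2, h3, h4, h5⟩ := hω.exceptional_of_block hmβ hβ hF hfree hd0 hd
    exact ⟨h1, by rw [hmβ, h1, h2], h3, h4, h5⟩

/-- Families of length `m * p + m + p - 2` are not product-one free. -/
theorem not_productOneFree (hm : 2 ≤ m) {F : Finset ι} (hF : #F + 2 = m * p + m + p) :
    ¬ ProductOneFree ω el F (m * p) := by
  intro hfree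
  have hp2 := hp.out.two_le
  have hmp : 2 * 2 ≤ m * p := Nat.mul_le_mul hm hp2
  -- Deleting an inner or an outer term leaves outer counts differing by one. Each must be p - 1, or
  -- 3 when p = 2, and such numbers never differ by one.
  have key : ∀ i ∈ F, #{k ∈ F.erase i | (el k).1 ≠ 0} + 1 = p ∨
      p = 2 ∧ m = 3 ∧ #{k ∈ F.erase i | (el k).1 ≠ 0} = 3 := by
    intro i hi
    have h1 := card_erase_add_one hi
    rcases hω.isGenericFamily_or_isExceptionalFamily hm (F := F.erase i) (by omega)
      (fun T hT => hfree T (hT.trans (erase_subset _ _))) with h | h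
    · exact Or.inl h.1
    · exact Or.inr ⟨h.1, h.2.1, h.2.2.1⟩
  have hO : ∀ i ∈ F, (el i).1 ≠ 0 →
      #{k ∈ F.erase i | (el k).1 ≠ 0} + 1 = #{k ∈ F | (el k).1 ≠ 0} := fun i hi h => by
    rw [filter_erase, card_erase_add_one (mem_filter.2 ⟨hi, h⟩)]
  have hI : ∀ i ∈ F, (el i).1 = 0 →
      #{k ∈ F.erase i | (el k).1 ≠ 0} = #{k ∈ F | (el k).1 ≠ 0} := fun i hi h => by
    rw [filter_erase, erase_eq_of_notMem]
    exact fun h' => (mem_filter.1 h').2 h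
  obtain ⟨i, hi⟩ : F.Nonempty := by rw [← card_pos]; omega
  have hcardF : #{i ∈ F | (el i).1 = 0} + #{i ∈ F | (el i).1 ≠ 0} = #F :=
    card_filter_add_card_filter_not _
  have hle : #{k ∈ F | (el k).1 ≠ 0} ≤ #{k ∈ F.erase i | (el k).1 ≠ 0} + 1 := by
    by_cases h : (el i).1 = 0
    · rw [hI i hi h]; omega
    · rw [hO i hi h]
  have hge : #{k ∈ F.erase i | (el k).1 ≠ 0} ≤ #{k ∈ F | (el k).1 ≠ 0} :=
    card_le_card (filter_subset_filter _ (erase_subset _ _))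
  have h0 := key i hi
  obtain ⟨i₁, hi₁⟩ : ({i ∈ F | (el i).1 = 0} : Finset ι).Nonempty := by
    rw [← card_pos]
    rcases h0 with h | ⟨h1, h2, h3⟩
    · omega
    · have : m * p = 6 := by rw [h1, h2]
      omega
  obtain ⟨i₂, hi₂⟩ : ({i ∈ F | (el i).1 ≠ 0} : Finset ι).Nonempty := by
    rw [← card_pos]
    omega
  rw [mem_filter] at hi₁ hi₂
  have h1 := key i₁ hi₁.1
  have h2 := key i₂ hi₂.1
  rw [hI i₁ hi₁.1 hi₁.2] at h1
  have h3 := hO i₂ hi₂.1 hi₂.2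
  omega

end IsWeight

end ModelStructure

/-! ### Normal forms and coordinates in the metacyclic group. -/

section NormalForm

variable {H : Type*} [Group H] {a b : H} {r : ℤ}

lemma zpow_mul_pow_of_conj (h : a⁻¹ * b * a = b ^ r) (j : ℤ) (i : ℕ) :
    b ^ j * a ^ i = a ^ i * b ^ (r ^ i * j) := by
  have h1 : ∀ j : ℤ, b ^ j * a = a * b ^ (r * j) := by
    intro j
    rw [zpow_mul, ← h]
    have := conj_zpow (a := a⁻¹) (b := b) (i := j)
    rw [inv_inv] at this
    rw [this]
    group
  induction i with
  | zero => simp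
  | succ i ih =>
    rw [pow_succ a, ← mul_assoc, ih, mul_assoc, h1, mul_assoc]
    congr 3
    ring

/-- Powers of b move past nonnegative powers of a; inverses stay within reach because a⁻¹ = a^(p -
1). -/
lemma exists_eq_pow_mul_zpow {p : ℕ} (hp : 1 ≤ p) (ha : a ^ p = 1) (h : a⁻¹ * b * a = b ^ r) {g : H}
    (hg : g ∈ Subgroup.closure {a, b}) : ∃ (i : ℕ) (j : ℤ), g = a ^ i * b ^ j := by
  have hmul : ∀ (i k : ℕ) (j l : ℤ), ∃ (n : ℕ) (t : ℤ),
      a ^ i * b ^ j * (a ^ k * b ^ l) = a ^ n * b ^ t := by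
    intro i k j l
    refine ⟨i + k, r ^ k * j + l, ?_⟩
    rw [mul_assoc, ← mul_assoc (b ^ j), zpow_mul_pow_of_conj h, mul_assoc, ← zpow_add, ← mul_assoc,
      ← pow_add]
  induction hg using Subgroup.closure_induction with
  | mem c hc =>
    rcases hc with rfl | rfl
    · exact ⟨1, 0, by simp⟩
    · exact ⟨0, 1, by simp⟩
  | one => exact ⟨0, 0, by simp⟩
  | mul _ _ _ _ h1 h2 =>
    obtain ⟨i, j, rfl⟩ := h1
    obtain ⟨k, l, rfl⟩ := h2
    exact hmul i k j l
  | inv _ _ h1 =>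
    obtain ⟨i, j, rfl⟩ := h1
    have h2 : a⁻¹ = a ^ (p - 1) := by
      rw [inv_eq_iff_mul_eq_one, ← pow_succ', Nat.sub_add_cancel hp, ha]
    have h3 : (a ^ i * b ^ j)⁻¹ = a ^ 0 * b ^ (-j) * (a ^ ((p - 1) * i) * b ^ (0 : ℤ)) := by
      rw [mul_inv_rev, ← zpow_neg, ← inv_pow, h2, ← pow_mul]
      simp
    rw [h3]
    exact hmul _ _ _ _

lemma zpow_eq_pow_val {m : ℕ} [NeZero m] (hb : b ^ m = 1) (j : ℤ) :
    b ^ j = b ^ (j : ZMod m).val := by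
  rw [← zpow_natCast b, ZMod.val_intCast]
  conv_lhs => rw [← Int.mul_ediv_add_emod j m]
  rw [zpow_add, zpow_mul, zpow_natCast, hb, one_zpow, one_mul]

end NormalForm

namespace MetacyclicGroup

section Coordinates

variable {p m : ℕ} {r : ℤ}

lemma x_pow : x p m r ^ p = 1 :=
  PresentedGroup.one_of_mem (rels := {FreeGroup.of false ^ p, FreeGroup.of true ^ m,
    (FreeGroup.of false)⁻¹ * FreeGroup.of true * FreeGroup.of false * (FreeGroup.of true ^ r)⁻¹})
    (by simp)

lemma y_pow : y p m r ^ m = 1 :=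
  PresentedGroup.one_of_mem (rels := {FreeGroup.of false ^ p, FreeGroup.of true ^ m,
    (FreeGroup.of false)⁻¹ * FreeGroup.of true * FreeGroup.of false * (FreeGroup.of true ^ r)⁻¹})
    (by simp)

lemma conj_y : (x p m r)⁻¹ * y p m r * x p m r = y p m r ^ r := by
  have h : (x p m r)⁻¹ * y p m r * x p m r * (y p m r ^ r)⁻¹ = 1 :=
    PresentedGroup.one_of_mem (rels := {FreeGroup.of false ^ p, FreeGroup.of true ^ m,
      (FreeGroup.of false)⁻¹ * FreeGroup.of true * FreeGroup.of false * (FreeGroup.of true ^ r)⁻¹})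
      (by simp)
  exact mul_inv_eq_one.1 h

/-- Homomorphisms from the metacyclic group. -/
def lift {H : Type*} [Group H] (a b : H) (ha : a ^ p = 1) (hb : b ^ m = 1)
    (hab : a⁻¹ * b * a = b ^ r) : MetacyclicGroup p m r →* H :=
  PresentedGroup.toGroup (f := fun i => cond i b a) (by
    rintro w (rfl | rfl | rfl)
    · simpa using ha
    · simpa using hb
    · simpa [mul_inv_eq_one] using hab)

lemma lift_x {H : Type*} [Group H] {a b : H} (ha : a ^ p = 1) (hb : b ^ m = 1)
    (hab : a⁻¹ * b * a = b ^ r) : lift a b ha hb hab (x p m r) = a :=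
  PresentedGroup.toGroup.of _

lemma lift_y {H : Type*} [Group H] {a b : H} (ha : a ^ p = 1) (hb : b ^ m = 1)
    (hab : a⁻¹ * b * a = b ^ r) : lift a b ha hb hab (y p m r) = b :=
  PresentedGroup.toGroup.of _

lemma exists_eq_x_pow_mul_y_zpow (hp : 1 ≤ p) (g : MetacyclicGroup p m r) :
    ∃ (i : ℕ) (j : ℤ), g = x p m r ^ i * y p m r ^ j := by
  refine exists_eq_pow_mul_zpow hp x_pow conj_y ?_
  have h : Set.range (PresentedGroup.of : Bool → MetacyclicGroup p m r) ⊆ {x p m r, y p m r} := by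
    rintro _ ⟨b, rfl⟩
    cases b
    · exact Or.inl rfl
    · exact Or.inr rfl
  refine Subgroup.closure_mono h ?_
  rw [PresentedGroup.closure_range_of]
  trivial

/-- The action of `y` by conjugation with the powers of `x`. -/
def weight (p m : ℕ) (r : ℤ) (a : ZMod p) : ZMod m := (r : ZMod m) ^ a.val

variable [hp : Fact p.Prime] [NeZero m]

/-- For a ≠ 0, r is itself a power of ω(a), so ω(a) - 1 divides the unit r - 1. -/
lemma isWeight_weight (hr : (r : ZMod m) ^ p = 1) (hr' : IsUnit ((r : ZMod m) - 1)) :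
    IsWeight (weight p m r) := by
  have hmod : ∀ n : ℕ, weight p m r n = (r : ZMod m) ^ n := fun n => by
    rw [weight, ZMod.val_natCast, ← pow_eq_pow_mod n hr]
  refine ⟨by simp [weight], fun a b => ?_, fun a ha => ?_⟩
  · have := hmod (a.val + b.val)
    rw [Nat.cast_add, ZMod.natCast_zmod_val, ZMod.natCast_zmod_val, pow_add] at this
    exact this
  · have h1 : weight p m r a ^ (a⁻¹).val = r := by
      have := hmod (a.val * (a⁻¹).val)
      rw [Nat.cast_mul, ZMod.natCast_zmod_val, ZMod.natCast_zmod_val, mul_inv_cancel₀ ha, pow_mul]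
        at this
      rw [weight, ← this, ← Nat.cast_one, hmod, pow_one]
    have h2 := sub_dvd_pow_sub_pow (weight p m r a) 1 (a⁻¹).val
    rw [h1, one_pow] at h2
    exact isUnit_of_dvd_unit h2 hr'

/-- The action of the powers of `x` on coordinates. -/
def shiftX (p m : ℕ) : Multiplicative (ZMod p) →* Equiv.Perm (ZMod p × ZMod m) where
  toFun z :=
    { toFun := fun v => (z.toAdd + v.1, v.2)
      invFun := fun v => (-z.toAdd + v.1, v.2)
      left_inv := fun v => by simp
      right_inv := fun v => by simp }
  map_one' := by ext <;> simp
  map_mul' z w := by ext <;> simp [add_assoc]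

/-- The action of the powers of `y` on coordinates. -/
def shiftY (ω : ZMod p → ZMod m) : Multiplicative (ZMod m) →* Equiv.Perm (ZMod p × ZMod m) where
  toFun z :=
    { toFun := fun v => (v.1, ω v.1 * z.toAdd + v.2)
      invFun := fun v => (v.1, -(ω v.1 * z.toAdd) + v.2)
      left_inv := fun v => by simp
      right_inv := fun v => by simp }
  map_one' := by ext <;> simp
  map_mul' z w := by ext <;> simp [mul_add, add_assoc]

/-- The action of the metacyclic group on coordinates. -/
def action (hr : (r : ZMod m) ^ p = 1) (hr' : IsUnit ((r : ZMod m) - 1)) :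
    MetacyclicGroup p m r →* Equiv.Perm (ZMod p × ZMod m) :=
  lift (shiftX p m (Multiplicative.ofAdd 1)) (shiftY (weight p m r) (Multiplicative.ofAdd 1))
    (by
      rw [← map_pow, ← ofAdd_nsmul, nsmul_one, CharP.cast_eq_zero, ofAdd_zero, map_one])
    (by
      rw [← map_pow, ← ofAdd_nsmul, nsmul_one, CharP.cast_eq_zero, ofAdd_zero, map_one])
    (by
      rw [mul_assoc, inv_mul_eq_iff_eq_mul, ← map_zpow, ← ofAdd_zsmul, zsmul_one]
      ext v
      · rfl
      · have h1 := (isWeight_weight hr hr').map_add 1 v.1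
        have h2 : weight p m r 1 = r := by
          have := hp.out.one_lt
          have : Fact (1 < p) := ⟨this⟩
          rw [weight, ZMod.val_one, pow_one]
        change weight p m r (1 + v.1) * 1 + v.2 = weight p m r v.1 * (r : ZMod m) + v.2
        rw [h1, h2]
        ring)

/-- The coordinates of an element. -/
def coords (hr : (r : ZMod m) ^ p = 1) (hr' : IsUnit ((r : ZMod m) - 1))
    (g : MetacyclicGroup p m r) : ZMod p × ZMod m := action hr hr' g (0, 0)

variable (hr : (r : ZMod m) ^ p = 1) (hr' : IsUnit ((r : ZMod m) - 1))

/-- This is left multiplication on normal forms. The action makes coordinates well defined on the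
presented group and separates its mp normal forms. -/
lemma action_apply (i : ℕ) (j : ℤ) (v : ZMod p × ZMod m) :
    action hr hr' (x p m r ^ i * y p m r ^ j) v = (i + v.1, weight p m r v.1 * j + v.2) := by
  rw [map_mul, map_pow, map_zpow, action, lift_x, lift_y, ← map_pow, ← map_zpow, ← ofAdd_nsmul,
    ← ofAdd_zsmul, nsmul_one, zsmul_one]
  rfl

lemma coords_x_pow_mul_y_zpow (i : ℕ) (j : ℤ) :
    coords hr hr' (x p m r ^ i * y p m r ^ j) = ((i : ZMod p), (j : ZMod m)) := by
  rw [coords, action_apply, (isWeight_weight hr hr').map_zero]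
  simp

lemma coords_x_pow_mul_y_pow (i j : ℕ) :
    coords hr hr' (x p m r ^ i * y p m r ^ j) = ((i : ZMod p), (j : ZMod m)) := by
  have := coords_x_pow_mul_y_zpow hr hr' i j
  rwa [zpow_natCast, Int.cast_natCast] at this

lemma coords_y_pow (j : ℕ) : coords hr hr' (y p m r ^ j) = (0, (j : ZMod m)) := by
  have := coords_x_pow_mul_y_pow hr hr' 0 j
  rwa [pow_zero, one_mul, Nat.cast_zero] at this

lemma coords_one : coords hr hr' 1 = 0 := by
  have := coords_y_pow hr hr' 0
  rwa [pow_zero, Nat.cast_zero] at this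

lemma coords_mul (g h : MetacyclicGroup p m r) : coords hr hr' (g * h) =
    ((coords hr hr' g).1 + (coords hr hr' h).1,
      weight p m r (coords hr hr' h).1 * (coords hr hr' g).2 + (coords hr hr' h).2) := by
  obtain ⟨i, j, rfl⟩ := exists_eq_x_pow_mul_y_zpow hp.out.one_lt.le g
  rw [coords_x_pow_mul_y_zpow, coords, map_mul, Equiv.Perm.mul_apply, action_apply]
  rfl

lemma x_pow_mul_y_pow_coords (g : MetacyclicGroup p m r) :
    g = x p m r ^ (coords hr hr' g).1.val * y p m r ^ (coords hr hr' g).2.val := by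
  obtain ⟨i, j, rfl⟩ := exists_eq_x_pow_mul_y_zpow hp.out.one_lt.le g
  rw [coords_x_pow_mul_y_zpow, ZMod.val_natCast, ← pow_eq_pow_mod i x_pow]
  congr 1
  exact zpow_eq_pow_val y_pow j

lemma coords_injective : Function.Injective (coords (p := p) (m := m) hr hr') := by
  intro g h hgh
  rw [x_pow_mul_y_pow_coords hr hr' g, hgh, ← x_pow_mul_y_pow_coords hr hr' h]

lemma coords_surjective : Function.Surjective (coords (p := p) (m := m) hr hr') := by
  intro v
  refine ⟨x p m r ^ v.1.val * y p m r ^ v.2.val, ?_⟩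
  rw [coords_x_pow_mul_y_pow, ZMod.natCast_zmod_val, ZMod.natCast_zmod_val]

include hr hr' in
lemma natCard : Nat.card (MetacyclicGroup p m r) = m * p := by
  rw [Nat.card_congr (Equiv.ofBijective _ ⟨coords_injective hr hr', coords_surjective hr hr'⟩),
    Nat.card_prod, Nat.card_zmod, Nat.card_zmod, mul_comm]

variable {ι : Type*} [DecidableEq ι]

lemma coords_prod (s : ι → MetacyclicGroup p m r) (l : List ι) :
    coords hr hr' (l.map s).prod = (seqClass (fun i => coords hr hr' (s i)) l,
      seqValue (weight p m r) (fun i => coords hr hr' (s i)) l) := by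
  induction l with
  | nil => exact coords_one hr hr'
  | cons i l ih =>
    rw [List.map_cons, List.prod_cons, coords_mul, ih, seqClass_cons, seqValue_cons]

/-- Product-one subsequences in terms of coordinates. -/
lemma isCardProductOneFree_iff (s : ι → MetacyclicGroup p m r) (F : Finset ι) :
    IsCardProductOneFree (F.val.map s) ↔
      ProductOneFree (weight p m r) (fun i => coords hr hr' (s i)) F (m * p) := by
  rw [IsCardProductOneFree, natCard hr hr', ← not_iff_not, not_not]
  constructor
  · rintro ⟨T, hT, hTc, l, rfl, hl⟩ hfree
    -- A subsequence is lifted to a sublist of indices and its ordering to a permutation of that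
    -- sublist, so repeated group elements become distinct indices.
    rw [← Finset.coe_toList F, Multiset.map_coe, Multiset.coe_le] at hT
    obtain ⟨l₁, hl₁, hl₁s⟩ := hT
    obtain ⟨l₂, hl₂, rfl⟩ := List.sublist_map_iff.1 hl₁s
    obtain ⟨l₃, rfl, hl₃⟩ : ∃ l₃ : List ι, l = l₃.map s ∧ l₃.Perm l₂ := by
      have h1 : Relation.Comp (· = List.map s ·) List.Perm l l₂ := by
        rw [List.eq_map_comp_perm]
        exact hl₁.symm
      exact h1
    have hnd : l₃.Nodup := hl₃.nodup_iff.2 (hl₂.nodup (nodup_toList F))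
    have h1 := coords_prod hr hr' s l₃
    rw [hl, coords_one] at h1
    refine hfree l₃.toFinset ?_ ?_ ⟨l₃, hnd, rfl, (congrArg Prod.fst h1).symm,
      (congrArg Prod.snd h1).symm, by simp⟩
    · intro i hi
      rw [List.mem_toFinset, hl₃.mem_iff] at hi
      exact mem_toList.1 (hl₂.subset hi)
    · rw [List.toFinset_card_of_nodup hnd]
      simpa using hTc
  · intro h
    simp only [ProductOneFree, not_forall, not_not] at h
    obtain ⟨T, hT, hTc, l, hnd, rfl, h1, h2, -⟩ := h
    refine ⟨(l.map s : List _), ?_, ?_, l.map s, rfl, ?_⟩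
    · rw [← Multiset.map_coe]
      refine Multiset.map_le_map ((Multiset.le_iff_subset (by simpa using hnd)).2 fun i hi => ?_)
      exact hT (List.mem_toFinset.2 (by simpa using hi))
    · rw [List.toFinset_card_of_nodup hnd] at hTc
      simpa using hTc
    · apply coords_injective hr hr'
      rw [coords_prod, coords_one, h1, h2]
      rfl

end Coordinates

end MetacyclicGroup

lemma Multiset.exists_map_fin_eq {α : Type*} {S : Multiset α} {n : ℕ} (hn : S.card = n) :
    ∃ s : Fin n → α, (univ : Finset (Fin n)).val.map s = S := by
  rw [← Multiset.length_toList] at hn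
  subst hn
  refine ⟨S.toList.get, ?_⟩
  rw [Fin.univ_val_map, List.ofFn_get, Multiset.coe_toList]

lemma Finset.card_filter_eq_countP {ι α : Type*} (F : Finset ι) (s : ι → α) (P : α → Prop)
    [DecidablePred P] : #{i ∈ F | P (s i)} = (F.val.map s).countP P := by
  rw [Multiset.countP_map]
  rfl

lemma Finset.filter_val_map {ι α : Type*} (F : Finset ι) (s : ι → α) (P : α → Prop)
    [DecidablePred P] : ({i ∈ F | P (s i)} : Finset ι).val.map s = (F.val.map s).filter P := by
  rw [Multiset.filter_map]
  rfl

lemma Multiset.map_eq_replicate {ι α : Type*} {F : Multiset ι} {s : ι → α} {c : α}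
    (h : ∀ i ∈ F, s i = c) : F.map s = Multiset.replicate (Multiset.card F) c := by
  rw [Multiset.map_congr rfl h, Multiset.map_const']

lemma ZMod.isUnit_natCast_sub_iff {m : ℕ} (a b : ℕ) :
    IsUnit ((a : ZMod m) - b) ↔ Int.gcd ((a : ℤ) - b) m = 1 := by
  have := ZMod.coe_int_isUnit_iff_isCoprime ((a : ℤ) - b) m
  push_cast at this
  rw [this, isCoprime_comm, Int.isCoprime_iff_gcd_eq_one]

/-! ### From coordinate families to the stated sequences. -/

namespace MetacyclicGroup

section Extremal

variable {p m : ℕ} {r : ℤ} [hp : Fact p.Prime] [NeZero m] (hr : (r : ZMod m) ^ p = 1)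
  (hr' : IsUnit ((r : ZMod m) - 1)) {ι : Type*} [DecidableEq ι]

lemma isGenericExtremal_of_family (hm : 2 ≤ m) {s : ι → MetacyclicGroup p m r} {F : Finset ι}
    (h : IsGenericFamily (fun i => coords hr hr' (s i)) F) :
    IsGenericExtremal p m r (F.val.map s) := by
  obtain ⟨hO, ⟨a, ha, hcl⟩, c₁, c₂, k₁, k₂, hc, hk₁, hk₂, hk, h₁, h₂, hall⟩ := h
  beta_reduce at hO hcl h₁ h₂ hall
  have hp2 := hp.out.two_le
  have hm0 := NeZero.pos m
  set O := {i ∈ F | (coords hr hr' (s i)).1 ≠ 0} with hOdef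
  set I := {i ∈ F | (coords hr hr' (s i)).1 = 0} with hIdef
  obtain ⟨e, he⟩ := Multiset.exists_map_fin_eq (S := O.val) (n := p - 1) (by
    change #O = p - 1
    omega)
  have hlt : ∀ {n : ℕ} [NeZero n] (z : ZMod n), z.val ≤ n - 1 := fun z => by
    have := ZMod.val_lt z
    omega
  have hinner : ∀ {i : ι} {c : ZMod m}, i ∈ I → (coords hr hr' (s i)).2 = c →
      s i = y p m r ^ c.val := by
    intro i c hi hic
    rw [x_pow_mul_y_pow_coords hr hr' (s i), hic, (mem_filter.1 hi).2, ZMod.val_zero, pow_zero,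
      one_mul]
  refine ⟨a.val, fun k => (coords hr hr' (s (e k))).2.val, c₁.val, c₂.val, k₁, k₂,
    ⟨Nat.one_le_iff_ne_zero.2 fun h => ha ((ZMod.val_eq_zero a).1 h), hlt a⟩, fun k => hlt _,
    hlt _, hlt _, ?_, hk₁, hk₂, hk, ?_⟩
  · rw [← ZMod.isUnit_natCast_sub_iff, ZMod.natCast_zmod_val, ZMod.natCast_zmod_val]
    exact hc
  · have e₁ : F.val.map s = O.val.map s + I.val.map s := by
      rw [← Multiset.map_add, add_comm]
      exact congrArg _ (Multiset.filter_add_not _ F.val).symm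
    have e₂ : I.val.map s = ({i ∈ I | (coords hr hr' (s i)).2 = c₁} : Finset ι).val.map s +
        ({i ∈ I | ¬ (coords hr hr' (s i)).2 = c₁} : Finset ι).val.map s := by
      rw [← Multiset.map_add]
      exact congrArg _ (Multiset.filter_add_not _ I.val).symm
    have h₂' : #{i ∈ I | ¬ (coords hr hr' (s i)).2 = c₁} + 1 = k₂ * m := by
      have h3 := card_filter_add_card_filter_not (s := I) (fun i => (coords hr hr' (s i)).2 = c₁)
      have h4 : #{i ∈ I | ¬ (coords hr hr' (s i)).2 = c₁} ≤
          #{i ∈ I | (coords hr hr' (s i)).2 = c₂} := card_le_card fun i hi => by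
        rw [mem_filter] at hi ⊢
        exact ⟨hi.1, (hall i hi.1).resolve_left hi.2⟩
      have hne : c₂ ≠ c₁ := by
        rintro rfl
        rw [sub_self, isUnit_zero_iff] at hc
        have : Fact (1 < m) := ⟨by omega⟩
        exact zero_ne_one hc
      have h5 : #{i ∈ I | (coords hr hr' (s i)).2 = c₂} ≤
          #{i ∈ I | ¬ (coords hr hr' (s i)).2 = c₁} := card_le_card fun i hi => by
        rw [mem_filter] at hi ⊢
        exact ⟨hi.1, by rw [hi.2]; exact hne⟩
      omega
    rw [e₁, e₂, ← he, Multiset.map_map, ← add_assoc]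
    congr 1
    · congr 1
      · refine Multiset.map_congr rfl fun k _ => ?_
        have hk : e k ∈ O := by
          rw [← Finset.mem_val, ← he]
          exact Multiset.mem_map_of_mem _ (mem_univ k)
        have hk' := mem_filter.1 hk
        rw [Function.comp_apply, ← hcl _ hk'.1 hk'.2]
        exact x_pow_mul_y_pow_coords hr hr' _
      · rw [Multiset.map_eq_replicate (c := y p m r ^ c₁.val) fun i hi => ?_]
        · congr 1
          change #{i ∈ I | _} = _
          omega
        · have := mem_filter.1 (Finset.mem_def.2 hi)
          exact hinner this.1 this.2
    · rw [Multiset.map_eq_replicate (c := y p m r ^ c₂.val) fun i hi => ?_]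
      · congr 1
        change #{i ∈ I | _} = _
        omega
      · have := mem_filter.1 (Finset.mem_def.2 hi)
        exact hinner this.1 ((hall i this.1).resolve_left this.2)

lemma family_of_isGenericExtremal (hm : 2 ≤ m) {s : ι → MetacyclicGroup p m r} {F : Finset ι}
    (h : IsGenericExtremal p m r (F.val.map s)) :
    IsGenericFamily (fun i => coords hr hr' (s i)) F := by
  obtain ⟨a, b, c₁, c₂, k₁, k₂, ⟨ha, ha'⟩, -, -, -, hc, hk₁, hk₂, hk, hS⟩ := h
  have hp2 := hp.out.two_le
  have : Fact (1 < m) := ⟨by omega⟩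
  rw [← ZMod.isUnit_natCast_sub_iff] at hc
  have ha0 : (a : ZMod p) ≠ 0 := by
    rw [Ne, ZMod.natCast_eq_zero_iff]
    exact fun h => absurd (Nat.le_of_dvd (by omega) h) (by omega)
  have hne : (c₁ : ZMod m) ≠ c₂ := by
    intro h
    rw [h, sub_self, isUnit_zero_iff] at hc
    exact zero_ne_one hc
  have hcount : ∀ (P : ZMod p × ZMod m → Prop) [DecidablePred P],
      #{i ∈ F | P (coords hr hr' (s i))} =
        (univ : Finset (Fin (p - 1))).val.countP (fun i => P ((a : ZMod p), (b i : ZMod m))) +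
        (if P (0, (c₁ : ZMod m)) then k₁ * m - 1 else 0) +
        (if P (0, (c₂ : ZMod m)) then k₂ * m - 1 else 0) := by
    intro P _
    have hrep : ∀ n c : ℕ, (Multiset.replicate n (y p m r ^ c)).countP (fun g => P (coords hr hr' g)) =
        if P (0, (c : ZMod m)) then n else 0 := by
      intro n c
      split_ifs with h
      · rw [Multiset.countP_eq_card.2, Multiset.card_replicate]
        intro g hg
        rw [Multiset.eq_of_mem_replicate hg, coords_y_pow]
        exact h
      · rw [Multiset.countP_eq_zero]
        intro g hg
        rw [Multiset.eq_of_mem_replicate hg, coords_y_pow]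
        exact h
    rw [F.card_filter_eq_countP s (fun g => P (coords hr hr' g)), hS, Multiset.countP_add,
      Multiset.countP_add, hrep, hrep, Multiset.countP_map, Multiset.countP_eq_card_filter]
    simp only [coords_x_pow_mul_y_pow]
  have hforall : ∀ i ∈ F, (∃ k, coords hr hr' (s i) = ((a : ZMod p), (b k : ZMod m))) ∨
      coords hr hr' (s i) = (0, (c₁ : ZMod m)) ∨ coords hr hr' (s i) = (0, (c₂ : ZMod m)) := by
    intro i hi
    have h1 : s i ∈ F.val.map s := Multiset.mem_map_of_mem _ hi
    rw [hS, Multiset.mem_add, Multiset.mem_add, Multiset.mem_map] at h1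
    rcases h1 with (⟨k, -, hk⟩ | h1) | h1
    · exact Or.inl ⟨k, by rw [← hk, coords_x_pow_mul_y_pow]⟩
    · exact Or.inr (Or.inl (by rw [Multiset.eq_of_mem_replicate h1, coords_y_pow]))
    · exact Or.inr (Or.inr (by rw [Multiset.eq_of_mem_replicate h1, coords_y_pow]))
  have hkm : ∀ k, 1 ≤ k → 1 ≤ k * m := fun k hk => Nat.mul_pos hk (by omega)
  have hout : ∀ c, (univ : Finset (Fin (p - 1))).val.countP
      (fun k => ((a : ZMod p), (b k : ZMod m)).1 = 0 ∧ ((a : ZMod p), (b k : ZMod m)).2 = c) = 0 :=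
    fun c => Multiset.countP_eq_zero.2 fun k _ h => ha0 h.1
  refine ⟨?_, ⟨a, ha0, fun i hi hi0 => ?_⟩, c₁, c₂, k₁, k₂, hc, hk₁, hk₂, hk, ?_, ?_,
    fun i hi => ?_⟩
  · rw [hcount (fun v => v.1 ≠ 0), Multiset.countP_eq_card.2 fun _ _ => ha0]
    simp
    omega
  · beta_reduce at hi0 ⊢
    rcases hforall i hi with ⟨k, hk⟩ | h | h
    · rw [hk]
    · rw [h] at hi0
      exact absurd rfl hi0
    · rw [h] at hi0
      exact absurd rfl hi0
  · rw [filter_filter, hcount (fun v => v.1 = 0 ∧ v.2 = (c₁ : ZMod m)), hout]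
    simp [hne.symm]
    have := hkm k₁ hk₁
    omega
  · rw [filter_filter, hcount (fun v => v.1 = 0 ∧ v.2 = (c₂ : ZMod m)), hout]
    simp [hne]
    have := hkm k₂ hk₂
    omega
  · obtain ⟨hiF, hi0⟩ := mem_filter.1 hi
    beta_reduce at hi0 ⊢
    rcases hforall i hiF with ⟨k, hk⟩ | h | h
    · rw [hk] at hi0
      exact absurd hi0 ha0
    · exact Or.inl (by rw [h])
    · exact Or.inr (by rw [h])

end Extremal

section OrderSix

variable {r : ℤ} [NeZero 3] (hr : (r : ZMod 3) ^ 2 = 1)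
  (hr' : IsUnit ((r : ZMod 3) - 1)) {ι : Type*} [DecidableEq ι]

lemma eq_of_exceptional_family {s : ι → MetacyclicGroup 2 3 r} {F : Finset ι} (hF : #F = 8)
    (h : IsExceptionalFamily (fun i => coords hr hr' (s i)) F) :
    F.val.map s = {x 2 3 r, x 2 3 r * y 2 3 r, x 2 3 r * y 2 3 r ^ 2} + Multiset.replicate 5 1 := by
  obtain ⟨-, -, hO, hinj, h0⟩ := h
  beta_reduce at hO hinj h0
  set O := {i ∈ F | (coords hr hr' (s i)).1 ≠ 0} with hOdef
  have hI := card_filter_add_card_filter_not (s := F) (fun i => (coords hr hr' (s i)).1 = 0)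
  have e₁ : F.val.map s = O.val.map s +
      ({i ∈ F | (coords hr hr' (s i)).1 = 0} : Finset ι).val.map s := by
    rw [← Multiset.map_add, add_comm]
    exact congrArg _ (Multiset.filter_add_not _ F.val).symm
  -- Three distinct elements exhaust ℤ/3, so the outer terms are exactly x, xy and xy².
  have himg : O.image (fun i => (coords hr hr' (s i)).2) = univ := by
    apply Finset.eq_univ_of_card
    rw [card_image_of_injOn hinj, hO, ZMod.card]
  have e₂ : O.val.map (fun i => (coords hr hr' (s i)).2) = (univ : Finset (ZMod 3)).val := by
    rw [← image_val_of_injOn hinj, himg]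
  have e₃ : O.val.map s = (univ : Finset (ZMod 3)).val.map fun z => x 2 3 r * y 2 3 r ^ z.val := by
    rw [← e₂, Multiset.map_map]
    refine Multiset.map_congr rfl fun i hi => ?_
    have hi0 := (mem_filter.1 (Finset.mem_def.2 hi)).2
    have h1 : (coords hr hr' (s i)).1 = 1 :=
      ZMod.eq_of_ne_zero_of_ne_zero _ _ hi0 one_ne_zero
    have h2 := x_pow_mul_y_pow_coords hr hr' (s i)
    rw [h1, ZMod.val_one, pow_one] at h2
    exact h2
  have e₄ : (univ : Finset (ZMod 3)).val = {0, 1, 2} := rfl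
  have e₅ : ({0, 1, 2} : Multiset (ZMod 3)).map (fun z => x 2 3 r * y 2 3 r ^ z.val) =
      {x 2 3 r, x 2 3 r * y 2 3 r, x 2 3 r * y 2 3 r ^ 2} := by
    change ({x 2 3 r * y 2 3 r ^ 0, x 2 3 r * y 2 3 r ^ 1, x 2 3 r * y 2 3 r ^ 2} : Multiset _) = _
    rw [pow_zero, mul_one, pow_one]
  rw [e₁, e₃, e₄, e₅]
  congr 1
  · rw [Multiset.map_eq_replicate (c := 1) fun i hi => ?_]
    · congr 1
      change #{i ∈ F | _} = _
      simp only [hOdef, ne_eq] at hO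
      omega
    · obtain ⟨hiF, hi0⟩ := mem_filter.1 (Finset.mem_def.2 hi)
      apply coords_injective hr hr'
      rw [coords_one]
      exact Prod.ext hi0 (h0 i hiF hi0)

lemma exceptional_family_of_eq {s : ι → MetacyclicGroup 2 3 r} {F : Finset ι}
    (hS : F.val.map s =
      {x 2 3 r, x 2 3 r * y 2 3 r, x 2 3 r * y 2 3 r ^ 2} + Multiset.replicate 5 1) :
    IsExceptionalFamily (fun i => coords hr hr' (s i)) F := by
  have c₁ : coords hr hr' (x 2 3 r) = (1, 0) := by
    have := coords_x_pow_mul_y_pow hr hr' 1 0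
    simpa using this
  have c₂ : coords hr hr' (x 2 3 r * y 2 3 r) = (1, 1) := by
    have := coords_x_pow_mul_y_pow hr hr' 1 1
    simpa using this
  have c₃ : coords hr hr' (x 2 3 r * y 2 3 r ^ 2) = (1, 2) := by
    have := coords_x_pow_mul_y_pow hr hr' 1 2
    simpa using this
  have hfilter : ({i ∈ F | (coords hr hr' (s i)).1 ≠ 0} : Finset ι).val.map s =
      {x 2 3 r, x 2 3 r * y 2 3 r, x 2 3 r * y 2 3 r ^ 2} := by
    rw [F.filter_val_map s (fun g => (coords hr hr' g).1 ≠ 0), hS, Multiset.filter_add,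
      Multiset.filter_eq_self.2, Multiset.filter_eq_nil.2, add_zero]
    · intro g hg
      rw [Multiset.eq_of_mem_replicate hg, coords_one]
      simp
    · intro g hg
      simp only [Multiset.insert_eq_cons, Multiset.mem_cons, Multiset.mem_singleton] at hg
      rcases hg with rfl | rfl | rfl
      · rw [c₁]; exact one_ne_zero
      · rw [c₂]; exact one_ne_zero
      · rw [c₃]; exact one_ne_zero
  refine ⟨rfl, rfl, ?_, ?_, ?_⟩
  · have := congrArg Multiset.card hfilter
    rwa [Multiset.card_map] at this
  · have h1 := congrArg (Multiset.map fun g => (coords hr hr' g).2) hfilter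
    rw [Multiset.map_map] at h1
    simp only [Multiset.insert_eq_cons, Multiset.map_cons, Multiset.map_singleton, c₁, c₂, c₃] at h1
    have hnd : (0 ::ₘ 1 ::ₘ {2} : Multiset (ZMod 3)).Nodup := by decide
    rw [← h1] at hnd
    intro i hi k hk hik
    exact Multiset.inj_on_of_nodup_map hnd i hi k hk hik
  · intro i hi hi0
    have h1 : s i ∈ F.val.map s := Multiset.mem_map_of_mem _ hi
    rw [hS, Multiset.mem_add] at h1
    rcases h1 with h1 | h1
    · rw [← hfilter, Multiset.mem_map] at h1
      obtain ⟨k, hk, hks⟩ := h1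
      have := (mem_filter.1 (Finset.mem_def.2 hk)).2
      rw [hks] at this
      exact absurd hi0 this
    · change (coords hr hr' (s i)).2 = 0
      rw [Multiset.eq_of_mem_replicate h1, coords_one]
      rfl

/-- The generic extremal sequences over the group of order six. -/
lemma isGenericExtremal_two_three_iff {S : Multiset (MetacyclicGroup 2 3 r)} :
    IsGenericExtremal 2 3 r S ↔ ∃ b c₁ c₂ : ℕ, b ≤ 2 ∧ c₁ ≤ 2 ∧ c₂ ≤ 2 ∧
      Int.gcd ((c₁ : ℤ) - (c₂ : ℤ)) 3 = 1 ∧ S = {x 2 3 r * y 2 3 r ^ b} +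
        Multiset.replicate 5 (y 2 3 r ^ c₁) + Multiset.replicate 2 (y 2 3 r ^ c₂) := by
  have huniv : ∀ f : Fin (2 - 1) → MetacyclicGroup 2 3 r,
      (univ : Finset (Fin (2 - 1))).val.map f = {f 0} := fun f => rfl
  constructor
  · rintro ⟨a, b, c₁, c₂, k₁, k₂, ⟨ha, ha'⟩, hb, hc₁, hc₂, hc, hk₁, hk₂, hk, rfl⟩
    obtain rfl : a = 1 := by omega
    rw [huniv, pow_one]
    obtain rfl | rfl : k₁ = 1 ∨ k₁ = 2 := by omega
    · obtain rfl : k₂ = 2 := by omega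
      -- For k₁ = 1 the roles of the two constants are exchanged.
      refine ⟨b 0, c₂, c₁, hb 0, hc₂, hc₁, ?_, add_right_comm _ _ _⟩
      rwa [← neg_sub, Int.neg_gcd]
    · obtain rfl : k₂ = 1 := by omega
      exact ⟨b 0, c₁, c₂, hb 0, hc₁, hc₂, hc, rfl⟩
  · rintro ⟨b, c₁, c₂, hb, hc₁, hc₂, hc, rfl⟩
    refine ⟨1, fun _ => b, c₁, c₂, 2, 1, by omega, fun _ => hb, hc₁, hc₂, hc, by omega, by omega,
      by omega, ?_⟩
    rw [huniv, pow_one]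

end OrderSix

end MetacyclicGroup

lemma ZMod.eq_two_of_sq_eq_one : ∀ z : ZMod 3, z ^ 2 = 1 → z - 1 ≠ 0 → z = 2 := by decide

lemma IsCardProductOneFree.mono {G : Type*} [Group G] {S T : Multiset G}
    (hS : IsCardProductOneFree S) (hTS : T ≤ S) : IsCardProductOneFree T := by
  rintro ⟨U, hU, h⟩
  exact hS ⟨U, hU.trans hTS, h⟩

/-! ### The value of the constant and the characterisation. -/

namespace MetacyclicGroup

variable {p m : ℕ} {r : ℤ} [hp : Fact p.Prime] [NeZero m] (hr : (r : ZMod m) ^ p = 1)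
  (hr' : IsUnit ((r : ZMod m) - 1))
include hr hr'

/-- Comparing orders gives mp = 6 with m odd and p prime. Conversely r ≡ 2 modulo 3, so the two
presentations satisfy each other's relations. -/
lemma isIsoC2C3_iff : IsIsoC2C3 (MetacyclicGroup p m r) ↔ p = 2 ∧ m = 3 := by
  constructor
  · rintro ⟨e⟩
    have h1 := Nat.card_congr e.toEquiv
    have h2 : IsUnit (((2 : ℤ) : ZMod 3) - 1) := by
      have : ((2 : ℤ) : ZMod 3) - 1 = 1 := by decide
      rw [this]
      exact isUnit_one
    rw [natCard hr hr', natCard (p := 2) (m := 3) (r := 2) (by decide) h2] at h1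
    obtain ⟨k, rfl⟩ := (isWeight_weight hr hr').odd_modulus
    have hk : k < 3 := by
      have := Nat.mul_le_mul_left (2 * k + 1) hp.out.two_le
      omega
    interval_cases k
    · have := hp.out
      rw [show p = 6 by omega] at this
      exact absurd this (by decide)
    · omega
    · omega
  · rintro ⟨rfl, rfl⟩
    have h : (r : ZMod 3) = 2 := ZMod.eq_two_of_sq_eq_one _ hr hr'.ne_zero
    have key : ∀ t : ℤ, y 2 3 t ^ (2 : ℤ) = y 2 3 t ^ r := fun t => by
      rw [zpow_eq_pow_val (y_pow (p := 2) (r := t)) 2, zpow_eq_pow_val (y_pow (p := 2) (r := t)) r,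
        h]
      rfl
    have h₁ : (x 2 3 2)⁻¹ * y 2 3 2 * x 2 3 2 = y 2 3 2 ^ r := by rw [conj_y, key]
    have h₂ : (x 2 3 r)⁻¹ * y 2 3 r * x 2 3 r = y 2 3 r ^ (2 : ℤ) := by rw [conj_y, key]
    refine ⟨MonoidHom.toMulEquiv (lift _ _ x_pow y_pow h₁) (lift _ _ x_pow y_pow h₂) ?_ ?_⟩
    · refine PresentedGroup.ext fun b => ?_
      cases b
      · change lift _ _ x_pow y_pow h₂ (lift _ _ x_pow y_pow h₁ (x 2 3 r)) = x 2 3 r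
        rw [lift_x, lift_x]
      · change lift _ _ x_pow y_pow h₂ (lift _ _ x_pow y_pow h₁ (y 2 3 r)) = y 2 3 r
        rw [lift_y, lift_y]
    · refine PresentedGroup.ext fun b => ?_
      cases b
      · change lift _ _ x_pow y_pow h₁ (lift _ _ x_pow y_pow h₂ (x 2 3 2)) = x 2 3 2
        rw [lift_x, lift_x]
      · change lift _ _ x_pow y_pow h₁ (lift _ _ x_pow y_pow h₂ (y 2 3 2)) = y 2 3 2
        rw [lift_y, lift_y]

/-- The extremal sequences. -/
theorem isCardProductOneFree_iff_extremal (hm : 2 ≤ m) {S : Multiset (MetacyclicGroup p m r)}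
    (hS : S.card + 3 = m * p + m + p) : IsCardProductOneFree S ↔
      (¬ IsIsoC2C3 (MetacyclicGroup p m r) ∧ IsGenericExtremal p m r S) ∨
        (IsIsoC2C3 (MetacyclicGroup p m r) ∧ IsExceptionalExtremal p m r S) := by
  obtain ⟨n, hn⟩ : ∃ n, S.card = n := ⟨_, rfl⟩
  obtain ⟨s, hs⟩ := Multiset.exists_map_fin_eq hn
  set F := (univ : Finset (Fin n)) with hF
  have hFc : #F = S.card := by rw [hF, card_univ, Fintype.card_fin, hn]
  clear_value F
  have hω := isWeight_weight hr hr'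
  have hfree : IsCardProductOneFree S ↔ IsGenericFamily (fun i => coords hr hr' (s i)) F ∨
      IsExceptionalFamily (fun i => coords hr hr' (s i)) F := by
    rw [← hs, isCardProductOneFree_iff hr hr']
    refine ⟨fun h => hω.isGenericFamily_or_isExceptionalFamily hm (by omega) h, ?_⟩
    rintro (h | h)
    · exact h.productOneFree hω
    · refine h.productOneFree hω ?_
      have h1 := h.1
      have h2 : m * p = 6 := by rw [h1, h.2.1]
      have h3 := h.2.1
      omega
  have hgen : IsGenericFamily (fun i => coords hr hr' (s i)) F ↔ IsGenericExtremal p m r S := by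
    rw [← hs]
    exact ⟨isGenericExtremal_of_family hr hr' hm, family_of_isGenericExtremal hr hr' hm⟩
  rw [isIsoC2C3_iff hr hr', hfree, hgen]
  -- In order six the generic form is the second exceptional form, and the exceptional family is the
  -- first; in all other cases the latter does not occur.
  by_cases h : p = 2 ∧ m = 3
  · obtain ⟨rfl, rfl⟩ := h
    have hexc : IsExceptionalFamily (fun i => coords hr hr' (s i)) F ↔
        S = {x 2 3 r, x 2 3 r * y 2 3 r, x 2 3 r * y 2 3 r ^ 2} + Multiset.replicate 5 1 := by
      refine ⟨fun h => ?_, fun h => exceptional_family_of_eq hr hr' (hs.trans h)⟩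
      rw [← eq_of_exceptional_family hr hr' (by omega) h, hs]
    rw [hexc, isGenericExtremal_two_three_iff, IsExceptionalExtremal, or_comm]
    simp
  · have hexc : ¬ IsExceptionalFamily (fun i => coords hr hr' (s i)) F := fun h' =>
      h ⟨h'.1, h'.2.1⟩
    tauto

theorem egzConstant_eq (hm : 2 ≤ m) :
    egzConstant (MetacyclicGroup p m r) = m * p + m + p - 2 := by
  have hω := isWeight_weight hr hr'
  have hp2 := hp.out.two_le
  have hmp : 2 * 2 ≤ m * p := Nat.mul_le_mul hm hp2
  refine IsLeast.csInf_eq ⟨fun S hS => ?_, fun t ht => ?_⟩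
  · by_contra hfree
    obtain ⟨s, hs⟩ := Multiset.exists_map_fin_eq (S := S) rfl
    rw [← hs] at hfree
    refine hω.not_productOneFree hm ?_ ((isCardProductOneFree_iff hr hr' _ _).1 hfree)
    rw [card_univ, Fintype.card_fin]
    omega
  · by_contra hlt
    -- A generic extremal sequence with k₁ = 1 and k₂ = p; any t of its terms refute a smaller
    -- constant t.
    set S : Multiset (MetacyclicGroup p m r) :=
      (univ : Finset (Fin (p - 1))).val.map (fun _ => x p m r ^ 1 * y p m r ^ 0)
        + Multiset.replicate (1 * m - 1) (y p m r ^ 1)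
        + Multiset.replicate (p * m - 1) (y p m r ^ 0) with hS
    have hgen : IsGenericExtremal p m r S :=
      ⟨1, fun _ => 0, 1, 0, 1, p, by omega, fun _ => Nat.zero_le _, by omega, by omega, by simp,
        le_rfl, by omega, by omega, rfl⟩
    have hfree : IsCardProductOneFree S := by
      obtain ⟨s, hs⟩ := Multiset.exists_map_fin_eq (S := S) rfl
      rw [← hs] at hgen ⊢
      exact (isCardProductOneFree_iff hr hr' _ _).2
        ((family_of_isGenericExtremal hr hr' hm hgen).productOneFree hω)
    have hSc : S.card + 3 = m * p + m + p := by
      rw [hS, Multiset.card_add, Multiset.card_add, Multiset.card_map, Multiset.card_replicate,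
        Multiset.card_replicate, ← Finset.card_def, card_univ, Fintype.card_fin, mul_comm p m]
      omega
    have hTS : ((S.toList.take t : List _) : Multiset (MetacyclicGroup p m r)) ≤ S := by
      conv_rhs => rw [← S.coe_toList]
      exact (List.take_sublist _ _).subperm
    refine hfree.mono hTS (ht _ ?_)
    rw [Multiset.coe_card, List.length_take, Multiset.length_toList]
    omega

end MetacyclicGroup

theorem theorem1p2 (p m : ℕ) (r : ℤ) (hm : 2 ≤ m)
    (hr : r ^ p ≡ 1 [ZMOD (m : ℤ)])
    (hp : IsLeast {q : ℕ | q.Prime ∧ q ∣ Nat.card (MetacyclicGroup p m r)} p)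
    (hgcd : Int.gcd ((p : ℤ) * (r - 1)) (m : ℤ) = 1) :
    egzConstant (MetacyclicGroup p m r) - 1 = m * p + m + p - 3 ∧
    ∀ S : Multiset (MetacyclicGroup p m r),
      S.card = egzConstant (MetacyclicGroup p m r) - 1 →
        (IsCardProductOneFree S ↔
          (¬ IsIsoC2C3 (MetacyclicGroup p m r) ∧ IsGenericExtremal p m r S) ∨
          (IsIsoC2C3 (MetacyclicGroup p m r) ∧ IsExceptionalExtremal p m r S)) := by
  have : Fact p.Prime := ⟨hp.1.1⟩
  have : NeZero m := ⟨by omega⟩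
  have hr₁ : (r : ZMod m) ^ p = 1 := by
    have := (ZMod.intCast_eq_intCast_iff _ _ _).2 hr
    simpa using this
  have hr₂ : IsUnit ((r : ZMod m) - 1) := by
    have h := (ZMod.coe_int_isUnit_iff_isCoprime (r - 1) m).2
      ((Int.isCoprime_iff_gcd_eq_one.2 hgcd).of_mul_left_right.symm)
    push_cast at h
    exact h
  have hp2 := hp.1.1.two_le
  have hE := MetacyclicGroup.egzConstant_eq hr₁ hr₂ hm
  refine ⟨by omega, fun S hS => MetacyclicGroup.isCardProductOneFree_iff_extremal hr₁ hr₂ hm ?_⟩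
  omega
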